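/- Fix $T>0$ and $p>1$. **Setting (junction).** Let $N>1$, let $(e_i)_{1\le i\le N}$ be the canonical basis of $\mathbb R^N$, $J_i=\mathbb R_+e_i$ and $\mathcal G=\bigcup_iJ_i$. For $x\in\mathcal G$ and $t\in[0,T]$, let $\Gamma_t[x]$ be the set of all $y\in C([t,T];\mathcal G)\cap W^{1,p}(t,T;\mathbb R^N)$ with $y(t)=x$. Running costs $\ell_i\in C(\mathbb R_+\times\mathbb R\times[0,T])$ are given such that $\ell_i(\cdot,\cdot,s)$ is differentiable for every $s$ and $\partial_y\ell_i,\partial_a\ell_i$ are continuous in $(y,a,s)$, together with $\ell_*\in C([0,T])$, bounded continuous functions $g_i:\mathbb R_+\to\mathbb R$, and $g_*\in\mathbb R$. For $y\in\Gamma_t[x]$ put $$J_t(x;y)=\int_t^TL(y(s),y'(s),s)\,ds+g(y(T)),$$ where, for $z\in J_i\setminus\{0\}$, $L(z,a,s)=\ell_i(|z|,a\cdot e_i,s)$ and $g(z)=g_i(|z|)$, while $L(0,a,s)=\min\{\ell_*(s),\min_i\ell_i(0,0,s)\}$ and $g(0)=\min\{g_*,\min_ig_i(0)\}$. A trajectory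 $y\in\Gamma_t[x]$ is optimal if it minimizes $J_t(x;\cdot)$ on $\Gamma_t[x]$. **Assumptions.** * [H1] There are $C_0>0$ and $c_0\in\mathbb R$ with $\ell_i(y,a,s)\ge C_0|a|^p+c_0$ and $\ell_*(s)\ge c_0$ for all $i,y,a,s$. * [H2] For every $r>0$ there is a modulus of continuity $\omega_r$ with $|\ell_i(y,a,t_1)-\ell_i(y,a,t_2)|\le(1+|a|^p)\,\omega_r(|t_1-t_2|)$ for all $i$, $y\in[0,r]$, $a\in\mathbb R$, $t_1,t_2\in[0,T]$. * [H3] For every $r>0$ there is $\tilde c(r)\ge0$ with $|\partial_y\ell_i(y,a,s)|\le\tilde c(r)(|a|^p+1)$ and $|\partial_a\ell_i(y,a,s)|\le\tilde c(r)(|a|^{p-1}+1)$ for all $i$, $y\in[0,r]$, $a\in\mathbb R$, $s\in[0,T]$. * [H4] $a\mapsto\ell_i(y,a,s)$ is strictly convex for all $i,y,s$. * [H5] $g_i\in C^1(\mathbb R_+)$ for all $i$. **Theorem.** Under [H1]–[H5], for every $(x,t)\in\mathcal G\times[0,T]$ and every optimal trajectory $y\in\Gamma_t[x]$, the weak derivative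 $y'$ belongs to $L^\infty(t,T;\mathbb R^N)$. Moreover, for fixed data ($T$, $p$ and the costs) there is a positive function $V(r,\tau)$, nondecreasing in $r$ and nonincreasing in $\tau>0$ (it may blow up as $\tau\to0$), such that $$\|y'\|_{L^\infty(t,T)}\le V(|x|,T-t)$$ for all such $x$, $t$ and $y$. The same holds on general networks, in the following sense. A network $\mathcal N\subset\mathbb R^d$ is a connected union of finitely many distinct vertices $O_1,\dots,O_n$ and finitely many straight edges $J_1,\dots,J_N$. Edge $J_i$ has length $l_i\in(0,\infty]$ and arc-length parametrization $\pi_i(r)=O_{k_i}+r\,e_i$, $|e_i|=1$, $r\in[0,l_i]$ (or $r\in[0,\infty)$ if $l_i=\infty$); if $l_i<\infty$, then $\pi_i(l_i)$ is a vertex. The only vertices on an edge are its endpoints, and two different edges meet in at most one point, which is a vertex. Admissible and optimal trajectories are defined as above with $\mathcal N\subset\mathbb R^d$ in place of $\mathcal G\subset\mathbb R^N$. The functions $\ell_i,g_i$ are now defined for positions in $[0,l_i]$ (in $[0,\infty)$ if $l_i=\infty$), there are vertex costs $\ell_{*j}\in C([0,T])$, $g_{*j}\in\mathbb R$, and the same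 assumptions are made, with $\ell_{*j}(s)\ge c_0$ for every $j$. For $z$ in $J_i$ and not a vertex, $L(z,a,s)=\ell_i(\pi_i^{-1}(z),a\cdot e_i,s)$ and $g(z)=g_i(\pi_i^{-1}(z))$; at a vertex, $L(O_j,a,s)=\min\{\ell_{*j}(s),\min_{i:O_j\in J_i}\ell_i(\pi_i^{-1}(O_j),0,s)\}$ and $g(O_j)=\min\{g_{*j},\min_{i:O_j\in J_i}g_i(\pi_i^{-1}(O_j))\}$. -/

import Mathlib

open MeasureTheory Set

namespace NetworkControl

/-! ### Sobolev trajectories on a time interval -/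

/-- `v` is the weak derivative of `y` on the open interval `(a, b)`. -/
def HasWeakDerivOn {d : ℕ} (y v : ℝ → EuclideanSpace ℝ (Fin d)) (a b : ℝ) : Prop :=
  ∀ φ : ℝ → ℝ, ContDiff ℝ (⊤ : ℕ∞) φ → HasCompactSupport φ → tsupport φ ⊆ Ioo a b →
    ∫ s in Ioo a b, deriv φ s • y s = -∫ s in Ioo a b, φ s • v s

/-- `y` belongs to `W^{1,p}(a, b; ℝ^d)` and `v` represents its weak derivative. -/
structure MemW1p {d : ℕ} (p : ℝ) (y v : ℝ → EuclideanSpace ℝ (Fin d)) (a b : ℝ) : Prop where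
  memLp : MemLp y (ENNReal.ofReal p) (volume.restrict (Ioo a b))
  memLp_deriv : MemLp v (ENNReal.ofReal p) (volume.restrict (Ioo a b))
  weakDeriv : HasWeakDerivOn y v a b

/-- `y` is an admissible trajectory in `G` starting from `x` at time `t`, that is
`y ∈ C([t, T]; G) ∩ W^{1,p}(t, T; ℝ^d)` and `y t = x`; `v` represents the weak derivative `y'`.
The values of `y` and `v` outside `[t, T]` are irrelevant. -/
structure IsTrajectory {d : ℕ} (p T : ℝ) (G : Set (EuclideanSpace ℝ (Fin d)))
    (x : EuclideanSpace ℝ (Fin d)) (t : ℝ) (y v : ℝ → EuclideanSpace ℝ (Fin d)) : Prop where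
  continuousOn : ContinuousOn y (Icc t T)
  mapsTo : MapsTo y (Icc t T) G
  memW1p : MemW1p p y v t T
  start : y t = x

/-- The cost `∫_t^T L(y, y', s) ds + g(y(T))` of a trajectory `y` with `y' = v`. -/
noncomputable def totalCost {d : ℕ} (T : ℝ)
    (L : EuclideanSpace ℝ (Fin d) → EuclideanSpace ℝ (Fin d) → ℝ → ℝ)
    (g : EuclideanSpace ℝ (Fin d) → ℝ) (t : ℝ) (y v : ℝ → EuclideanSpace ℝ (Fin d)) : ℝ :=
  (∫ s in t..T, L (y s) (v s) s) + g (y T)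

/-- `y` (with `y' = v`) is an optimal trajectory in `G` starting from `x` at time `t`: it is
admissible, and it minimizes the cost among all admissible trajectories. -/
def IsOptimal {d : ℕ} (p T : ℝ) (G : Set (EuclideanSpace ℝ (Fin d)))
    (L : EuclideanSpace ℝ (Fin d) → EuclideanSpace ℝ (Fin d) → ℝ → ℝ)
    (g : EuclideanSpace ℝ (Fin d) → ℝ) (x : EuclideanSpace ℝ (Fin d)) (t : ℝ)
    (y v : ℝ → EuclideanSpace ℝ (Fin d)) : Prop :=
  IsTrajectory p T G x t y v ∧
    ∀ z w : ℝ → EuclideanSpace ℝ (Fin d), IsTrajectory p T G x t z w →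
      totalCost T L g t y v ≤ totalCost T L g t z w

/-! ### Assumptions on the costs

The running cost `ℓ i y a s` of edge `i` is a function of the position `y ∈ D i` on the edge
(an interval `[0, l]` or `[0, ∞)`), of the signed speed `a ∈ ℝ` and of the time `s ∈ [0, T]`. -/

/-- Modulus of continuity. -/
def IsModulus (ω : ℝ → ℝ) : Prop :=
  ω 0 = 0 ∧ MonotoneOn ω (Ici 0) ∧ ContinuousWithinAt ω (Ici 0) 0

/-- Partial derivative with respect to the position. -/
noncomputable def partialPos (D : Set ℝ) (ℓ : ℝ → ℝ → ℝ → ℝ) (y a s : ℝ) : ℝ :=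
  derivWithin (fun z => ℓ z a s) D y

/-- Partial derivative with respect to the speed. -/
noncomputable def partialSpeed (ℓ : ℝ → ℝ → ℝ → ℝ) (y a s : ℝ) : ℝ :=
  deriv (fun b => ℓ y b s) a

/-- `ℓ` is continuous on `D × ℝ × [0, T]`, each `ℓ(·, ·, s)` is differentiable on `D × ℝ`, and
the two partial derivatives are continuous on `D × ℝ × [0, T]`. -/
structure IsRegularRunningCost (T : ℝ) (D : Set ℝ) (ℓ : ℝ → ℝ → ℝ → ℝ) : Prop where
  continuousOn : ContinuousOn (fun q : ℝ × ℝ × ℝ => ℓ q.1 q.2.1 q.2.2) (D ×ˢ univ ×ˢ Icc 0 T)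
  differentiableOn : ∀ s ∈ Icc 0 T,
    DifferentiableOn ℝ (fun q : ℝ × ℝ => ℓ q.1 q.2 s) (D ×ˢ univ)
  continuousOn_partialPos :
    ContinuousOn (fun q : ℝ × ℝ × ℝ => partialPos D ℓ q.1 q.2.1 q.2.2) (D ×ˢ univ ×ˢ Icc 0 T)
  continuousOn_partialSpeed :
    ContinuousOn (fun q : ℝ × ℝ × ℝ => partialSpeed ℓ q.1 q.2.1 q.2.2) (D ×ˢ univ ×ˢ Icc 0 T)

/-- The standing assumptions on the running costs `ℓ i` of the edges and `ℓstar k` of the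
vertices: regularity, coercivity, uniform continuity in time, growth of the partial
derivatives, and strict convexity with respect to the speed. -/
structure RunningCostAssumptions {N n : ℕ} (p T : ℝ) (D : Fin N → Set ℝ)
    (ℓ : Fin N → ℝ → ℝ → ℝ → ℝ) (ℓstar : Fin n → ℝ → ℝ) : Prop where
  regular : ∀ i, IsRegularRunningCost T (D i) (ℓ i)
  continuousOn_star : ∀ k, ContinuousOn (ℓstar k) (Icc 0 T)
  coercive : ∃ C₀ c₀ : ℝ, 0 < C₀ ∧
    (∀ i, ∀ y ∈ D i, ∀ a : ℝ, ∀ s ∈ Icc 0 T, C₀ * |a| ^ p + c₀ ≤ ℓ i y a s) ∧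
    ∀ k, ∀ s ∈ Icc 0 T, c₀ ≤ ℓstar k s
  time_modulus : ∀ r : ℝ, 0 < r → ∃ ω : ℝ → ℝ, IsModulus ω ∧
    ∀ i, ∀ y ∈ D i ∩ Icc 0 r, ∀ a : ℝ, ∀ t₁ ∈ Icc 0 T, ∀ t₂ ∈ Icc 0 T,
      |ℓ i y a t₁ - ℓ i y a t₂| ≤ (1 + |a| ^ p) * ω |t₁ - t₂|
  deriv_growth : ∀ r : ℝ, 0 < r → ∃ c : ℝ, 0 ≤ c ∧
    ∀ i, ∀ y ∈ D i ∩ Icc 0 r, ∀ a : ℝ, ∀ s ∈ Icc 0 T,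
      |partialPos (D i) (ℓ i) y a s| ≤ c * (|a| ^ p + 1) ∧
      |partialSpeed (ℓ i) y a s| ≤ c * (|a| ^ (p - 1) + 1)
  strictConvex : ∀ i, ∀ y ∈ D i, ∀ s ∈ Icc 0 T, StrictConvexOn ℝ univ (fun a => ℓ i y a s)

/-- The terminal cost on each edge is bounded and continuously differentiable, up to the
endpoints of the edge. -/
structure TerminalCostAssumptions {N : ℕ} (D : Fin N → Set ℝ) (g : Fin N → ℝ → ℝ) : Prop where
  bounded : ∀ i, ∃ M : ℝ, ∀ y ∈ D i, |g i y| ≤ M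
  contDiffOn : ∀ i, ContDiffOn ℝ 1 (g i) (D i)

/-- `min {c, min_{i ∈ S} f i}`. -/
def minWith {N : ℕ} (c : ℝ) (S : Finset (Fin N)) (f : Fin N → ℝ) : ℝ := S.fold min c f

/-! ### Junctions -/

/-- The half-line `ℝ₊ e_i` of `ℝ^N`. -/
def junctionEdge {N : ℕ} (i : Fin N) : Set (EuclideanSpace ℝ (Fin N)) :=
  {x | ∃ r : ℝ, 0 ≤ r ∧ x = r • EuclideanSpace.single i (1 : ℝ)}

/-- The junction with `N` half-lines, as a subset of `ℝ^N`. -/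
def junction (N : ℕ) : Set (EuclideanSpace ℝ (Fin N)) := ⋃ i : Fin N, junctionEdge i

/-- Running cost on the junction: `ℓ_i(|y|, a_i, s)` if `y` is in the open edge `i`, where `a_i`
is the component of the velocity `a` along `e_i`, and `min {ℓ_*(s), min_i ℓ_i(0, 0, s)}`
at the vertex. -/
noncomputable def junctionRunningCost {N : ℕ} (ℓ : Fin N → ℝ → ℝ → ℝ → ℝ) (ℓstar : ℝ → ℝ)
    (y a : EuclideanSpace ℝ (Fin N)) (s : ℝ) : ℝ :=
  (∑ i, (junctionEdge i \ {0}).indicator (fun z => ℓ i ‖z‖ (a i) s) y) +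
    ({0} : Set (EuclideanSpace ℝ (Fin N))).indicator
      (fun _ => minWith (ℓstar s) Finset.univ (fun i => ℓ i 0 0 s)) y

/-- Terminal cost on the junction: `g_i(|y|)` if `y` is in the open edge `i`, and
`min {g_*, min_i g_i(0)}` at the vertex. -/
noncomputable def junctionTerminalCost {N : ℕ} (g : Fin N → ℝ → ℝ) (gstar : ℝ)
    (y : EuclideanSpace ℝ (Fin N)) : ℝ :=
  (∑ i, (junctionEdge i \ {0}).indicator (fun z => g i ‖z‖) y) +
    ({0} : Set (EuclideanSpace ℝ (Fin N))).indicator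
      (fun _ => minWith gstar Finset.univ (fun i => g i 0)) y

/-! ### General networks -/

/-- A point set `[0, l]` (if `l < ∞`) or `[0, ∞)` (if `l = ∞`). -/
def edgeDomain (l : ENNReal) : Set ℝ := {r | 0 ≤ r ∧ ENNReal.ofReal r ≤ l}

/-- The point at abscissa `r` on the half-line issued from `O` with direction `e`. -/
noncomputable def rayPoint {d : ℕ} (O e : EuclideanSpace ℝ (Fin d)) (r : ℝ) :
    EuclideanSpace ℝ (Fin d) := O + r • e

/-- A network in `ℝ^d` with `n` vertices and `N` straight edges, finite or infinite. Edge `i` is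
issued from the vertex `src i`, has unit direction `dir i` and length `len i ∈ (0, ∞]`; if the
length is finite, the other endpoint is a vertex as well. The orientation is arbitrary. -/
structure Network (d n N : ℕ) where
  vertex : Fin n → EuclideanSpace ℝ (Fin d)
  src : Fin N → Fin n
  dir : Fin N → EuclideanSpace ℝ (Fin d)
  len : Fin N → ENNReal
  vertex_injective : Function.Injective vertex
  norm_dir : ∀ i, ‖dir i‖ = 1
  len_pos : ∀ i, 0 < len i
  endpoint : ∀ i, len i ≠ ⊤ → ∃ k, rayPoint (vertex (src i)) (dir i) (len i).toReal = vertex k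
  /-- a vertex that lies on an edge is an endpoint of this edge -/
  vertex_on_edge : ∀ i, ∀ r ∈ edgeDomain (len i), ∀ k,
    rayPoint (vertex (src i)) (dir i) r = vertex k → r = 0 ∨ (len i ≠ ⊤ ∧ r = (len i).toReal)
  /-- two different edges meet at most at one point, which is a vertex -/
  inter_subset : ∀ i j, i ≠ j →
    rayPoint (vertex (src i)) (dir i) '' edgeDomain (len i) ∩
      rayPoint (vertex (src j)) (dir j) '' edgeDomain (len j) ⊆ range vertex
  inter_subsingleton : ∀ i j, i ≠ j →
    (rayPoint (vertex (src i)) (dir i) '' edgeDomain (len i) ∩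
      rayPoint (vertex (src j)) (dir j) '' edgeDomain (len j)).Subsingleton
  connected : IsConnected
    (range vertex ∪ ⋃ i, rayPoint (vertex (src i)) (dir i) '' edgeDomain (len i))

namespace Network

variable {d n N : ℕ} (𝒩 : Network d n N)

/-- The interval of abscissas on edge `i`. -/
def dom (i : Fin N) : Set ℝ := edgeDomain (𝒩.len i)

/-- Arc-length parametrization of edge `i`. -/
noncomputable def param (i : Fin N) (r : ℝ) : EuclideanSpace ℝ (Fin d) :=
  rayPoint (𝒩.vertex (𝒩.src i)) (𝒩.dir i) r

/-- The closed edge `i`. -/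
def edge (i : Fin N) : Set (EuclideanSpace ℝ (Fin d)) := 𝒩.param i '' 𝒩.dom i

/-- The set of vertices. -/
def vertices : Set (EuclideanSpace ℝ (Fin d)) := range 𝒩.vertex

/-- The network as a subset of `ℝ^d`. -/
def carrier : Set (EuclideanSpace ℝ (Fin d)) := 𝒩.vertices ∪ ⋃ i, 𝒩.edge i

/-- On edge `i`, the inverse of the parametrization. -/
noncomputable def coord (i : Fin N) (z : EuclideanSpace ℝ (Fin d)) : ℝ :=
  inner ℝ (𝒩.dir i) (z - 𝒩.vertex (𝒩.src i))

open Classical in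
/-- The edges adjacent to vertex `k`. -/
noncomputable def adjacent (k : Fin n) : Finset (Fin N) :=
  Finset.univ.filter fun i => 𝒩.vertex k ∈ 𝒩.edge i

/-- Running cost on the network; `inner ℝ (dir i) a` is the signed speed along edge `i`. -/
noncomputable def runningCost (ℓ : Fin N → ℝ → ℝ → ℝ → ℝ) (ℓstar : Fin n → ℝ → ℝ)
    (y a : EuclideanSpace ℝ (Fin d)) (s : ℝ) : ℝ :=
  (∑ i, (𝒩.edge i \ 𝒩.vertices).indicator
      (fun z => ℓ i (𝒩.coord i z) (inner ℝ (𝒩.dir i) a) s) y) +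
    ∑ k, ({𝒩.vertex k} : Set (EuclideanSpace ℝ (Fin d))).indicator
      (fun O => minWith (ℓstar k s) (𝒩.adjacent k) (fun i => ℓ i (𝒩.coord i O) 0 s)) y

/-- Terminal cost on the network. -/
noncomputable def terminalCost (g : Fin N → ℝ → ℝ) (gstar : Fin n → ℝ)
    (y : EuclideanSpace ℝ (Fin d)) : ℝ :=
  (∑ i, (𝒩.edge i \ 𝒩.vertices).indicator (fun z => g i (𝒩.coord i z)) y) +
    ∑ k, ({𝒩.vertex k} : Set (EuclideanSpace ℝ (Fin d))).indicator
      (fun O => minWith (gstar k) (𝒩.adjacent k) (fun i => g i (𝒩.coord i O))) y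

end Network

/-- Every trajectory in `G` that is optimal for the costs `L`, `g` has a bounded derivative,
with a positive bound `V` that depends on the initial data `(x, t)` only through `|x|` and
`T - t`. It is locally uniform: `V` is nondecreasing in `|x|` and nonincreasing in `T - t > 0`
(so that it may blow up only as `|x| → ∞` or `t → T`). -/
def OptimalVelocitiesBounded {d : ℕ} (p T : ℝ) (G : Set (EuclideanSpace ℝ (Fin d)))
    (L : EuclideanSpace ℝ (Fin d) → EuclideanSpace ℝ (Fin d) → ℝ → ℝ)
    (g : EuclideanSpace ℝ (Fin d) → ℝ) : Prop :=
  ∃ V : ℝ → ℝ → ℝ,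
    (∀ r τ, 0 < V r τ) ∧
    (∀ τ, Monotone fun r => V r τ) ∧
    (∀ r, AntitoneOn (V r) (Ioi 0)) ∧
    ∀ x ∈ G, ∀ t ∈ Icc 0 T, ∀ y v : ℝ → EuclideanSpace ℝ (Fin d),
      IsOptimal p T G L g x t y v →
        MemLp v ⊤ (volume.restrict (Ioo t T)) ∧
        eLpNorm v ⊤ (volume.restrict (Ioo t T)) ≤ ENNReal.ofReal (V ‖x‖ (T - t))

end NetworkControl

namespace NetworkControl

open scoped ContDiff Topology

/-! ### Weak derivatives and indefinite integrals -/

/-! The running cost grows superlinearly in the speed, so moving fast is never worthwhile when a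
slower competitor reaches a suitable point. Fix an optimal trajectory with `‖x‖ ≤ R` and `τ ≤ T -
t`. Comparison with resting at `x` bounds the energy `∫ (1 + ‖v‖ ^ p)` by a constant `E`
(`exists_energy_bound`), hence the trajectory stays in the ball of radius `R + E`. At almost every
time spent at a vertex the velocity is zero (`ae_velocity_vertex`). The other times form open
intervals, the excursions, each inside a single edge (`exists_excursion`).

Inside an edge the problem is one-dimensional and the Euler–Lagrange equation holds in the form of
du Bois-Reymond: the momentum `∂_a ℓ` along the trajectory has weak derivative `∂_y ℓ`, so its
essential oscillation on the excursion is at most `C * E`, however short or long the excursion is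
(`oscillation_le`). By convexity and coercivity, large speed means large momentum of the same sign.
A bound on the mean velocity of the excursion yields a set of positive measure where the momentum is
controlled, and the oscillation bound carries it to the whole excursion (`velocity_le_of_mean_le`).
It remains to bound mean velocities, uniformly over all excursions.

If both ends are vertices, the excursion either returns to its starting point, with mean zero, or
crosses a whole edge, which takes a minimal time because the energy is bounded. If it ends at time
`T` off the vertices, the competitor that stops at its beginning loses at most a Lipschitz constant
times the displacement in terminal cost, and superlinearity wins (`mean_le_of_terminal`). These two
cases already bound the speed by some `K₀` after the first visit to a vertex.

The delicate case is the excursion that starts at time `t` off the vertices and ends at a vertex. A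
displacement `X ≥ κ` is again handled by energy. If `X ≤ κ`, the competitor goes to the vertex at
unit speed and then catches up with the trajectory at time `t + 2 * X`, which needs speed at most `2
* K₀` (`mean_le_of_hitting`). This requires `2 * κ ≤ T - t`, the only place where the time to
maturity enters, and `κ` small enough that the network is a star around the vertex at the scale of
the detour.

A junction is a network with one vertex and infinite edges, so the first half of the theorem is an
instance of the second. -/

theorem integral_deriv_mul_primitive {a b : ℝ} (hab : a ≤ b) {φ w : ℝ → ℝ} (hφ : ContDiff ℝ ∞ φ)
    (hφa : φ a = 0) (hφb : φ b = 0) (hw : IntervalIntegrable w volume a b) (z₀ : ℝ) :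
    ∫ s in a..b, deriv φ s * (z₀ + ∫ u in a..s, w u) = -∫ s in a..b, φ s * w s := by
  have hφ' : AbsolutelyContinuousOnInterval φ a b :=
    (hφ.of_le (by exact_mod_cast le_top)).contDiffOn.absolutelyContinuousOnInterval
  have hW : AbsolutelyContinuousOnInterval (fun s => z₀ + ∫ u in a..s, w u) a b := by
    have h0 : AbsolutelyContinuousOnInterval (fun _ : ℝ => z₀) a b :=
      (contDiff_const (𝕜 := ℝ) (n := 1)).contDiffOn.absolutelyContinuousOnInterval
    exact h0.add (hw.absolutelyContinuousOnInterval_intervalIntegral (by simp [hab]))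
  have h := hW.integral_mul_deriv_eq_deriv_mul hφ'
  have h2 : ∫ s in a..b, deriv (fun s => z₀ + ∫ u in a..s, w u) s * φ s =
      ∫ s in a..b, φ s * w s := by
    apply intervalIntegral.integral_congr_ae
    filter_upwards [hw.ae_hasDerivAt_integral] with s hs hs'
    have h3 := ((hs (uIoc_subset_uIcc hs') a (by simp)).const_add z₀).deriv
    rw [h3, mul_comm]
  rw [h2, hφa, hφb] at h
  simp only [mul_comm (deriv φ _)]
  rw [h]; ring

variable {d : ℕ}

theorem intervalIntegral_apply {w : ℝ → EuclideanSpace ℝ (Fin d)} {a b : ℝ}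
    (hw : IntervalIntegrable w volume a b) (i : Fin d) :
    (∫ s in a..b, w s) i = ∫ s in a..b, w s i := by
  have := (EuclideanSpace.proj (𝕜 := ℝ) i).intervalIntegral_comp_comm hw
  exact this.symm

theorem hasWeakDerivOn_of_eq_integral {a b : ℝ} (hab : a ≤ b)
    {y w : ℝ → EuclideanSpace ℝ (Fin d)} (hw : IntervalIntegrable w volume a b)
    (hy : ∀ s ∈ Icc a b, y s = y a + ∫ u in a..s, w u) : HasWeakDerivOn y w a b := by
  intro φ hφ hφc hφs
  have hφa : φ a = 0 := image_eq_zero_of_notMem_tsupport fun h => (lt_irrefl _ (hφs h).1)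
  have hφb : φ b = 0 := image_eq_zero_of_notMem_tsupport fun h => (lt_irrefl _ (hφs h).2)
  rw [← integral_Ioc_eq_integral_Ioo, ← integral_Ioc_eq_integral_Ioo,
    ← intervalIntegral.integral_of_le hab, ← intervalIntegral.integral_of_le hab]
  have hyc : ContinuousOn y (Icc a b) := by
    have h1 := intervalIntegral.continuousOn_primitive_interval
      ((intervalIntegrable_iff_integrableOn_Icc_of_le hab).1 hw |>.mono_set
        (by rw [uIcc_of_le hab]))
    rw [uIcc_of_le hab] at h1
    exact (continuousOn_const.add h1).congr fun s hs => hy s hs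
  have hφ' : Continuous (deriv φ) := hφ.continuous_deriv (by simp)
  ext i
  have i1 : IntervalIntegrable (fun s => deriv φ s • y s) volume a b := by
    apply ContinuousOn.intervalIntegrable
    rw [uIcc_of_le hab]
    exact hφ'.continuousOn.smul hyc
  have i2 : IntervalIntegrable (fun s => φ s • w s) volume a b :=
    hw.continuousOn_smul hφ.continuous.continuousOn
  rw [intervalIntegral_apply i1, PiLp.neg_apply, intervalIntegral_apply i2]
  simp only [PiLp.smul_apply, smul_eq_mul]
  have hwi : IntervalIntegrable (fun s => w s i) volume a b :=
    ⟨(EuclideanSpace.proj (𝕜 := ℝ) i).integrable_comp hw.1,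
      (EuclideanSpace.proj (𝕜 := ℝ) i).integrable_comp hw.2⟩
  rw [← integral_deriv_mul_primitive hab hφ hφa hφb hwi (y a i)]
  apply intervalIntegral.integral_congr
  intro s hs
  rw [uIcc_of_le hab] at hs
  simp only
  rw [hy s hs, PiLp.add_apply, intervalIntegral_apply]
  exact hw.mono_set (by rw [uIcc_of_le hab, uIcc_of_le hs.1]; exact Icc_subset_Icc_right hs.2)

/-- The primitive taken from `a` vanishes to the left of the support of `ψ`, and also to the right
because the total integral is zero. -/
theorem exists_primitive_of_integral_eq_zero {a b : ℝ} {ψ : ℝ → ℝ}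
    (hψ : ContDiff ℝ ∞ ψ) (hψc : HasCompactSupport ψ) (hψs : tsupport ψ ⊆ Ioo a b)
    (h0 : ∫ s, ψ s = 0) :
    ∃ φ : ℝ → ℝ, ContDiff ℝ ∞ φ ∧ HasCompactSupport φ ∧ tsupport φ ⊆ Ioo a b ∧
      deriv φ = ψ := by
  have hder : ∀ s, HasDerivAt (fun s => ∫ u in a..s, ψ u) (ψ s) s := fun s =>
    intervalIntegral.integral_hasDerivAt_right (hψ.continuous.intervalIntegrable _ _)
      (hψ.continuous.stronglyMeasurableAtFilter _ _) hψ.continuous.continuousAt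
  have hderiv : deriv (fun s => ∫ u in a..s, ψ u) = ψ := funext fun s => (hder s).deriv
  -- If `ψ` has empty support, reversed endpoints make `Icc c d` empty.
  obtain ⟨c, d, hcd, hsub⟩ : ∃ c d, Icc c d ⊆ Ioo a b ∧ tsupport ψ ⊆ Icc c d := by
    rcases (tsupport ψ).eq_empty_or_nonempty with he | hne
    · exact ⟨1, 0, by simp, by simp [he]⟩
    · obtain ⟨m, hm, hm'⟩ := hψc.isCompact.exists_isLeast hne
      obtain ⟨M, hM, hM'⟩ := hψc.isCompact.exists_isGreatest hne
      exact ⟨m, M, fun s hs => ⟨(hψs hm).1.trans_le hs.1, hs.2.trans_lt (hψs hM).2⟩,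
        fun s hs => ⟨hm' hs, hM' hs⟩⟩
  have hz : ∀ s, s ∉ Icc c d → ψ s = 0 := fun s hs =>
    image_eq_zero_of_notMem_tsupport fun h => hs (hsub h)
  have hsupp : Function.support (fun s => ∫ u in a..s, ψ u) ⊆ Icc c d := by
    intro s hs
    by_contra hn
    apply hs
    simp only
    rcases lt_or_ge s c with h | h
    · rw [intervalIntegral.integral_congr_ae (g := fun _ => 0)]
      · simp
      refine Filter.Eventually.of_forall fun u hu => hz u fun hu' => ?_
      rcases le_total c d with hcd' | hcd'
      · have := (hcd ⟨le_rfl, hcd'⟩).1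
        rcases mem_uIoc.1 hu with h1 | h1 <;> linarith [hu'.1, h1.1, h1.2]
      · have : u = c := le_antisymm (hu'.2.trans hcd') hu'.1
        have := (hcd hu').1
        rcases mem_uIoc.1 hu with h1 | h1 <;> linarith [hu'.1, h1.1, h1.2]
    · have hd : d < s := by
        by_contra h'
        exact hn ⟨h, not_lt.1 h'⟩
      have hint : Integrable ψ := hψ.continuous.integrable_of_hasCompactSupport hψc
      rcases le_or_gt c d with hcd' | hcd'
      · have has : a ≤ s := ((hcd ⟨le_rfl, hcd'⟩).1.trans_le h).le
        rw [intervalIntegral.integral_of_le has, setIntegral_eq_integral_of_forall_compl_eq_zero,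
          h0]
        intro u hu
        apply hz
        intro hu'
        exact hu ⟨(hcd hu').1, hu'.2.trans hd.le⟩
      · have : ∀ u, ψ u = 0 := fun u => hz u (by simp [hcd'])
        simp [this]
  have hts : tsupport (fun s => ∫ u in a..s, ψ u) ⊆ Icc c d :=
    closure_minimal hsupp isClosed_Icc
  refine ⟨fun s => ∫ u in a..s, ψ u, ?_, ?_, hts.trans hcd, hderiv⟩
  · rw [contDiff_infty_iff_deriv]
    exact ⟨fun s => (hder s).differentiableAt, by rw [hderiv]; exact hψ⟩
  · exact isCompact_Icc.of_isClosed_subset (isClosed_tsupport _) hts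

/-- Du Bois-Reymond: with a fixed bump `ρ` of integral one, `ψ - (∫ ψ) ρ` is the derivative of a
test function for every test function `ψ`. Hence `z` minus its `ρ`-average is orthogonal to all test
functions, and continuity turns almost everywhere into everywhere. -/
theorem eq_const_of_hasWeakDerivOn_zero {a b : ℝ} (hab : a < b)
    {z : ℝ → EuclideanSpace ℝ (Fin d)} (hz : ContinuousOn z (Icc a b))
    (h : HasWeakDerivOn z (fun _ => 0) a b) : ∀ s ∈ Icc a b, z s = z a := by
  have hzi : IntegrableOn z (Ioo a b) :=
    (hz.integrableOn_compact isCompact_Icc).mono_set Ioo_subset_Icc_self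
  obtain ⟨ρ, hρ, hρc, hρs, hρ1⟩ : ∃ ρ : ℝ → ℝ, ContDiff ℝ ∞ ρ ∧ HasCompactSupport ρ ∧
      tsupport ρ ⊆ Ioo a b ∧ ∫ s, ρ s = 1 := by
    let f : ContDiffBump ((a + b) / 2) := ⟨(b - a) / 8, (b - a) / 4, by linarith, by linarith⟩
    refine ⟨f.normed volume, f.contDiff_normed, f.hasCompactSupport_normed, ?_,
      f.integral_normed⟩
    rw [f.tsupport_normed_eq]
    intro s hs
    rw [Metric.mem_closedBall, Real.dist_eq, abs_le] at hs
    change -((b - a) / 4) ≤ _ ∧ _ ≤ (b - a) / 4 at hs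
    constructor <;> linarith [hs.1, hs.2]
  set C := ∫ s in Ioo a b, ρ s • z s with hC
  have key : ∀ ψ : ℝ → ℝ, ContDiff ℝ ∞ ψ → HasCompactSupport ψ → tsupport ψ ⊆ Ioo a b →
      ∫ s, ψ s • (z s - C) = 0 := by
    intro ψ hψ hψc hψs
    set m := ∫ s, ψ s with hm
    have hψi : Integrable ψ := hψ.continuous.integrable_of_hasCompactSupport hψc
    have hρi : Integrable ρ := hρ.continuous.integrable_of_hasCompactSupport hρc
    have hsm : tsupport (fun s => m * ρ s) ⊆ tsupport ρ :=
      closure_mono (Function.support_mul_subset_right (fun _ => m) ρ)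
    have hsub : tsupport (fun s => ψ s - m * ρ s) ⊆ tsupport ψ ∪ tsupport ρ :=
      (tsupport_sub ψ (fun s => m * ρ s)).trans (union_subset_union_right _ hsm)
    obtain ⟨φ, hφ, hφc, hφs, hφd⟩ := exists_primitive_of_integral_eq_zero
      (a := a) (b := b) (ψ := fun s => ψ s - m * ρ s)
      (hψ.sub (contDiff_const.mul hρ)) ((hψc.isCompact.union hρc.isCompact).of_isClosed_subset
        (isClosed_tsupport _) hsub) (hsub.trans (union_subset hψs hρs)) (by
        rw [integral_sub hψi (hρi.const_mul m), integral_const_mul, hρ1, ← hm]; simp)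
    have h1 := h φ hφ hφc hφs
    simp only [smul_zero, integral_zero, neg_zero, hφd] at h1
    have bdd : ∀ g : ℝ → ℝ, Continuous g → HasCompactSupport g →
        IntegrableOn (fun s => g s • z s) (Ioo a b) := by
      intro g hg hgc
      exact ((hg.continuousOn.smul hz).integrableOn_compact isCompact_Icc).mono_set
        Ioo_subset_Icc_self
    have h2 : ∫ s in Ioo a b, ψ s • z s = m • C := by
      have : ∀ s, (ψ s - m * ρ s) • z s = ψ s • z s - m • (ρ s • z s) := by
        intro s; rw [sub_smul, mul_smul]
      simp only [this] at h1
      have i3 : IntegrableOn (fun s => m • (ρ s • z s)) (Ioo a b) :=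
        (bdd ρ hρ.continuous hρc).smul m
      rw [integral_sub (bdd ψ hψ.continuous hψc) i3, integral_smul, sub_eq_zero] at h1
      exact h1
    have h3 : ∫ s, ψ s • (z s - C) = ∫ s in Ioo a b, ψ s • (z s - C) := by
      symm
      apply setIntegral_eq_integral_of_forall_compl_eq_zero
      intro s hs
      rw [image_eq_zero_of_notMem_tsupport fun h' => hs (hψs h'), zero_smul]
    have h4 : ∫ s in Ioo a b, ψ s = m :=
      setIntegral_eq_integral_of_forall_compl_eq_zero fun s hs =>
        image_eq_zero_of_notMem_tsupport fun h' => hs (hψs h')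
    rw [h3]
    simp only [smul_sub]
    rw [integral_sub (bdd ψ hψ.continuous hψc) (hψi.integrableOn.smul_const C), h2,
      integral_smul_const, h4, sub_self]
  have hae := isOpen_Ioo.ae_eq_zero_of_integral_contDiff_smul_eq_zero (μ := volume)
    (U := Ioo a b) (f := fun s => z s - C)
    ((hzi.sub (integrableOn_const (by simp))).locallyIntegrableOn) key
  have hall : EqOn z (fun _ => C) (Icc a b) := by
    rw [← closure_Ioo hab.ne]
    refine EqOn.of_subset_closure ?_ (by rwa [closure_Ioo hab.ne]) continuousOn_const
      subset_closure subset_rfl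
    refine Measure.eqOn_open_of_ae_eq (μ := volume) ?_ isOpen_Ioo
      (hz.mono Ioo_subset_Icc_self) continuousOn_const
    rw [Filter.EventuallyEq, ae_restrict_iff' measurableSet_Ioo]
    filter_upwards [hae] with s hs hs'
    exact sub_eq_zero.1 (hs hs')
  intro s hs
  rw [hall hs, hall (left_mem_Icc.2 hab.le)]

/-- The difference between `y` and the primitive of `w` is continuous with zero weak derivative. -/
theorem HasWeakDerivOn.eq_integral {a b : ℝ} (hab : a ≤ b)
    {y w : ℝ → EuclideanSpace ℝ (Fin d)} (h : HasWeakDerivOn y w a b)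
    (hy : ContinuousOn y (Icc a b)) (hw : IntervalIntegrable w volume a b) :
    ∀ s ∈ Icc a b, y s = y a + ∫ u in a..s, w u := by
  rcases hab.eq_or_lt with rfl | hab'
  · intro s hs
    have : s = a := le_antisymm hs.2 hs.1
    simp [this]
  have hW : ContinuousOn (fun s => ∫ u in a..s, w u) (Icc a b) := by
    have h1 := intervalIntegral.continuousOn_primitive_interval
      ((intervalIntegrable_iff_integrableOn_Icc_of_le hab).1 hw |>.mono_set
        (by rw [uIcc_of_le hab]))
    rwa [uIcc_of_le hab] at h1
  have h2 := hasWeakDerivOn_of_eq_integral hab (y := fun s => ∫ u in a..s, w u) hw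
    (fun s _ => by simp)
  have hz : HasWeakDerivOn (fun s => y s - ∫ u in a..s, w u) (fun _ => 0) a b := by
    intro φ hφ hφc hφs
    have hφ' : Continuous (deriv φ) := hφ.continuous_deriv (by simp)
    simp only [smul_sub, smul_zero, integral_zero, neg_zero]
    rw [integral_sub, h φ hφ hφc hφs, h2 φ hφ hφc hφs, sub_self]
    · exact ((hφ'.continuousOn.smul hy).integrableOn_compact isCompact_Icc).mono_set
        Ioo_subset_Icc_self
    · exact ((hφ'.continuousOn.smul hW).integrableOn_compact isCompact_Icc).mono_set
        Ioo_subset_Icc_self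
  intro s hs
  have := eq_const_of_hasWeakDerivOn_zero hab' (hy.sub hW) hz s hs
  simp only [Pi.sub_apply, intervalIntegral.integral_same, sub_zero] at this
  rw [← this]; abel

/-! ### Paths on subintervals, concatenation and local optimality -/

/-- An absolutely continuous curve `z` in `G` on `[a, b]` with velocity `w ∈ L^p`. -/
structure IsPath (p : ℝ) (G : Set (EuclideanSpace ℝ (Fin d))) (a b : ℝ)
    (z w : ℝ → EuclideanSpace ℝ (Fin d)) : Prop where
  memLp : MemLp w (ENNReal.ofReal p) (volume.restrict (Ioc a b))
  eq_integral : ∀ s ∈ Icc a b, z s = z a + ∫ u in a..s, w u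
  mapsTo : MapsTo z (Icc a b) G

namespace IsPath

variable {p a b m : ℝ} {G : Set (EuclideanSpace ℝ (Fin d))}
  {z w z' w' : ℝ → EuclideanSpace ℝ (Fin d)}

theorem intervalIntegrable (hp : 1 ≤ p) (hab : a ≤ b) (h : IsPath p G a b z w) :
    IntervalIntegrable w volume a b := by
  rw [intervalIntegrable_iff_integrableOn_Ioc_of_le hab]
  exact h.memLp.integrable (by rwa [← ENNReal.ofReal_one, ENNReal.ofReal_le_ofReal_iff (by linarith)])

theorem continuousOn (hp : 1 ≤ p) (hab : a ≤ b) (h : IsPath p G a b z w) :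
    ContinuousOn z (Icc a b) := by
  have h1 := intervalIntegral.continuousOn_primitive_interval
    ((intervalIntegrable_iff_integrableOn_Icc_of_le hab).1 (h.intervalIntegrable hp hab)
      |>.mono_set (by rw [uIcc_of_le hab]))
  rw [uIcc_of_le hab] at h1
  exact (continuousOn_const.add h1).congr fun s hs => h.eq_integral s hs

theorem sub_eq_integral (hp : 1 ≤ p) (h : IsPath p G a b z w) {s s' : ℝ} (hs : s ∈ Icc a b)
    (hs' : s' ∈ Icc a b) : z s' - z s = ∫ u in s..s', w u := by
  have hab : a ≤ b := hs.1.trans hs.2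
  have hi := h.intervalIntegrable hp hab
  have hi1 : ∀ r ∈ Icc a b, IntervalIntegrable w volume a r := fun r hr =>
    hi.mono_set (by rw [uIcc_of_le hab, uIcc_of_le hr.1]; exact Icc_subset_Icc_right hr.2)
  rw [h.eq_integral s hs, h.eq_integral s' hs',
    ← intervalIntegral.integral_interval_sub_left (hi1 s' hs') (hi1 s hs)]
  abel

theorem mono (hp : 1 ≤ p) (h : IsPath p G a b z w) {a' b' : ℝ} (ha : a ≤ a') (hb : b' ≤ b) :
    IsPath p G a' b' z w where
  memLp := h.memLp.mono_measure (Measure.restrict_mono (Ioc_subset_Ioc ha hb) le_rfl)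
  eq_integral s hs := by
    rw [← h.sub_eq_integral hp ⟨ha, hs.1.trans (hs.2.trans hb)⟩ ⟨ha.trans hs.1, hs.2.trans hb⟩]
    abel
  mapsTo := h.mapsTo.mono_left (Icc_subset_Icc ha hb)

theorem congr_velocity (h : IsPath p G a b z w)
    (hw : ∀ᵐ s, s ∈ Ioc a b → w' s = w s) : IsPath p G a b z w' where
  memLp := h.memLp.ae_eq (by
    rw [Filter.EventuallyEq, ae_restrict_iff' measurableSet_Ioc]
    filter_upwards [hw] with s hs hs' using (hs hs').symm)
  eq_integral s hs := by
    rw [h.eq_integral s hs]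
    congr 1
    apply intervalIntegral.integral_congr_ae
    filter_upwards [hw] with u hu hu'
    rw [uIoc_of_le hs.1] at hu'
    exact (hu ⟨hu'.1, hu'.2.trans hs.2⟩).symm
  mapsTo := h.mapsTo

theorem concat (hp : 1 ≤ p) (ham : a ≤ m) (hmb : m ≤ b) (h : IsPath p G a m z w)
    (h' : IsPath p G m b z' w') (hm : z m = z' m) :
    IsPath p G a b (fun s => if s ≤ m then z s else z' s)
      (fun s => if s ≤ m then w s else w' s) := by
  have hcl : ∀ s ≤ m, a ≤ s → ∫ u in a..s, (if u ≤ m then w u else w' u) = ∫ u in a..s, w u := by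
    intro s hs has
    apply intervalIntegral.integral_congr_ae
    refine Filter.Eventually.of_forall fun u hu => ?_
    rw [uIoc_of_le has] at hu
    simp [hu.2.trans hs]
  have hcr : ∀ s, m ≤ s → ∫ u in m..s, (if u ≤ m then w u else w' u) = ∫ u in m..s, w' u := by
    intro s hs
    apply intervalIntegral.integral_congr_ae
    refine Filter.Eventually.of_forall fun u hu => ?_
    rw [uIoc_of_le hs] at hu
    simp [hu.1]
  have hL : MemLp (fun s => if s ≤ m then w s else w' s) (ENNReal.ofReal p)
      (volume.restrict (Ioc a b)) := by
    have e1 : MemLp ((Ioc a m).indicator w) (ENNReal.ofReal p) volume :=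
      (memLp_indicator_iff_restrict measurableSet_Ioc).2 h.memLp
    have e2 : MemLp ((Ioc m b).indicator w') (ENNReal.ofReal p) volume :=
      (memLp_indicator_iff_restrict measurableSet_Ioc).2 h'.memLp
    refine ((e1.add e2).restrict (Ioc a b)).ae_eq ?_
    rw [Filter.EventuallyEq, ae_restrict_iff' measurableSet_Ioc]
    refine Filter.Eventually.of_forall fun s hs => ?_
    by_cases hsm : s ≤ m
    · simp [hsm, hs.1]
    · have := not_le.1 hsm
      simp [hsm, hs.2]
  have hi : IntervalIntegrable (fun s => if s ≤ m then w s else w' s) volume a b := by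
    rw [intervalIntegrable_iff_integrableOn_Ioc_of_le (ham.trans hmb)]
    exact hL.integrable
      (by rwa [← ENNReal.ofReal_one, ENNReal.ofReal_le_ofReal_iff (by linarith)])
  refine ⟨hL, fun s hs => ?_, fun s hs => ?_⟩
  · by_cases hsm : s ≤ m
    · simp only [hsm, if_true, ham]
      rw [hcl s hsm hs.1, h.eq_integral s ⟨hs.1, hsm⟩]
    · have hms := (not_le.1 hsm).le
      simp only [hsm, if_false, ham, if_true]
      rw [← intervalIntegral.integral_add_adjacent_intervals (b := m), hcl m le_rfl ham,
        hcr s hms, ← add_assoc, ← h.eq_integral m ⟨ham, le_rfl⟩, hm,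
        h'.eq_integral s ⟨hms, hs.2⟩]
      · exact hi.mono_set (by
          rw [uIcc_of_le ham, uIcc_of_le (ham.trans hmb)]; exact Icc_subset_Icc_right hmb)
      · exact hi.mono_set (by
          rw [uIcc_of_le hms, uIcc_of_le (ham.trans hmb)]; exact Icc_subset_Icc ham hs.2)
  · by_cases hsm : s ≤ m
    · simp only [hsm, if_true]; exact h.mapsTo ⟨hs.1, hsm⟩
    · simp only [hsm, if_false]; exact h'.mapsTo ⟨(not_le.1 hsm).le, hs.2⟩

theorem affine {z₀ z₁ : EuclideanSpace ℝ (Fin d)} (hab : a < b) (hG : segment ℝ z₀ z₁ ⊆ G) :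
    IsPath p G a b (fun s => z₀ + ((s - a) / (b - a)) • (z₁ - z₀))
      (fun _ => (b - a)⁻¹ • (z₁ - z₀)) where
  memLp := memLp_const _
  eq_integral s hs := by
    rw [intervalIntegral.integral_const, smul_smul]
    simp [div_eq_mul_inv]
  mapsTo s hs := by
    apply hG
    rw [segment_eq_image']
    refine ⟨(s - a) / (b - a), ⟨div_nonneg (by linarith [hs.1]) (by linarith), ?_⟩, rfl⟩
    rw [div_le_one (by linarith)]
    linarith [hs.2]

theorem const {z₀ : EuclideanSpace ℝ (Fin d)} (hG : z₀ ∈ G) :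
    IsPath p G a b (fun _ => z₀) (fun _ => 0) where
  memLp := memLp_const _
  eq_integral s hs := by simp
  mapsTo s hs := hG

end IsPath

/-- Passage from test functions to the integral formulation. Competitors are built as `IsPath`,
which restricts to subintervals and concatenates. -/
theorem isTrajectory_iff {p T t : ℝ} {G : Set (EuclideanSpace ℝ (Fin d))}
    {x : EuclideanSpace ℝ (Fin d)} {y v : ℝ → EuclideanSpace ℝ (Fin d)} (hp : 1 ≤ p)
    (htT : t ≤ T) : IsTrajectory p T G x t y v ↔ IsPath p G t T y v ∧ y t = x := by
  constructor
  · intro h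
    have hL : MemLp v (ENNReal.ofReal p) (volume.restrict (Ioc t T)) := by
      rw [← Measure.restrict_congr_set Ioo_ae_eq_Ioc]
      exact h.memW1p.memLp_deriv
    have hi : IntervalIntegrable v volume t T := by
      rw [intervalIntegrable_iff_integrableOn_Ioc_of_le htT]
      exact hL.integrable
        (by rwa [← ENNReal.ofReal_one, ENNReal.ofReal_le_ofReal_iff (by linarith)])
    exact ⟨⟨hL, h.memW1p.weakDeriv.eq_integral htT h.continuousOn hi, h.mapsTo⟩, h.start⟩
  · rintro ⟨h, hx⟩
    refine ⟨h.continuousOn hp htT, h.mapsTo, ⟨?_, ?_, ?_⟩, hx⟩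
    · obtain ⟨C, hC⟩ := isCompact_Icc.exists_bound_of_continuousOn (h.continuousOn hp htT)
      refine MemLp.of_bound (((h.continuousOn hp htT).mono
        Ioo_subset_Icc_self).aestronglyMeasurable measurableSet_Ioo) C ?_
      rw [ae_restrict_iff' measurableSet_Ioo]
      exact Filter.Eventually.of_forall fun s hs => hC s (Ioo_subset_Icc_self hs)
    · rw [Measure.restrict_congr_set Ioo_ae_eq_Ioc]
      exact h.memLp
    · exact hasWeakDerivOn_of_eq_integral htT (h.intervalIntegrable hp htT) h.eq_integral

/-- The running cost is integrable along every path. -/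
def IntegrableAlongPaths (p T : ℝ) (G : Set (EuclideanSpace ℝ (Fin d)))
    (L : EuclideanSpace ℝ (Fin d) → EuclideanSpace ℝ (Fin d) → ℝ → ℝ) : Prop :=
  ∀ a b z w, 0 ≤ a → a ≤ b → b ≤ T → IsPath p G a b z w →
    IntervalIntegrable (fun s => L (z s) (w s) s) volume a b

theorem integral_concat {L : EuclideanSpace ℝ (Fin d) → EuclideanSpace ℝ (Fin d) → ℝ → ℝ}
    {a m b : ℝ} {z w z' w' : ℝ → EuclideanSpace ℝ (Fin d)} (ham : a ≤ m) (hmb : m ≤ b)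
    (h : IntervalIntegrable (fun s => L (z s) (w s) s) volume a m)
    (h' : IntervalIntegrable (fun s => L (z' s) (w' s) s) volume m b) :
    ∫ s in a..b, L (if s ≤ m then z s else z' s) (if s ≤ m then w s else w' s) s =
      (∫ s in a..m, L (z s) (w s) s) + ∫ s in m..b, L (z' s) (w' s) s := by
  have e1 : EqOn (fun s => L (z s) (w s) s)
      (fun s => L (if s ≤ m then z s else z' s) (if s ≤ m then w s else w' s) s) (uIoc a m) := by
    intro s hs
    rw [uIoc_of_le ham] at hs
    simp [hs.2]
  have e2 : EqOn (fun s => L (z' s) (w' s) s)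
      (fun s => L (if s ≤ m then z s else z' s) (if s ≤ m then w s else w' s) s) (uIoc m b) := by
    intro s hs
    rw [uIoc_of_le hmb] at hs
    simp [not_le.2 hs.1]
  rw [← intervalIntegral.integral_add_adjacent_intervals (h.congr e1) (h'.congr e2)]
  congr 1
  · exact (intervalIntegral.integral_congr_ae (Filter.Eventually.of_forall fun s hs => e1 hs)).symm
  · exact (intervalIntegral.integral_congr_ae (Filter.Eventually.of_forall fun s hs => e2 hs)).symm

section Optimal

variable {p T t : ℝ} {G : Set (EuclideanSpace ℝ (Fin d))}
  {L : EuclideanSpace ℝ (Fin d) → EuclideanSpace ℝ (Fin d) → ℝ → ℝ}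
  {g : EuclideanSpace ℝ (Fin d) → ℝ}
  {x : EuclideanSpace ℝ (Fin d)} {y v : ℝ → EuclideanSpace ℝ (Fin d)}

theorem IsOptimal.isPath (hp : 1 ≤ p) (htT : t ≤ T) (h : IsOptimal p T G L g x t y v) :
    IsPath p G t T y v := ((isTrajectory_iff hp htT).1 h.1).1

/-- Allows the velocity to be replaced by a measurable representative. -/
theorem IsOptimal.congr_velocity {v' : ℝ → EuclideanSpace ℝ (Fin d)} (hp : 1 ≤ p) (htT : t ≤ T)
    (h : IsOptimal p T G L g x t y v) (hv : ∀ᵐ s, s ∈ Ioc t T → v' s = v s) :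
    IsOptimal p T G L g x t y v' := by
  refine ⟨(isTrajectory_iff hp htT).2 ⟨(h.isPath hp htT).congr_velocity hv, h.1.start⟩, ?_⟩
  have : totalCost T L g t y v' = totalCost T L g t y v := by
    unfold totalCost
    congr 1
    apply intervalIntegral.integral_congr_ae
    filter_upwards [hv] with s hs hs'
    rw [uIoc_of_le htT] at hs'
    rw [hs hs']
  rw [this]
  exact h.2

/-- Comparison with a path that leaves the optimal trajectory at time `a`. -/
theorem IsOptimal.terminal_le (hp : 1 ≤ p) (ht : 0 ≤ t) (hL : IntegrableAlongPaths p T G L)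
    (h : IsOptimal p T G L g x t y v) {a : ℝ} (hta : t ≤ a) (haT : a ≤ T)
    {z w : ℝ → EuclideanSpace ℝ (Fin d)} (hz : IsPath p G a T z w) (hza : z a = y a) :
    (∫ s in a..T, L (y s) (v s) s) + g (y T) ≤ (∫ s in a..T, L (z s) (w s) s) + g (z T) := by
  have hy := h.isPath hp (hta.trans haT)
  have hy1 := hy.mono hp le_rfl haT
  have i1 := hL _ _ _ _ ht hta haT hy1
  have i2 := hL _ _ _ _ (ht.trans hta) haT le_rfl hz
  have i3 := hL _ _ _ _ (ht.trans hta) haT le_rfl (hy.mono hp hta le_rfl)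
  have hc := hy1.concat hp hta haT hz hza.symm
  have := h.2 _ _ ((isTrajectory_iff hp (hta.trans haT)).2
    ⟨hc, by simp only [hta, if_true]; exact h.1.start⟩)
  unfold totalCost at this
  rw [integral_concat hta haT i1 i2, ← intervalIntegral.integral_add_adjacent_intervals i1 i3]
    at this
  -- When `a = T` the concatenated path ends on its first branch, but there `z` and `y` agree.
  have hT : (if T ≤ a then y T else z T) = z T := by
    split_ifs with h'
    · have : a = T := le_antisymm haT h'
      rw [← this, hza]
    · rfl
  simp only [hT] at this
  linarith

/-- Comparison with a path that coincides with the optimal trajectory outside `[a, b]`. -/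
theorem IsOptimal.integral_le (hp : 1 ≤ p) (ht : 0 ≤ t) (hL : IntegrableAlongPaths p T G L)
    (h : IsOptimal p T G L g x t y v) {a b : ℝ} (hta : t ≤ a) (hab : a ≤ b) (hbT : b ≤ T)
    {z w : ℝ → EuclideanSpace ℝ (Fin d)} (hz : IsPath p G a b z w) (hza : z a = y a)
    (hzb : z b = y b) :
    ∫ s in a..b, L (y s) (v s) s ≤ ∫ s in a..b, L (z s) (w s) s := by
  have hy := h.isPath hp (hta.trans (hab.trans hbT))
  have hy1 := hy.mono hp (hta.trans hab) (le_refl T)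
  have ha := ht.trans hta
  have i1 := hL _ _ _ _ (ha.trans hab) hbT le_rfl hy1
  have i2 := hL _ _ _ _ ha hab hbT hz
  have i3 := hL _ _ _ _ ha hab hbT (hy.mono hp hta hbT)
  have hc := hz.concat hp hab hbT hy1 hzb
  have := h.terminal_le hp ht hL hta (hab.trans hbT) hc (by simp [hab, hza])
  rw [integral_concat hab hbT i2 i1, ← intervalIntegral.integral_add_adjacent_intervals i3 i1]
    at this
  have hT : (if T ≤ b then z T else y T) = y T := by
    split_ifs with h'
    · have : b = T := le_antisymm hbT h'
      rw [← this, hzb]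
    · rfl
  simp only [hT] at this
  linarith

end Optimal

/-! ### Geometry of networks -/

theorem edgeDomain_top : edgeDomain ⊤ = Ici 0 := by
  ext r; simp [edgeDomain]

theorem edgeDomain_eq_Icc {l : ENNReal} (hl : l ≠ ⊤) : edgeDomain l = Icc 0 l.toReal := by
  ext r
  simp only [edgeDomain, mem_ofPred_eq, mem_Icc]
  refine and_congr_right fun _ => ?_
  rw [ENNReal.ofReal_le_iff_le_toReal hl]

theorem minWith_le_left {N : ℕ} (c : ℝ) (S : Finset (Fin N)) (f : Fin N → ℝ) :
    minWith c S f ≤ c := by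
  unfold minWith; rw [Finset.fold_min_le]; exact Or.inl le_rfl

theorem minWith_le {N : ℕ} (c : ℝ) {S : Finset (Fin N)} (f : Fin N → ℝ) {i : Fin N}
    (hi : i ∈ S) : minWith c S f ≤ f i := by
  unfold minWith; rw [Finset.fold_min_le]; exact Or.inr ⟨i, hi, le_rfl⟩

theorem le_minWith {N : ℕ} {b c : ℝ} {S : Finset (Fin N)} {f : Fin N → ℝ} (hc : b ≤ c)
    (hf : ∀ i ∈ S, b ≤ f i) : b ≤ minWith c S f := by
  unfold minWith; rw [Finset.le_fold_min]; exact ⟨hc, hf⟩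

theorem continuousOn_minWith {N : ℕ} {c : ℝ → ℝ} {S : Finset (Fin N)} {f : Fin N → ℝ → ℝ}
    {s : Set ℝ} (hc : ContinuousOn c s) (hf : ∀ i ∈ S, ContinuousOn (f i) s) :
    ContinuousOn (fun t => minWith (c t) S (fun i => f i t)) s := by
  classical
  unfold minWith
  induction S using Finset.induction_on with
  | empty => simpa using hc
  | insert i S hi ih =>
    simp only [Finset.fold_insert hi]
    exact ContinuousOn.inf (hf i (by simp)) (ih fun j hj => hf j (by simp [hj]))

namespace Network

variable {d n N : ℕ} (𝒩 : Network d n N)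

theorem coord_param (i : Fin N) (r : ℝ) : 𝒩.coord i (𝒩.param i r) = r := by
  simp [coord, param, rayPoint, inner_smul_right, 𝒩.norm_dir i]

theorem continuous_coord (i : Fin N) : Continuous (𝒩.coord i) := by
  unfold coord; fun_prop

theorem continuous_param (i : Fin N) : Continuous (𝒩.param i) := by
  unfold param rayPoint; fun_prop

theorem param_sub_param (i : Fin N) (r r' : ℝ) :
    𝒩.param i r - 𝒩.param i r' = (r - r') • 𝒩.dir i := by
  unfold param rayPoint; module

theorem norm_param_sub_param (i : Fin N) (r r' : ℝ) :
    ‖𝒩.param i r - 𝒩.param i r'‖ = |r - r'| := by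
  rw [param_sub_param, norm_smul, 𝒩.norm_dir, mul_one, Real.norm_eq_abs]

theorem coord_sub_coord (i : Fin N) (z z' : EuclideanSpace ℝ (Fin d)) :
    𝒩.coord i z - 𝒩.coord i z' = inner ℝ (𝒩.dir i) (z - z') := by
  unfold coord; rw [← inner_sub_right]; congr 1; abel

theorem abs_inner_dir_le (i : Fin N) (a : EuclideanSpace ℝ (Fin d)) :
    |inner ℝ (𝒩.dir i) a| ≤ ‖a‖ := by
  have := abs_real_inner_le_norm (𝒩.dir i) a
  rwa [𝒩.norm_dir, one_mul] at this

theorem param_coord {i : Fin N} {z : EuclideanSpace ℝ (Fin d)} (hz : z ∈ 𝒩.edge i) :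
    𝒩.param i (𝒩.coord i z) = z := by
  obtain ⟨r, _, rfl⟩ := hz
  rw [coord_param]

theorem coord_mem_dom {i : Fin N} {z : EuclideanSpace ℝ (Fin d)} (hz : z ∈ 𝒩.edge i) :
    𝒩.coord i z ∈ 𝒩.dom i := by
  obtain ⟨r, hr, rfl⟩ := hz
  rwa [coord_param]

theorem param_mem_edge {i : Fin N} {r : ℝ} (hr : r ∈ 𝒩.dom i) : 𝒩.param i r ∈ 𝒩.edge i :=
  ⟨r, hr, rfl⟩

theorem dom_eq (i : Fin N) :
    𝒩.dom i = Ici 0 ∨ (𝒩.len i ≠ ⊤ ∧ 𝒩.dom i = Icc 0 (𝒩.len i).toReal) := by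
  by_cases h : 𝒩.len i = ⊤
  · left; unfold dom; rw [h, edgeDomain_top]
  · right; exact ⟨h, edgeDomain_eq_Icc h⟩

theorem len_toReal_pos {i : Fin N} (h : 𝒩.len i ≠ ⊤) : 0 < (𝒩.len i).toReal :=
  ENNReal.toReal_pos (𝒩.len_pos i).ne' h

theorem isClosed_dom (i : Fin N) : IsClosed (𝒩.dom i) := by
  rcases 𝒩.dom_eq i with h | ⟨_, h⟩ <;> rw [h]
  · exact isClosed_Ici
  · exact isClosed_Icc

theorem convex_dom (i : Fin N) : Convex ℝ (𝒩.dom i) := by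
  rcases 𝒩.dom_eq i with h | ⟨_, h⟩ <;> rw [h]
  · exact convex_Ici 0
  · exact convex_Icc 0 _

theorem nonneg_of_mem_dom {i : Fin N} {r : ℝ} (hr : r ∈ 𝒩.dom i) : 0 ≤ r := hr.1

theorem zero_mem_dom (i : Fin N) : (0 : ℝ) ∈ 𝒩.dom i := ⟨le_rfl, by simp⟩

theorem isClosed_edge (i : Fin N) : IsClosed (𝒩.edge i) := by
  have : 𝒩.edge i = 𝒩.coord i ⁻¹' 𝒩.dom i ∩ {z | 𝒩.param i (𝒩.coord i z) = z} := by
    ext z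
    constructor
    · exact fun hz => ⟨𝒩.coord_mem_dom hz, 𝒩.param_coord hz⟩
    · rintro ⟨h1, h2⟩
      exact ⟨_, h1, h2⟩
  rw [this]
  exact ((𝒩.isClosed_dom i).preimage (𝒩.continuous_coord i)).inter
    (isClosed_eq ((𝒩.continuous_param i).comp (𝒩.continuous_coord i)) continuous_id)

theorem isClosed_vertices : IsClosed 𝒩.vertices := (finite_range _).isClosed

theorem convex_edge (i : Fin N) : Convex ℝ (𝒩.edge i) := by
  rintro _ ⟨r, hr, rfl⟩ _ ⟨r', hr', rfl⟩ a b ha hb hab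
  refine ⟨a * r + b * r', 𝒩.convex_dom i hr hr' ha hb hab, ?_⟩
  unfold param rayPoint
  have : a = 1 - b := by linarith
  subst this
  module

theorem edge_subset_carrier (i : Fin N) : 𝒩.edge i ⊆ 𝒩.carrier :=
  (subset_iUnion 𝒩.edge i).trans subset_union_right

theorem vertex_mem_carrier (k : Fin n) : 𝒩.vertex k ∈ 𝒩.carrier := Or.inl ⟨k, rfl⟩

theorem exists_mem_edge {z : EuclideanSpace ℝ (Fin d)} (hz : z ∈ 𝒩.carrier)
    (hv : z ∉ 𝒩.vertices) : ∃ i, z ∈ 𝒩.edge i := by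
  rcases hz with h | h
  · exact absurd h hv
  · exact mem_iUnion.1 h

theorem edge_unique {i j : Fin N} {z : EuclideanSpace ℝ (Fin d)} (hi : z ∈ 𝒩.edge i)
    (hj : z ∈ 𝒩.edge j) (hv : z ∉ 𝒩.vertices) : i = j := by
  by_contra h
  exact hv (𝒩.inter_subset i j h ⟨hi, hj⟩)

theorem param_zero_mem_vertices (i : Fin N) : 𝒩.param i 0 ∈ 𝒩.vertices :=
  ⟨𝒩.src i, by simp [param, rayPoint]⟩

theorem param_len_mem_vertices {i : Fin N} (h : 𝒩.len i ≠ ⊤) :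
    𝒩.param i (𝒩.len i).toReal ∈ 𝒩.vertices := by
  obtain ⟨k, hk⟩ := 𝒩.endpoint i h
  exact ⟨k, hk.symm⟩

theorem param_mem_vertices_iff {i : Fin N} {r : ℝ} (hr : r ∈ 𝒩.dom i) :
    𝒩.param i r ∈ 𝒩.vertices ↔ r = 0 ∨ (𝒩.len i ≠ ⊤ ∧ r = (𝒩.len i).toReal) := by
  constructor
  · rintro ⟨k, hk⟩
    exact 𝒩.vertex_on_edge i r hr k hk.symm
  · rintro (rfl | ⟨h, rfl⟩)
    · exact 𝒩.param_zero_mem_vertices i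
    · exact 𝒩.param_len_mem_vertices h

theorem mem_interior_dom_iff {i : Fin N} {r : ℝ} (hr : r ∈ 𝒩.dom i) :
    r ∈ interior (𝒩.dom i) ↔ 𝒩.param i r ∉ 𝒩.vertices := by
  rw [𝒩.param_mem_vertices_iff hr]
  by_cases h : 𝒩.len i = ⊤
  · have e : 𝒩.dom i = Ici 0 := by unfold dom; rw [h, edgeDomain_top]
    rw [e] at hr ⊢
    simp only [interior_Ici, mem_Ioi, h, ne_eq, not_true, false_and, or_false]
    exact ⟨fun h => h.ne', fun h => lt_of_le_of_ne hr (Ne.symm h)⟩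
  · have e : 𝒩.dom i = Icc 0 (𝒩.len i).toReal := edgeDomain_eq_Icc h
    rw [e] at hr ⊢
    simp only [interior_Icc, mem_Ioo, ne_eq, h, not_false_eq_true, true_and, not_or]
    exact ⟨fun h => ⟨h.1.ne', h.2.ne⟩, fun h => ⟨lt_of_le_of_ne hr.1 (Ne.symm h.1),
      lt_of_le_of_ne hr.2 h.2⟩⟩

/-- On an edge only the endpoints are vertices, so `κ` is the smallest finite length. An excursion
between vertices thus has displacement zero or at least `κ`. -/
theorem exists_vertex_gap : ∃ κ > 0, ∀ i, ∀ r ∈ 𝒩.dom i, ∀ r' ∈ 𝒩.dom i,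
    𝒩.param i r ∈ 𝒩.vertices → 𝒩.param i r' ∈ 𝒩.vertices → r = r' ∨ κ ≤ |r - r'| := by
  have hpos : ∀ i, 𝒩.len i ≠ ⊤ → 0 < (𝒩.len i).toReal := fun i => 𝒩.len_toReal_pos
  obtain ⟨κ, hκ, hle⟩ : ∃ κ > 0, ∀ i, 𝒩.len i ≠ ⊤ → κ ≤ (𝒩.len i).toReal := by
    classical
    -- The extra index `none` makes the minimum exist when there are no edges; infinite edges get
    -- the dummy length `1`.
    have := Finite.exists_min (fun i : Option (Fin N) => i.elim (1 : ℝ)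
      (fun i => if 𝒩.len i = ⊤ then 1 else (𝒩.len i).toReal))
    obtain ⟨i₀, hi₀⟩ := this
    refine ⟨_, ?_, fun i hi => (hi₀ (some i)).trans (by simp [hi])⟩
    rcases i₀ with _ | i₀
    · simp
    · by_cases h : 𝒩.len i₀ = ⊤
      · simp [h]
      · simp [h, hpos i₀ h]
  refine ⟨κ, hκ, fun i r hr r' hr' h h' => ?_⟩
  rcases (𝒩.param_mem_vertices_iff hr).1 h with rfl | ⟨hl, rfl⟩
  · rcases (𝒩.param_mem_vertices_iff hr').1 h' with rfl | ⟨hl, rfl⟩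
    · exact Or.inl rfl
    · right; rw [zero_sub, abs_neg, abs_of_pos (hpos i hl)]; exact hle i hl
  · rcases (𝒩.param_mem_vertices_iff hr').1 h' with rfl | ⟨hl, rfl⟩
    · right; rw [sub_zero, abs_of_pos (hpos i hl)]; exact hle i hl
    · exact Or.inl rfl

/-- Near a vertex, a network is a star. -/
theorem exists_star_radius : ∃ ρ > 0, ∀ k, ∀ z ∈ 𝒩.carrier, dist z (𝒩.vertex k) < ρ →
    segment ℝ (𝒩.vertex k) z ⊆ 𝒩.carrier := by
  have key : ∀ k, ∃ ρ > 0, ∀ z ∈ 𝒩.carrier, dist z (𝒩.vertex k) < ρ →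
      segment ℝ (𝒩.vertex k) z ⊆ 𝒩.carrier := by
    intro k
    -- The other vertices and the edges that avoid `vertex k` form a closed set. Within its distance
    -- from `vertex k`, every point other than the vertex lies on an edge through it, and edges are
    -- convex.
    set F : Set (EuclideanSpace ℝ (Fin d)) :=
      (⋃ j ∈ {j | j ≠ k}, {𝒩.vertex j}) ∪ ⋃ i ∈ {i | 𝒩.vertex k ∉ 𝒩.edge i}, 𝒩.edge i with hF
    have hFc : IsClosed F := by
      refine IsClosed.union ?_ ?_
      · exact (toFinite _).isClosed_biUnion fun j _ => isClosed_singleton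
      · exact (toFinite _).isClosed_biUnion fun i _ => 𝒩.isClosed_edge i
    have hk : 𝒩.vertex k ∈ Fᶜ := by
      rintro (h | h)
      · simp only [mem_ofPred_eq, mem_iUnion, mem_singleton_iff] at h
        obtain ⟨j, hj, h⟩ := h
        exact hj (𝒩.vertex_injective h.symm)
      · simp only [mem_ofPred_eq, mem_iUnion] at h
        obtain ⟨i, hi, h⟩ := h
        exact hi h
    obtain ⟨ρ, hρ, hsub⟩ := Metric.isOpen_iff.1 hFc.isOpen_compl _ hk
    refine ⟨ρ, hρ, fun z hz hdist => ?_⟩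
    have hzF := hsub (Metric.mem_ball.2 hdist)
    rcases hz with ⟨j, rfl⟩ | h
    · have : j = k := by
        by_contra hne
        exact hzF (Or.inl (by simp only [mem_ofPred_eq, mem_iUnion]; exact ⟨j, hne, rfl⟩))
      subst this
      rw [segment_same, singleton_subset_iff]
      exact 𝒩.vertex_mem_carrier j
    · obtain ⟨i, hi⟩ := mem_iUnion.1 h
      have : 𝒩.vertex k ∈ 𝒩.edge i := by
        by_contra hne
        exact hzF (Or.inr (by simp only [mem_ofPred_eq, mem_iUnion]; exact ⟨i, hne, hi⟩))
      exact ((𝒩.convex_edge i).segment_subset this hi).trans (𝒩.edge_subset_carrier i)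
  choose ρ hρ hρ' using key
  rcases isEmpty_or_nonempty (Fin n) with he | hne
  · exact ⟨1, one_pos, fun k => he.elim k⟩
  · obtain ⟨k₀, hk₀⟩ := Finite.exists_min ρ
    exact ⟨ρ k₀, hρ k₀, fun k z hz hd => hρ' k z hz (hd.trans_le (hk₀ k))⟩

/-- A connected subset of the network without vertices is contained in one edge. -/
theorem exists_subset_edge {S : Set (EuclideanSpace ℝ (Fin d))} (hS : IsPreconnected S)
    (hne : S.Nonempty) (hG : S ⊆ 𝒩.carrier) (hv : Disjoint S 𝒩.vertices) :
    ∃ i, S ⊆ 𝒩.edge i := by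
  obtain ⟨z, hz⟩ := hne
  obtain ⟨i, hi⟩ := 𝒩.exists_mem_edge (hG hz) (disjoint_left.1 hv hz)
  refine ⟨i, fun z' hz' => ?_⟩
  by_contra hn
  have hcl : IsClosed (⋃ j ∈ {j | j ≠ i}, 𝒩.edge j) :=
    (toFinite _).isClosed_biUnion fun j _ => 𝒩.isClosed_edge j
  have hcov : ∀ z ∈ S, z ∉ 𝒩.edge i → z ∈ ⋃ j ∈ {j | j ≠ i}, 𝒩.edge j := by
    intro z hz hzi
    obtain ⟨j, hj⟩ := 𝒩.exists_mem_edge (hG hz) (disjoint_left.1 hv hz)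
    simp only [mem_ofPred_eq, mem_iUnion]
    exact ⟨j, fun h => hzi (h ▸ hj), hj⟩
  -- If `S` left edge `i`, connectedness would give a point of `S` shared with another edge, that
  -- is, a vertex.
  obtain ⟨q, hq, hq1, hq2⟩ := isPreconnected_closed_iff.1 hS _ _ (𝒩.isClosed_edge i) hcl
    (fun z hz => by
      by_cases h : z ∈ 𝒩.edge i
      · exact Or.inl h
      · exact Or.inr (hcov z hz h)) ⟨z, hz, hi⟩ ⟨z', hz', hcov z' hz' hn⟩
  simp only [mem_ofPred_eq, mem_iUnion] at hq2
  obtain ⟨j, hj, hqj⟩ := hq2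
  exact hj (𝒩.edge_unique hqj hq1 (disjoint_left.1 hv hq))

/-! ### Values of the costs -/

variable (ℓ : Fin N → ℝ → ℝ → ℝ → ℝ) (ℓstar : Fin n → ℝ → ℝ) (g : Fin N → ℝ → ℝ)
  (gstar : Fin n → ℝ)

theorem sum_indicator_edge {i : Fin N} {z : EuclideanSpace ℝ (Fin d)} (hz : z ∈ 𝒩.edge i)
    (hv : z ∉ 𝒩.vertices) (f : Fin N → EuclideanSpace ℝ (Fin d) → ℝ)
    (h : Fin n → EuclideanSpace ℝ (Fin d) → ℝ) :
    (∑ i, (𝒩.edge i \ 𝒩.vertices).indicator (f i) z) +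
      ∑ k, ({𝒩.vertex k} : Set (EuclideanSpace ℝ (Fin d))).indicator (h k) z = f i z := by
  rw [Finset.sum_eq_single i, Finset.sum_eq_zero, add_zero, indicator_of_mem]
  · exact ⟨hz, hv⟩
  · intro k _
    apply indicator_of_notMem
    intro hk
    exact hv ⟨k, (mem_singleton_iff.1 hk).symm⟩
  · intro j _ hj
    apply indicator_of_notMem
    intro hj'
    exact hj (𝒩.edge_unique hj'.1 hz hv)
  · simp

theorem sum_indicator_vertex (k : Fin n) (f : Fin N → EuclideanSpace ℝ (Fin d) → ℝ)
    (h : Fin n → EuclideanSpace ℝ (Fin d) → ℝ) :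
    (∑ i, (𝒩.edge i \ 𝒩.vertices).indicator (f i) (𝒩.vertex k)) +
      ∑ k', ({𝒩.vertex k'} : Set (EuclideanSpace ℝ (Fin d))).indicator (h k') (𝒩.vertex k) =
    h k (𝒩.vertex k) := by
  rw [Finset.sum_eq_zero, Finset.sum_eq_single k, zero_add, indicator_of_mem]
  · rfl
  · intro j _ hj
    apply indicator_of_notMem
    intro hj'
    exact hj (𝒩.vertex_injective (mem_singleton_iff.1 hj').symm)
  · simp
  · intro i _
    apply indicator_of_notMem
    intro hi
    exact hi.2 ⟨k, rfl⟩

theorem runningCost_edge {i : Fin N} {z : EuclideanSpace ℝ (Fin d)} (hz : z ∈ 𝒩.edge i)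
    (hv : z ∉ 𝒩.vertices) (a : EuclideanSpace ℝ (Fin d)) (s : ℝ) :
    𝒩.runningCost ℓ ℓstar z a s = ℓ i (𝒩.coord i z) (inner ℝ (𝒩.dir i) a) s :=
  𝒩.sum_indicator_edge hz hv (fun i z => ℓ i (𝒩.coord i z) (inner ℝ (𝒩.dir i) a) s) _

theorem runningCost_vertex (k : Fin n) (a : EuclideanSpace ℝ (Fin d)) (s : ℝ) :
    𝒩.runningCost ℓ ℓstar (𝒩.vertex k) a s =
      minWith (ℓstar k s) (𝒩.adjacent k) (fun i => ℓ i (𝒩.coord i (𝒩.vertex k)) 0 s) :=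
  𝒩.sum_indicator_vertex k _ fun k O =>
    minWith (ℓstar k s) (𝒩.adjacent k) (fun i => ℓ i (𝒩.coord i O) 0 s)

theorem terminalCost_edge {i : Fin N} {z : EuclideanSpace ℝ (Fin d)} (hz : z ∈ 𝒩.edge i)
    (hv : z ∉ 𝒩.vertices) : 𝒩.terminalCost g gstar z = g i (𝒩.coord i z) :=
  𝒩.sum_indicator_edge hz hv (fun i z => g i (𝒩.coord i z)) _

theorem terminalCost_vertex (k : Fin n) :
    𝒩.terminalCost g gstar (𝒩.vertex k) =
      minWith (gstar k) (𝒩.adjacent k) (fun i => g i (𝒩.coord i (𝒩.vertex k))) :=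
  𝒩.sum_indicator_vertex k _ fun k O =>
    minWith (gstar k) (𝒩.adjacent k) (fun i => g i (𝒩.coord i O))

/-- The minimum at the vertices has the favourable sign: a competitor that stops at a vertex pays no
more than the limit along the edge. -/
theorem terminalCost_le {i : Fin N} {z : EuclideanSpace ℝ (Fin d)} (hz : z ∈ 𝒩.edge i) :
    𝒩.terminalCost g gstar z ≤ g i (𝒩.coord i z) := by
  by_cases hv : z ∈ 𝒩.vertices
  · obtain ⟨k, rfl⟩ := hv
    rw [terminalCost_vertex]
    exact minWith_le (gstar k) (fun i => g i (𝒩.coord i (𝒩.vertex k)))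
      (by simp [adjacent, hz])
  · exact (𝒩.terminalCost_edge g gstar hz hv).le

theorem exists_bound_terminalCost {g : Fin N → ℝ → ℝ} (hg : TerminalCostAssumptions 𝒩.dom g) :
    ∃ M, ∀ z ∈ 𝒩.carrier, |𝒩.terminalCost g gstar z| ≤ M := by
  choose M hM using hg.bounded
  have hM0 : ∀ i, 0 ≤ M i := fun i => (abs_nonneg _).trans (hM i 0 (𝒩.zero_mem_dom i))
  have h1 : ∀ i, M i ≤ ∑ i, M i := fun i =>
    Finset.single_le_sum (fun j _ => hM0 j) (Finset.mem_univ i)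
  have h2 : ∀ k, |gstar k| ≤ ∑ k, |gstar k| := fun k =>
    Finset.single_le_sum (f := fun k => |gstar k|) (fun j _ => abs_nonneg _) (Finset.mem_univ k)
  have h3 : 0 ≤ ∑ i, M i := Finset.sum_nonneg fun i _ => hM0 i
  have h4 : 0 ≤ ∑ k, |gstar k| := Finset.sum_nonneg fun i _ => abs_nonneg _
  refine ⟨(∑ i, M i) + ∑ k, |gstar k|, fun z hz => ?_⟩
  by_cases hv : z ∈ 𝒩.vertices
  · obtain ⟨k, rfl⟩ := hv
    rw [terminalCost_vertex, abs_le]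
    constructor
    · apply le_minWith
      · linarith [neg_abs_le (gstar k), h2 k]
      · intro i hi
        have := hM i _ (𝒩.coord_mem_dom (i := i) (by simpa [adjacent] using hi))
        linarith [neg_abs_le (g i (𝒩.coord i (𝒩.vertex k))), h1 i]
    · exact (minWith_le_left _ _ _).trans (by linarith [le_abs_self (gstar k), h2 k])
  · obtain ⟨i, hi⟩ := 𝒩.exists_mem_edge hz hv
    rw [𝒩.terminalCost_edge g gstar hi hv]
    linarith [hM i _ (𝒩.coord_mem_dom hi), h1 i]

end Network

/-! ### Growth of the running cost and integrability along paths -/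

theorem abs_le_one_add_rpow {p : ℝ} (hp : 1 ≤ p) {a : ℝ} (ha : 0 ≤ a) : a ≤ 1 + a ^ p := by
  rcases le_total a 1 with h | h
  · have := Real.rpow_nonneg ha p; linarith
  · have := Real.rpow_le_rpow_of_exponent_le h hp
    rw [Real.rpow_one] at this; linarith

theorem mul_rpow_sub_one {p : ℝ} (hp : 1 < p) {a : ℝ} (ha : 0 ≤ a) :
    a * a ^ (p - 1) = a ^ p := by
  rcases ha.eq_or_lt with rfl | h
  · rw [Real.zero_rpow (by linarith : p ≠ 0), zero_mul]
  · rw [Real.rpow_sub_one h.ne']; field_simp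

theorem IsRegularRunningCost.hasDerivAt_speed {T : ℝ} {D : Set ℝ} {ℓ : ℝ → ℝ → ℝ → ℝ}
    (h : IsRegularRunningCost T D ℓ) {y a s : ℝ} (hy : y ∈ D) (hs : s ∈ Icc 0 T) :
    HasDerivAt (fun b => ℓ y b s) (partialSpeed ℓ y a s) a := by
  have h1 : DifferentiableWithinAt ℝ (fun q : ℝ × ℝ => ℓ q.1 q.2 s) (D ×ˢ univ) (y, a) :=
    h.differentiableOn s hs (y, a) ⟨hy, mem_univ _⟩
  have h2 : DifferentiableWithinAt ℝ (fun b : ℝ => (y, b)) univ a := by fun_prop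
  have h3 := h1.comp a h2 (fun b _ => ⟨hy, mem_univ _⟩)
  rw [differentiableWithinAt_univ] at h3
  exact h3.hasDerivAt

/-- The costs of `RunningCostAssumptions` and their partial derivatives have polynomial growth. -/
theorem RunningCostAssumptions.exists_growth_bound {N n : ℕ} {p T : ℝ} (hp : 1 < p)
    {D : Fin N → Set ℝ} {ℓ : Fin N → ℝ → ℝ → ℝ → ℝ} {ℓstar : Fin n → ℝ → ℝ}
    (hA : RunningCostAssumptions p T D ℓ ℓstar) (hD : ∀ i, IsClosed (D i)) (r : ℝ) :
    ∃ C, 0 ≤ C ∧ (∀ k, ∀ s ∈ Icc 0 T, |ℓstar k s| ≤ C) ∧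
      ∀ i, ∀ y ∈ D i ∩ Icc 0 r, ∀ a, ∀ s ∈ Icc 0 T,
        |ℓ i y a s| ≤ C * (1 + |a| ^ p) ∧ |partialPos (D i) (ℓ i) y a s| ≤ C * (1 + |a| ^ p) ∧
        |partialSpeed (ℓ i) y a s| ≤ C * (1 + |a| ^ (p - 1)) := by
  -- The growth assumption needs a positive radius, whereas `r` is arbitrary.
  obtain ⟨c, hc, hder⟩ := hA.deriv_growth (max r 1) (by positivity)
  have h0 : ∀ i, ∃ M, 0 ≤ M ∧ ∀ y ∈ D i ∩ Icc 0 r, ∀ s ∈ Icc 0 T, |ℓ i y 0 s| ≤ M := by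
    intro i
    have hK : IsCompact ((D i ∩ Icc 0 r) ×ˢ (({0} : Set ℝ) ×ˢ Icc 0 T)) :=
      (isCompact_Icc.inter_left (hD i)).prod (isCompact_singleton.prod isCompact_Icc)
    obtain ⟨M, hM⟩ := hK.exists_bound_of_continuousOn ((hA.regular i).continuousOn.mono
      (prod_mono inter_subset_left (prod_mono (subset_univ _) le_rfl)))
    refine ⟨max M 0, le_max_right _ _, fun y hy s hs => ?_⟩
    exact (hM (y, 0, s) ⟨hy, rfl, hs⟩).trans (le_max_left _ _)
  choose M hM0 hM using h0
  have h1 : ∀ k, ∃ M, 0 ≤ M ∧ ∀ s ∈ Icc 0 T, |ℓstar k s| ≤ M := by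
    intro k
    obtain ⟨M, hM⟩ := isCompact_Icc.exists_bound_of_continuousOn (hA.continuousOn_star k)
    exact ⟨max M 0, le_max_right _ _, fun s hs => (hM s hs).trans (le_max_left _ _)⟩
  choose S hS0 hS using h1
  have hMs : ∀ i, M i ≤ ∑ i, M i := fun i =>
    Finset.single_le_sum (fun j _ => hM0 j) (Finset.mem_univ i)
  have hSs : ∀ i, S i ≤ ∑ i, S i := fun i =>
    Finset.single_le_sum (fun j _ => hS0 j) (Finset.mem_univ i)
  have hM' : 0 ≤ ∑ i, M i := Finset.sum_nonneg fun i _ => hM0 i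
  have hS' : 0 ≤ ∑ i, S i := Finset.sum_nonneg fun i _ => hS0 i
  refine ⟨2 * c + (∑ i, M i) + ∑ k, S k, by positivity, fun k s hs => ?_,
    fun i y hy a s hs => ?_⟩
  · linarith [hS k s hs, hSs k]
  have hy' : y ∈ D i ∩ Icc 0 (max r 1) := ⟨hy.1, hy.2.1, hy.2.2.trans (le_max_left _ _)⟩
  have hap : 0 ≤ |a| ^ p := Real.rpow_nonneg (abs_nonneg _) _
  have hap1 : 0 ≤ |a| ^ (p - 1) := Real.rpow_nonneg (abs_nonneg _) _
  refine ⟨?_, ?_, ?_⟩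
  -- The growth of `ℓ` comes from its values at speed zero, bounded by compactness, and the mean
  -- value inequality in the speed.
  · have hdiff : |ℓ i y a s - ℓ i y 0 s| ≤ c * (|a| ^ (p - 1) + 1) * |a| := by
      have := (convex_uIcc (0 : ℝ) a).norm_image_sub_le_of_norm_hasDerivWithin_le
        (f := fun b => ℓ i y b s) (f' := fun b => partialSpeed (ℓ i) y b s)
        (C := c * (|a| ^ (p - 1) + 1))
        (fun b _ => ((hA.regular i).hasDerivAt_speed hy.1 hs).hasDerivWithinAt)
        (fun b hb => ?_) left_mem_uIcc right_mem_uIcc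
      · simpa [Real.norm_eq_abs] using this
      · refine ((hder i y hy' b s hs).2).trans ?_
        have : |b| ≤ |a| := by
          have := abs_sub_left_of_mem_uIcc hb
          simpa using this
        gcongr
    have h2 : c * (|a| ^ (p - 1) + 1) * |a| = c * (|a| ^ p + |a|) := by
      rw [← mul_rpow_sub_one hp (abs_nonneg a)]; ring
    have h3 : |a| ≤ 1 + |a| ^ p := abs_le_one_add_rpow hp.le (abs_nonneg a)
    have h4 : |ℓ i y a s| ≤ |ℓ i y a s - ℓ i y 0 s| + |ℓ i y 0 s| := by
      simpa using abs_add_le (ℓ i y a s - ℓ i y 0 s) (ℓ i y 0 s)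
    have h5 := hM i y hy s hs
    have h6 : c * (|a| ^ p + |a|) ≤ 2 * c * (1 + |a| ^ p) := by
      rw [mul_comm 2 c, mul_assoc]
      exact mul_le_mul_of_nonneg_left (by linarith) hc
    nlinarith [hMs i, mul_nonneg hM' hap, mul_nonneg hS' hap]
  · refine ((hder i y hy' a s hs).1).trans ?_
    nlinarith [mul_nonneg hM' hap, mul_nonneg hS' hap, mul_nonneg hc hap]
  · refine ((hder i y hy' a s hs).2).trans ?_
    nlinarith [mul_nonneg hM' hap1, mul_nonneg hS' hap1, mul_nonneg hc hap1]

/-- `f` is controlled only on `S`; the image measure of `h` is concentrated there, so measurability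
with respect to it suffices. -/
theorem aestronglyMeasurable_comp_continuousOn {X : Type*} [TopologicalSpace X]
    [MeasurableSpace X] [OpensMeasurableSpace X] {f : X → ℝ} {S : Set X}
    (hf : ContinuousOn f S) (hS : MeasurableSet S) {h : ℝ → X} {μ : Measure ℝ}
    (hh : AEMeasurable h μ) (hm : ∀ᵐ s ∂μ, h s ∈ S) :
    AEStronglyMeasurable (fun s => f (h s)) μ := by
  have h1 : AEMeasurable f ((μ.map h).restrict S) := hf.aemeasurable hS
  have h2 : (μ.map h).restrict S = μ.map h :=
    Measure.restrict_eq_self_of_ae_mem ((ae_map_iff hh hS).2 hm)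
  rw [h2] at h1
  exact (h1.comp_aemeasurable hh).aestronglyMeasurable

theorem integrable_one_add_norm_rpow {E : Type*} [NormedAddCommGroup E] {p : ℝ} (hp : 1 ≤ p)
    {μ : Measure ℝ} [IsFiniteMeasure μ] {w : ℝ → E} (hw : MemLp w (ENNReal.ofReal p) μ) :
    Integrable (fun s => 1 + ‖w s‖ ^ p) μ := by
  have h1 := hw.integrable_norm_rpow (by simp; linarith) ENNReal.ofReal_ne_top
  rw [ENNReal.toReal_ofReal (by linarith)] at h1
  exact (integrable_const 1).add h1

namespace Network

variable {d n N : ℕ} {𝒩 : Network d n N} {p T : ℝ} {ℓ : Fin N → ℝ → ℝ → ℝ → ℝ}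
  {ℓstar : Fin n → ℝ → ℝ}

theorem exists_coord_bound (R : ℝ) :
    ∃ r, 0 < r ∧ ∀ i, ∀ z ∈ 𝒩.edge i, ‖z‖ ≤ R → 𝒩.coord i z ∈ 𝒩.dom i ∩ Icc 0 r := by
  refine ⟨max R 0 + 1 + ∑ k, ‖𝒩.vertex k‖, ?_, fun i z hz hR => ⟨𝒩.coord_mem_dom hz,
    𝒩.nonneg_of_mem_dom (𝒩.coord_mem_dom hz), ?_⟩⟩
  · have := Finset.sum_nonneg (s := Finset.univ) fun k _ => norm_nonneg (𝒩.vertex k)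
    positivity
  · have h1 : 𝒩.coord i z ≤ ‖z - 𝒩.vertex (𝒩.src i)‖ :=
      (le_abs_self _).trans (𝒩.abs_inner_dir_le i _)
    have h2 := norm_sub_le z (𝒩.vertex (𝒩.src i))
    have h3 : ‖𝒩.vertex (𝒩.src i)‖ ≤ ∑ k, ‖𝒩.vertex k‖ :=
      Finset.single_le_sum (f := fun k => ‖𝒩.vertex k‖) (fun k _ => norm_nonneg _)
        (Finset.mem_univ _)
    linarith [le_max_left R 0]

theorem exists_runningCost_bound (hp : 1 < p) (hA : RunningCostAssumptions p T 𝒩.dom ℓ ℓstar)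
    (R : ℝ) : ∃ C, 0 ≤ C ∧ ∀ z ∈ 𝒩.carrier, ‖z‖ ≤ R → ∀ a, ∀ s ∈ Icc 0 T,
      |𝒩.runningCost ℓ ℓstar z a s| ≤ C * (1 + ‖a‖ ^ p) := by
  obtain ⟨r, hr, hcoord⟩ := exists_coord_bound (𝒩 := 𝒩) R
  obtain ⟨C, hC, hstar, hbd⟩ := hA.exists_growth_bound hp 𝒩.isClosed_dom r
  refine ⟨C, hC, fun z hz hzR a s hs => ?_⟩
  have hap : 0 ≤ C * ‖a‖ ^ p := mul_nonneg hC (Real.rpow_nonneg (norm_nonneg _) _)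
  by_cases hv : z ∈ 𝒩.vertices
  · obtain ⟨k, rfl⟩ := hv
    rw [runningCost_vertex, abs_le]
    have h1 := abs_le.1 (hstar k s hs)
    constructor
    · apply le_minWith
      · linarith
      · intro i hi
        have hi' : 𝒩.vertex k ∈ 𝒩.edge i := by simpa [adjacent] using hi
        have := abs_le.1 (hbd i _ (hcoord i _ hi' hzR) 0 s hs).1
        rw [abs_zero, Real.zero_rpow (by linarith)] at this
        linarith
    · exact (minWith_le_left _ _ _).trans (by linarith)
  · obtain ⟨i, hi⟩ := 𝒩.exists_mem_edge hz hv
    rw [𝒩.runningCost_edge ℓ ℓstar hi hv]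
    refine (hbd i _ (hcoord i z hi hzR) _ s hs).1.trans ?_
    have := 𝒩.abs_inner_dir_le i a
    have hp0 : 0 ≤ p := by linarith
    gcongr

theorem aestronglyMeasurable_runningCost (hA : RunningCostAssumptions p T 𝒩.dom ℓ ℓstar)
    {a b : ℝ} (ha : 0 ≤ a) (hb : b ≤ T) {z w : ℝ → EuclideanSpace ℝ (Fin d)}
    (hz : ContinuousOn z (Icc a b))
    (hw : AEStronglyMeasurable w (volume.restrict (Ioc a b))) :
    AEStronglyMeasurable (fun s => 𝒩.runningCost ℓ ℓstar (z s) (w s) s)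
      (volume.restrict (Ioc a b)) := by
  rcases le_or_gt b a with hab | hab
  · rw [Ioc_eq_empty (not_lt.2 hab), Measure.restrict_empty]
    exact aestronglyMeasurable_zero_measure _
  -- Freezing `z` outside `[a, b]` makes it continuous on the line, so that the sets of times spent
  -- on an edge or at a vertex are measurable.
  have hz' : Continuous (fun s => z (projIcc a b hab.le s)) :=
    hz.domRestrict.comp continuous_projIcc
  have hsub : Ioc a b ⊆ Icc 0 T := fun s hs => ⟨ha.trans hs.1.le, hs.2.trans hb⟩
  have hmem : ∀ᵐ s ∂(volume.restrict (Ioc a b)), s ∈ Icc 0 T := by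
    rw [ae_restrict_iff' measurableSet_Ioc]
    exact Filter.Eventually.of_forall hsub
  have key : AEStronglyMeasurable
      (fun s => 𝒩.runningCost ℓ ℓstar (z (projIcc a b hab.le s)) (w s) s)
      (volume.restrict (Ioc a b)) := by
    unfold runningCost
    refine AEStronglyMeasurable.add ?_ ?_
    · refine Finset.aestronglyMeasurable_fun_sum _ fun i _ => ?_
      have hS : MeasurableSet {s | z (projIcc a b hab.le s) ∈ 𝒩.edge i \ 𝒩.vertices} :=
        hz'.measurable ((𝒩.isClosed_edge i).measurableSet.diff 𝒩.isClosed_vertices.measurableSet)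
      have : AEStronglyMeasurable ({s | z (projIcc a b hab.le s) ∈ 𝒩.edge i \ 𝒩.vertices}.indicator
          (fun s => ℓ i (𝒩.coord i (z (projIcc a b hab.le s))) (inner ℝ (𝒩.dir i) (w s)) s))
          (volume.restrict (Ioc a b)) := by
        rw [aestronglyMeasurable_indicator_iff hS]
        refine aestronglyMeasurable_comp_continuousOn (hA.regular i).continuousOn
          (((𝒩.isClosed_dom i).prod (isClosed_univ.prod isClosed_Icc)).measurableSet)
          (h := fun s => (𝒩.coord i (z (projIcc a b hab.le s)), inner ℝ (𝒩.dir i) (w s), s)) ?_ ?_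
        · refine AEMeasurable.prodMk ?_ (AEMeasurable.prodMk ?_ aemeasurable_id)
          · exact ((𝒩.continuous_coord i).comp hz').aemeasurable
          · exact (hw.mono_measure Measure.restrict_le_self).const_inner.aemeasurable
        · rw [ae_restrict_iff' hS]
          filter_upwards [hmem] with s hs hs'
          exact ⟨𝒩.coord_mem_dom hs'.1, mem_univ _, hs⟩
      exact this
    · refine Finset.aestronglyMeasurable_fun_sum _ fun k _ => ?_
      have hS : MeasurableSet {s | z (projIcc a b hab.le s) ∈
          ({𝒩.vertex k} : Set (EuclideanSpace ℝ (Fin d)))} :=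
        hz'.measurable (measurableSet_singleton _)
      have : AEStronglyMeasurable ({s | z (projIcc a b hab.le s) ∈
          ({𝒩.vertex k} : Set (EuclideanSpace ℝ (Fin d)))}.indicator
          (fun s => minWith (ℓstar k s) (𝒩.adjacent k)
            (fun i => ℓ i (𝒩.coord i (𝒩.vertex k)) 0 s))) (volume.restrict (Ioc a b)) := by
        refine AEStronglyMeasurable.indicator ?_ hS
        refine ContinuousOn.aestronglyMeasurable ?_ measurableSet_Ioc
        refine (continuousOn_minWith (hA.continuousOn_star k) fun i hi => ?_).mono hsub
        have hi' : 𝒩.vertex k ∈ 𝒩.edge i := by simpa [adjacent] using hi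
        exact (hA.regular i).continuousOn.comp
          (f := fun s => (𝒩.coord i (𝒩.vertex k), (0 : ℝ), s)) (by fun_prop)
          (fun s hs => ⟨𝒩.coord_mem_dom hi', mem_univ _, hs⟩)
      refine this.congr (Filter.Eventually.of_forall fun s => ?_)
      simp only [indicator, mem_ofPred_eq, mem_singleton_iff]
      split_ifs with h
      · rw [h]
      · rfl
  refine key.congr ?_
  rw [Filter.EventuallyEq, ae_restrict_iff' measurableSet_Ioc]
  refine Filter.Eventually.of_forall fun s hs => ?_
  rw [projIcc_of_mem hab.le (Ioc_subset_Icc_self hs)]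

theorem integrableAlongPaths_runningCost (hp : 1 < p)
    (hA : RunningCostAssumptions p T 𝒩.dom ℓ ℓstar) :
    IntegrableAlongPaths p T 𝒩.carrier (𝒩.runningCost ℓ ℓstar) := by
  intro a b z w ha hab hb h
  have hz := h.continuousOn hp.le hab
  obtain ⟨R, hR⟩ := isCompact_Icc.exists_bound_of_continuousOn hz
  obtain ⟨C, hC, hbd⟩ := exists_runningCost_bound hp hA R
  rw [intervalIntegrable_iff_integrableOn_Ioc_of_le hab]
  refine Integrable.mono' ((integrable_one_add_norm_rpow hp.le h.memLp).const_mul C)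
    (aestronglyMeasurable_runningCost hA ha hb hz h.memLp.1) ?_
  rw [ae_restrict_iff' measurableSet_Ioc]
  refine Filter.Eventually.of_forall fun s hs => ?_
  have hs' := Ioc_subset_Icc_self hs
  exact hbd _ (h.mapsTo hs') (hR s hs') _ s ⟨ha.trans hs.1.le, hs.2.trans hb⟩

end Network

/-! ### Velocities along paths in a network -/

theorem integral_mono_of_ae_Ioo {f g : ℝ → ℝ} {a b : ℝ} (hab : a ≤ b)
    (hf : IntervalIntegrable f volume a b) (hg : IntervalIntegrable g volume a b)
    (h : ∀ᵐ s, s ∈ Ioo a b → f s ≤ g s) : ∫ s in a..b, f s ≤ ∫ s in a..b, g s := by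
  rw [intervalIntegral.integral_of_le hab, intervalIntegral.integral_of_le hab,
    integral_Ioc_eq_integral_Ioo, integral_Ioc_eq_integral_Ioo]
  exact setIntegral_mono_ae_restrict (hf.1.mono_set Ioo_subset_Ioc_self)
    (hg.1.mono_set Ioo_subset_Ioc_self) ((ae_restrict_iff' measurableSet_Ioo).2 h)

/-- All but countably many points of a level set are its limits from the right, and slopes between
points of the level set vanish. -/
theorem deriv_eq_zero_of_level_set {E : Type*} [NormedAddCommGroup E] [NormedSpace ℝ E]
    (z w : ℝ → E) (O : E) : ∀ᵐ s, z s = O → HasDerivAt z (w s) s → w s = 0 := by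
  have hc := (countable_setOfPred_isolated_right_within (s := {s | z s = O})).ae_notMem volume
  filter_upwards [hc] with s hs hzs hd
  simp only [not_and] at hs
  have hne : (𝓝[{s | z s = O} ∩ Ioi s] s).NeBot := ⟨hs hzs⟩
  have h1 := hd.hasDerivWithinAt (s := {s | z s = O} ∩ Ioi s)
  rw [hasDerivWithinAt_iff_tendsto_slope' (fun h => lt_irrefl s h.2)] at h1
  refine tendsto_nhds_unique h1 (tendsto_const_nhds.congr' ?_)
  filter_upwards [self_mem_nhdsWithin] with u hu
  rw [slope_def_module]
  have h3 : z u = O := hu.1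
  rw [h3, hzs, sub_self, smul_zero]

theorem IsPath.ae_hasDerivAt {d : ℕ} {p a b : ℝ} {G : Set (EuclideanSpace ℝ (Fin d))}
    {z w : ℝ → EuclideanSpace ℝ (Fin d)} (hp : 1 ≤ p) (hab : a ≤ b) (h : IsPath p G a b z w) :
    ∀ᵐ s, s ∈ Ioo a b → HasDerivAt z (w s) s := by
  filter_upwards [(h.intervalIntegrable hp hab).ae_hasDerivAt_integral] with s hs hs'
  rw [uIcc_of_le hab] at hs
  have h1 := (hs (Ioo_subset_Icc_self hs') a (left_mem_Icc.2 hab)).const_add (z a)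
  refine h1.congr_of_eventuallyEq ?_
  filter_upwards [Ioo_mem_nhds hs'.1 hs'.2] with u hu
  exact h.eq_integral u (Ioo_subset_Icc_self hu)

namespace Network

variable {d n N : ℕ} {𝒩 : Network d n N} {p T : ℝ} {ℓ : Fin N → ℝ → ℝ → ℝ → ℝ}
  {ℓstar : Fin n → ℝ → ℝ} {a b : ℝ} {z w : ℝ → EuclideanSpace ℝ (Fin d)}

/-- The times spent at vertices may form a complicated set of positive measure; since the velocity
vanishes there, only excursions need an estimate. -/
theorem ae_velocity_vertex (hp : 1 ≤ p) (hab : a ≤ b) (h : IsPath p 𝒩.carrier a b z w) :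
    ∀ᵐ s, s ∈ Ioo a b → z s ∈ 𝒩.vertices → w s = 0 := by
  have := ae_all_iff.2 fun k => deriv_eq_zero_of_level_set z w (𝒩.vertex k)
  filter_upwards [h.ae_hasDerivAt hp hab, this] with s hs hs' hsI hv
  obtain ⟨k, hk⟩ := hv
  exact hs' k hk.symm (hs hsI)

theorem eventually_mem_edge {i : Fin N} {O : EuclideanSpace ℝ (Fin d)} (hi : O ∈ 𝒩.edge i)
    (hv : O ∉ 𝒩.vertices) : ∀ᶠ q in 𝓝 O, q ∈ 𝒩.carrier → q ∈ 𝒩.edge i ∧ q ∉ 𝒩.vertices := by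
  have hcl : IsClosed (⋃ j ∈ {j | j ≠ i}, 𝒩.edge j) :=
    (toFinite _).isClosed_biUnion fun j _ => 𝒩.isClosed_edge j
  have hO : O ∉ ⋃ j ∈ {j | j ≠ i}, 𝒩.edge j := by
    simp only [mem_iUnion, not_exists]
    exact fun j hj hO => hj (𝒩.edge_unique hO hi hv)
  filter_upwards [hcl.isOpen_compl.mem_nhds hO, 𝒩.isClosed_vertices.isOpen_compl.mem_nhds hv]
    with q hq hq' hqG
  obtain ⟨j, hj⟩ := 𝒩.exists_mem_edge hqG hq'
  refine ⟨?_, hq'⟩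
  by_contra hne
  apply hq
  simp only [mem_iUnion]
  exact ⟨j, fun h => hne (h ▸ hj), hj⟩

/-- Near a time spent in an open edge the path is `param` of its own coordinate; differentiate this
identity. It makes coercivity in the signed speed a coercivity in `‖w‖`. -/
theorem ae_velocity_edge (hp : 1 ≤ p) (hab : a ≤ b) (h : IsPath p 𝒩.carrier a b z w) :
    ∀ᵐ s, s ∈ Ioo a b → ∀ i, z s ∈ 𝒩.edge i → z s ∉ 𝒩.vertices →
      w s = (inner ℝ (𝒩.dir i) (w s) : ℝ) • 𝒩.dir i := by
  filter_upwards [h.ae_hasDerivAt hp hab] with s hs hsI i hi hv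
  have hd := hs hsI
  have h1 : HasDerivAt (fun u => 𝒩.coord i (z u)) (inner ℝ (𝒩.dir i) (w s)) s := by
    have := (hd.sub_const (𝒩.vertex (𝒩.src i)))
    simpa [coord] using (hasDerivAt_const s (𝒩.dir i)).inner ℝ this
  have h2 : HasDerivAt (fun u => 𝒩.param i (𝒩.coord i (z u)))
      ((inner ℝ (𝒩.dir i) (w s) : ℝ) • 𝒩.dir i) s :=
    (h1.smul_const (𝒩.dir i)).const_add _
  refine hd.unique (h2.congr_of_eventuallyEq ?_)
  filter_upwards [hd.continuousAt.eventually (eventually_mem_edge hi hv),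
    Ioo_mem_nhds hsI.1 hsI.2] with u hu hu'
  exact (𝒩.param_coord (hu (h.mapsTo (Ioo_subset_Icc_self hu'))).1).symm

theorem ae_abs_inner_dir (hp : 1 ≤ p) (hab : a ≤ b) (h : IsPath p 𝒩.carrier a b z w) :
    ∀ᵐ s, s ∈ Ioo a b → ∀ i, z s ∈ 𝒩.edge i → z s ∉ 𝒩.vertices →
      |inner ℝ (𝒩.dir i) (w s)| = ‖w s‖ := by
  filter_upwards [ae_velocity_edge hp hab h] with s hs hsI i hi hv
  conv_rhs => rw [hs hsI i hi hv, norm_smul, 𝒩.norm_dir, mul_one, Real.norm_eq_abs]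

/-- Coercivity of the running cost along a path. -/
theorem ae_runningCost_ge (hp : 1 < p) {C₀ c₀ : ℝ}
    (hc : ∀ i, ∀ y ∈ 𝒩.dom i, ∀ a : ℝ, ∀ s ∈ Icc 0 T, C₀ * |a| ^ p + c₀ ≤ ℓ i y a s)
    (hc' : ∀ k, ∀ s ∈ Icc 0 T, c₀ ≤ ℓstar k s) (hC₀ : 0 < C₀) (ha : 0 ≤ a) (hb : b ≤ T)
    (hab : a ≤ b) (h : IsPath p 𝒩.carrier a b z w) :
    ∀ᵐ s, s ∈ Ioo a b → C₀ * ‖w s‖ ^ p + c₀ ≤ 𝒩.runningCost ℓ ℓstar (z s) (w s) s := by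
  filter_upwards [ae_abs_inner_dir hp.le hab h, ae_velocity_vertex hp.le hab h]
    with s hs hs' hsI
  have hsT : s ∈ Icc 0 T := ⟨ha.trans hsI.1.le, hsI.2.le.trans hb⟩
  by_cases hv : z s ∈ 𝒩.vertices
  -- At a vertex the cost ignores the velocity, so the bound depends on `w` being zero there.
  · rw [hs' hsI hv, norm_zero, Real.zero_rpow (by linarith), mul_zero, zero_add]
    obtain ⟨k, hk⟩ := hv
    rw [← hk, runningCost_vertex]
    refine le_minWith (hc' k s hsT) fun i hi => ?_
    have hi' : 𝒩.vertex k ∈ 𝒩.edge i := by simpa [adjacent] using hi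
    refine le_trans ?_ (hc i _ (𝒩.coord_mem_dom hi') 0 s hsT)
    have : 0 ≤ C₀ * |(0:ℝ)| ^ p := by positivity
    linarith
  · obtain ⟨i, hi⟩ := 𝒩.exists_mem_edge (h.mapsTo (Ioo_subset_Icc_self hsI)) hv
    rw [𝒩.runningCost_edge ℓ ℓstar hi hv, ← hs hsI i hi hv]
    exact hc i _ (𝒩.coord_mem_dom hi) _ s hsT

theorem integral_runningCost_ge (hp : 1 < p) (hA : RunningCostAssumptions p T 𝒩.dom ℓ ℓstar)
    {C₀ c₀ : ℝ}
    (hc : ∀ i, ∀ y ∈ 𝒩.dom i, ∀ a : ℝ, ∀ s ∈ Icc 0 T, C₀ * |a| ^ p + c₀ ≤ ℓ i y a s)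
    (hc' : ∀ k, ∀ s ∈ Icc 0 T, c₀ ≤ ℓstar k s) (hC₀ : 0 < C₀) (ha : 0 ≤ a) (hb : b ≤ T)
    (hab : a ≤ b) (h : IsPath p 𝒩.carrier a b z w) :
    C₀ * (∫ s in a..b, ‖w s‖ ^ p) + c₀ * (b - a) ≤
      ∫ s in a..b, 𝒩.runningCost ℓ ℓstar (z s) (w s) s := by
  have hi : IntervalIntegrable (fun s => ‖w s‖ ^ p) volume a b := by
    rw [intervalIntegrable_iff_integrableOn_Ioc_of_le hab]
    have := h.memLp.integrable_norm_rpow (by simp; linarith) ENNReal.ofReal_ne_top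
    rwa [ENNReal.toReal_ofReal (by linarith)] at this
  have e : C₀ * (∫ s in a..b, ‖w s‖ ^ p) + c₀ * (b - a) =
      ∫ s in a..b, (C₀ * ‖w s‖ ^ p + c₀) := by
    rw [intervalIntegral.integral_add (hi.const_mul _) intervalIntegrable_const,
      intervalIntegral.integral_const_mul, intervalIntegral.integral_const, smul_eq_mul]
    ring
  rw [e]
  exact integral_mono_of_ae_Ioo hab ((hi.const_mul _).add intervalIntegrable_const)
    (integrableAlongPaths_runningCost hp hA _ _ _ _ ha hab hb h)
    (ae_runningCost_ge hp hc hc' hC₀ ha hb hab h)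

end Network

/-! ### First variation and oscillation of the momentum -/

theorem IsRegularRunningCost.hasDerivAt_comp_line {T : ℝ} {D : Set ℝ} {ℓ : ℝ → ℝ → ℝ → ℝ}
    (h : IsRegularRunningCost T D ℓ) {y a s φ w ε : ℝ} (hy : y + ε * φ ∈ interior D)
    (hs : s ∈ Icc 0 T) :
    HasDerivAt (fun ε => ℓ (y + ε * φ) (a + ε * w) s)
      (partialPos D ℓ (y + ε * φ) (a + ε * w) s * φ +
        partialSpeed ℓ (y + ε * φ) (a + ε * w) s * w) ε := by
  set Y := y + ε * φ with hY
  set A := a + ε * w with hA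
  have hD : D ∈ 𝓝 Y := mem_interior_iff_mem_nhds.1 hy
  have h1 : DifferentiableAt ℝ (fun q : ℝ × ℝ => ℓ q.1 q.2 s) (Y, A) :=
    (h.differentiableOn s hs (Y, A) ⟨interior_subset hy, mem_univ _⟩).differentiableAt
      (prod_mem_nhds hD Filter.univ_mem)
  have hf := h1.hasFDerivAt
  set f' := fderiv ℝ (fun q : ℝ × ℝ => ℓ q.1 q.2 s) (Y, A)
  have e1 : partialPos D ℓ Y A s = f' (1, 0) := by
    unfold partialPos
    rw [derivWithin_of_mem_nhds hD]
    have : HasDerivAt (fun z : ℝ => (z, A)) (1, 0) Y :=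
      (hasDerivAt_id Y).prodMk (hasDerivAt_const Y A)
    exact (hf.comp_hasDerivAt (f := fun z : ℝ => (z, A)) Y this).deriv
  have e2 : partialSpeed ℓ Y A s = f' (0, 1) := by
    unfold partialSpeed
    have : HasDerivAt (fun b : ℝ => (Y, b)) (0, 1) A :=
      (hasDerivAt_const A Y).prodMk (hasDerivAt_id A)
    exact (hf.comp_hasDerivAt (f := fun b : ℝ => (Y, b)) A this).deriv
  have hl : HasDerivAt (fun ε : ℝ => (y + ε * φ, a + ε * w)) (φ, w) ε := by
    have h2 : HasDerivAt (fun ε : ℝ => y + ε * φ) φ ε := by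
      simpa using ((hasDerivAt_id ε).mul_const φ).const_add y
    have h3 : HasDerivAt (fun ε : ℝ => a + ε * w) w ε := by
      simpa using ((hasDerivAt_id ε).mul_const w).const_add a
    exact h2.prodMk h3
  have h4 := hf.comp_hasDerivAt (f := fun ε : ℝ => (y + ε * φ, a + ε * w)) ε hl
  have e3 : f' (φ, w) = f' (1, 0) * φ + f' (0, 1) * w := by
    have : ((φ, w) : ℝ × ℝ) = φ • ((1, 0) : ℝ × ℝ) + w • ((0, 1) : ℝ × ℝ) := by
      ext <;> simp
    rw [this, map_add, map_smul, map_smul, smul_eq_mul, smul_eq_mul]; ring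
  rw [e1, e2, ← e3]
  exact h4

theorem one_add_rpow_sub_one_le {p x : ℝ} (hp : 1 < p) (hx : 0 ≤ x) :
    1 + x ^ (p - 1) ≤ 2 * (1 + x ^ p) := by
  have h : x ^ (p - 1) ≤ 1 + x ^ p := by
    rcases le_total x 1 with h | h
    · have h1 := Real.rpow_le_one hx h (by linarith : 0 ≤ p - 1)
      have h2 := Real.rpow_nonneg hx p
      linarith
    · have h1 := Real.rpow_le_rpow_of_exponent_le h (by linarith : p - 1 ≤ p)
      linarith
  have h2 := Real.rpow_nonneg hx p
  linarith

/-- Growth conditions on the running cost of one edge, for positions in `[0, r]`. -/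
def HasGrowth (p T r C : ℝ) (D : Set ℝ) (ℓ : ℝ → ℝ → ℝ → ℝ) : Prop :=
  ∀ y ∈ D ∩ Icc 0 r, ∀ a, ∀ s ∈ Icc 0 T,
    |ℓ y a s| ≤ C * (1 + |a| ^ p) ∧ |partialPos D ℓ y a s| ≤ C * (1 + |a| ^ p) ∧
    |partialSpeed ℓ y a s| ≤ C * (1 + |a| ^ (p - 1))

section

variable {p T r C : ℝ} {D : Set ℝ} {ℓ : ℝ → ℝ → ℝ → ℝ} {c d : ℝ} {u a : ℝ → ℝ}

theorem aestronglyMeasurable_comp_curve {f : ℝ → ℝ → ℝ → ℝ}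
    (hf : ContinuousOn (fun q : ℝ × ℝ × ℝ => f q.1 q.2.1 q.2.2) (D ×ˢ univ ×ˢ Icc 0 T))
    (hD : IsClosed D) (hc : 0 ≤ c) (hd : d ≤ T) (hu : ContinuousOn u (Icc c d))
    (ha : AEStronglyMeasurable a (volume.restrict (Ioc c d))) (huD : ∀ s ∈ Icc c d, u s ∈ D) :
    AEStronglyMeasurable (fun s => f (u s) (a s) s) (volume.restrict (Ioc c d)) := by
  refine aestronglyMeasurable_comp_continuousOn hf
    ((hD.prod (isClosed_univ.prod isClosed_Icc)).measurableSet)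
    (h := fun s => (u s, a s, s)) ?_ ?_
  · exact AEMeasurable.prodMk ((hu.mono Ioc_subset_Icc_self).aestronglyMeasurable
      measurableSet_Ioc).aemeasurable (ha.aemeasurable.prodMk aemeasurable_id)
  · rw [ae_restrict_iff' measurableSet_Ioc]
    exact Filter.Eventually.of_forall fun s hs =>
      ⟨huD s (Ioc_subset_Icc_self hs), mem_univ _, hc.trans hs.1.le, hs.2.trans hd⟩

theorem intervalIntegrable_of_growth (hp : 1 < p) {f : ℝ → ℝ → ℝ → ℝ}
    (hf : ContinuousOn (fun q : ℝ × ℝ × ℝ => f q.1 q.2.1 q.2.2) (D ×ˢ univ ×ˢ Icc 0 T))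
    (hg : ∀ y ∈ D ∩ Icc 0 r, ∀ a, ∀ s ∈ Icc 0 T, |f y a s| ≤ C * (1 + |a| ^ p))
    (hD : IsClosed D) (hc : 0 ≤ c) (hcd : c ≤ d) (hd : d ≤ T) (hu : ContinuousOn u (Icc c d))
    (ha : MemLp a (ENNReal.ofReal p) (volume.restrict (Ioc c d)))
    (huD : ∀ s ∈ Icc c d, u s ∈ D ∩ Icc 0 r) :
    IntervalIntegrable (fun s => f (u s) (a s) s) volume c d := by
  rw [intervalIntegrable_iff_integrableOn_Ioc_of_le hcd]
  refine Integrable.mono' ((integrable_one_add_norm_rpow hp.le ha).const_mul C)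
    (aestronglyMeasurable_comp_curve hf hD hc hd hu ha.1 fun s hs => (huD s hs).1) ?_
  rw [ae_restrict_iff' measurableSet_Ioc]
  exact Filter.Eventually.of_forall fun s hs =>
    hg _ (huD s (Ioc_subset_Icc_self hs)) _ s ⟨hc.trans hs.1.le, hs.2.trans hd⟩

/-- Differentiation under the integral at `ε = 0`, which is a local minimum. The variations remain
in the interior of `D`, where `partialPos` is a two-sided derivative, and `w` is bounded so that the
integrands have a common integrable bound. -/
theorem first_variation_eq_zero (hp : 1 < p) (hreg : IsRegularRunningCost T D ℓ)
    (hD : IsClosed D) (hg : HasGrowth p T r C D ℓ) (hc : 0 ≤ c) (hcd : c ≤ d) (hd : d ≤ T)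
    (hu : ContinuousOn u (Icc c d))
    (ha : MemLp a (ENNReal.ofReal p) (volume.restrict (Ioc c d)))
    {φ w : ℝ → ℝ} {Φ W ε₀ : ℝ} (hφ : ContinuousOn φ (Icc c d)) (hΦ : ∀ s ∈ Icc c d, |φ s| ≤ Φ)
    (hw : Measurable w) (hW : ∀ s, |w s| ≤ W) (hε₀ : 0 < ε₀) (hε₁ : ε₀ ≤ 1)
    (hint : ∀ ε, |ε| < ε₀ → ∀ s ∈ Icc c d, u s + ε * φ s ∈ interior D ∩ Icc 0 r)
    (hmin : ∀ ε, |ε| < ε₀ → ∫ s in c..d, ℓ (u s) (a s) s ≤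
      ∫ s in c..d, ℓ (u s + ε * φ s) (a s + ε * w s) s) :
    ∫ s in c..d, (partialPos D ℓ (u s) (a s) s * φ s + partialSpeed ℓ (u s) (a s) s * w s) =
      0 := by
  have hΦ0 : 0 ≤ Φ := (abs_nonneg _).trans (hΦ c ⟨le_rfl, hcd⟩)
  have hW0 : 0 ≤ W := (abs_nonneg _).trans (hW c)
  have hu0 : ∀ s ∈ Icc c d, u s ∈ interior D ∩ Icc 0 r := fun s hs => by
    simpa using hint 0 (by simpa using hε₀) s hs
  have hT : ∀ s ∈ Icc c d, s ∈ Icc 0 T := fun s hs => ⟨hc.trans hs.1, hs.2.trans hd⟩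
  have hC : 0 ≤ C := by
    have h1 := (hg (u c) ⟨interior_subset (hu0 c ⟨le_rfl, hcd⟩).1, (hu0 c ⟨le_rfl, hcd⟩).2⟩ 0 c
      (hT c ⟨le_rfl, hcd⟩)).1
    rw [abs_zero, Real.zero_rpow (by linarith), add_zero, mul_one] at h1
    exact (abs_nonneg _).trans h1
  have hwL : MemLp w (ENNReal.ofReal p) (volume.restrict (Ioc c d)) :=
    MemLp.of_bound hw.aestronglyMeasurable W (Filter.Eventually.of_forall hW)
  have hline : ∀ ε : ℝ, MemLp (fun s => a s + ε * w s) (ENNReal.ofReal p)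
      (volume.restrict (Ioc c d)) := fun ε => ha.add (hwL.const_mul ε)
  have hball : ∀ ε ∈ Metric.ball (0 : ℝ) ε₀, |ε| < ε₀ := fun ε hε => by
    simpa [Real.dist_eq] using hε
  have hcont : ∀ ε : ℝ, ContinuousOn (fun s => u s + ε * φ s) (Icc c d) := fun ε =>
    hu.add (continuousOn_const.mul hφ)
  have hFint : ∀ ε, |ε| < ε₀ →
      IntervalIntegrable (fun s => ℓ (u s + ε * φ s) (a s + ε * w s) s) volume c d := fun ε hε =>
    intervalIntegrable_of_growth hp hreg.continuousOn (fun y hy a s hs => (hg y hy a s hs).1) hD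
      hc hcd hd (hcont ε) (hline ε)
      fun s hs => ⟨interior_subset (hint ε hε s hs).1, (hint ε hε s hs).2⟩
  -- The bound uses `|a + ε w| ≤ |a| + W`, valid since `|ε| < 1`; the term of growth `p - 1` is
  -- absorbed into growth `p`, which produces the factor `2`.
  have key := intervalIntegral.hasDerivAt_integral_of_dominated_loc_of_deriv_le
    (μ := volume) (a := c) (b := d) (𝕜 := ℝ)
    (F := fun ε s => ℓ (u s + ε * φ s) (a s + ε * w s) s)
    (F' := fun ε s => partialPos D ℓ (u s + ε * φ s) (a s + ε * w s) s * φ s +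
      partialSpeed ℓ (u s + ε * φ s) (a s + ε * w s) s * w s)
    (x₀ := 0) (s := Metric.ball 0 ε₀)
    (bound := fun s => (C * Φ + 2 * C * W) * (1 + ‖|a s| + W‖ ^ p))
    (Metric.ball_mem_nhds _ hε₀) ?_ ?_ ?_ ?_ ?_ ?_
  · have hmin' : IsLocalMin (fun ε => ∫ s in c..d, ℓ (u s + ε * φ s) (a s + ε * w s) s) 0 := by
      filter_upwards [Metric.ball_mem_nhds _ hε₀] with ε hε
      simpa using hmin ε (hball ε hε)
    have := hmin'.hasDerivAt_eq_zero key.2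
    simpa using this
  · filter_upwards [Metric.ball_mem_nhds _ hε₀] with ε hε
    rw [uIoc_of_le hcd]
    exact ((intervalIntegrable_iff_integrableOn_Ioc_of_le hcd).1 (hFint ε (hball ε hε))).1
  · exact hFint 0 (by simpa using hε₀)
  · rw [uIoc_of_le hcd]
    simp only [zero_mul, add_zero]
    refine AEStronglyMeasurable.add (AEStronglyMeasurable.mul ?_ ?_)
      (AEStronglyMeasurable.mul ?_ hw.aestronglyMeasurable)
    · exact aestronglyMeasurable_comp_curve hreg.continuousOn_partialPos hD hc hd hu ha.1
        fun s hs => interior_subset (hu0 s hs).1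
    · exact (hφ.mono Ioc_subset_Icc_self).aestronglyMeasurable measurableSet_Ioc
    · exact aestronglyMeasurable_comp_curve (f := partialSpeed ℓ)
        hreg.continuousOn_partialSpeed hD hc hd hu ha.1 fun s hs => interior_subset (hu0 s hs).1
  · refine Filter.Eventually.of_forall fun s hs ε hε => ?_
    rw [uIoc_of_le hcd] at hs
    have hs' := Ioc_subset_Icc_self hs
    have hε' := hball ε hε
    have hi := hint ε hε' s hs'
    obtain ⟨-, g1, g2⟩ := hg _ ⟨interior_subset hi.1, hi.2⟩ (a s + ε * w s) s (hT s hs')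
    have hX0 : 0 ≤ |a s| + W := by positivity
    have hle : |a s + ε * w s| ≤ |a s| + W := by
      refine (abs_add_le _ _).trans (add_le_add le_rfl ?_)
      rw [abs_mul]
      calc |ε| * |w s| ≤ 1 * W := mul_le_mul (hε'.le.trans hε₁) (hW s) (abs_nonneg _) zero_le_one
        _ = W := one_mul W
    rw [Real.norm_of_nonneg hX0]
    have k1 : |a s + ε * w s| ^ p ≤ (|a s| + W) ^ p :=
      Real.rpow_le_rpow (abs_nonneg _) hle (by linarith)
    have k2 : |a s + ε * w s| ^ (p - 1) ≤ (|a s| + W) ^ (p - 1) :=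
      Real.rpow_le_rpow (abs_nonneg _) hle (by linarith)
    have k3 := one_add_rpow_sub_one_le hp hX0
    have k4 : 0 ≤ (|a s| + W) ^ p := Real.rpow_nonneg hX0 p
    refine (norm_add_le _ _).trans ?_
    rw [norm_mul, norm_mul, Real.norm_eq_abs, Real.norm_eq_abs, Real.norm_eq_abs,
      Real.norm_eq_abs]
    have m1 : |partialPos D ℓ (u s + ε * φ s) (a s + ε * w s) s| * |φ s| ≤
        (C * (1 + (|a s| + W) ^ p)) * Φ :=
      mul_le_mul (g1.trans (mul_le_mul_of_nonneg_left (by linarith) hC)) (hΦ s hs')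
        (abs_nonneg _) (by positivity)
    have m2 : |partialSpeed ℓ (u s + ε * φ s) (a s + ε * w s) s| * |w s| ≤
        (C * (2 * (1 + (|a s| + W) ^ p))) * W :=
      mul_le_mul (g2.trans (mul_le_mul_of_nonneg_left (by linarith) hC)) (hW s)
        (abs_nonneg _) (by positivity)
    linarith
  · rw [intervalIntegrable_iff_integrableOn_Ioc_of_le hcd]
    refine (integrable_one_add_norm_rpow hp.le ?_).const_mul _
    exact ha.norm.add (memLp_const W)
  · refine Filter.Eventually.of_forall fun s hs ε hε => ?_
    rw [uIoc_of_le hcd] at hs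
    have hs' := Ioc_subset_Icc_self hs
    exact hreg.hasDerivAt_comp_line (hint ε (hball ε hε) s hs').1 (hT s hs')

end

/-- If `∫ Q φ + P φ' = 0` for all variations `φ` that vanish at the endpoints, then the essential
oscillation of `P` is at most `∫ |Q|`. -/
theorem essOsc_le_integral {P Q : ℝ → ℝ} {c d : ℝ} (hcd : c ≤ d)
    (hP : IntervalIntegrable P volume c d) (hQ : IntervalIntegrable Q volume c d)
    (hvar : ∀ w : ℝ → ℝ, Measurable w → (∃ W, ∀ s, |w s| ≤ W) → ∫ s in c..d, w s = 0 →
      ∫ s in c..d, (Q s * (∫ u in c..s, w u) + P s * w s) = 0)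
    {A B : Set ℝ} (hA : MeasurableSet A) (hB : MeasurableSet B) (hAs : A ⊆ Ioc c d)
    (hBs : B ⊆ Ioc c d) (hA0 : volume A ≠ 0) (hB0 : volume B ≠ 0) {α β : ℝ}
    (hα : ∀ s ∈ A, α ≤ P s) (hβ : ∀ s ∈ B, P s ≤ β) : α - β ≤ ∫ s in c..d, |Q s| := by
  have hfin : ∀ S : Set ℝ, S ⊆ Ioc c d → volume S ≠ ⊤ := fun S hS =>
    (measure_mono hS |>.trans_lt (by simp)).ne
  set mA := volume.real A with hmA
  set mB := volume.real B with hmB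
  have hmA0 : 0 < mA := ENNReal.toReal_pos hA0 (hfin A hAs)
  have hmB0 : 0 < mB := ENNReal.toReal_pos hB0 (hfin B hBs)
  -- The weights make `w` of mean zero, and its primitive is at most `mA * mB` in absolute value.
  -- Testing gives `∫ P w ≥ mA * mB * (α - β)` against `mA * mB * ∫ |Q|`, and the product of the
  -- measures cancels, however small `A` and `B` are.
  set w : ℝ → ℝ := fun s => A.indicator (fun _ => mB) s - B.indicator (fun _ => mA) s with hw
  have hwm : Measurable w :=
    (measurable_const.indicator hA).sub (measurable_const.indicator hB)
  have hwb : ∀ s, |w s| ≤ mA + mB := by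
    intro s
    rw [hw, abs_le]
    simp only [indicator]
    split_ifs <;> constructor <;> linarith
  have hint : ∀ S : Set ℝ, MeasurableSet S → ∀ m : ℝ, ∀ x y : ℝ,
      IntervalIntegrable (S.indicator fun _ => m) volume x y := fun S hS m x y =>
    ⟨(integrable_const m).indicator hS, (integrable_const m).indicator hS⟩
  have hval : ∀ S : Set ℝ, MeasurableSet S → ∀ m : ℝ, ∀ s ∈ Icc c d,
      ∫ u in c..s, S.indicator (fun _ => m) u = volume.real (S ∩ Ioc c s) * m := by
    intro S hS m s hs
    rw [intervalIntegral.integral_of_le hs.1, integral_indicator hS, setIntegral_const,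
      measureReal_restrict_apply hS, smul_eq_mul]
  have hφ : ∀ s ∈ Icc c d, |∫ u in c..s, w u| ≤ mA * mB := by
    intro s hs
    rw [hw, intervalIntegral.integral_sub (hint A hA mB _ _) (hint B hB mA _ _),
      hval A hA mB s hs, hval B hB mA s hs, abs_le]
    have h1 : volume.real (A ∩ Ioc c s) ≤ mA := measureReal_mono inter_subset_left (hfin A hAs)
    have h2 : volume.real (B ∩ Ioc c s) ≤ mB := measureReal_mono inter_subset_left (hfin B hBs)
    have h3 : 0 ≤ volume.real (A ∩ Ioc c s) := measureReal_nonneg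
    have h4 : 0 ≤ volume.real (B ∩ Ioc c s) := measureReal_nonneg
    constructor <;> nlinarith
  have hw0 : ∫ s in c..d, w s = 0 := by
    rw [hw, intervalIntegral.integral_sub (hint A hA mB _ _) (hint B hB mA _ _),
      hval A hA mB d ⟨hcd, le_rfl⟩, hval B hB mA d ⟨hcd, le_rfl⟩, inter_eq_left.2 hAs,
      inter_eq_left.2 hBs]
    ring
  have hv := hvar w hwm ⟨_, hwb⟩ hw0
  have hwint : ∀ x y, IntervalIntegrable w volume x y := fun x y =>
    (hint A hA mB x y).sub (hint B hB mA x y)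
  have hφc : ContinuousOn (fun s => ∫ u in c..s, w u) (uIcc c d) :=
    (intervalIntegral.continuous_primitive hwint c).continuousOn
  have iQ : IntervalIntegrable (fun s => Q s * ∫ u in c..s, w u) volume c d :=
    hQ.mul_continuousOn hφc
  have iPA : IntervalIntegrable (fun s => A.indicator P s) volume c d := by
    rw [intervalIntegrable_iff] at hP ⊢
    exact hP.indicator hA
  have iPB : IntervalIntegrable (fun s => B.indicator P s) volume c d := by
    rw [intervalIntegrable_iff] at hP ⊢
    exact hP.indicator hB
  have ePw : ∀ s, P s * w s = mB * A.indicator P s - mA * B.indicator P s := by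
    intro s
    simp only [hw, indicator]
    split_ifs <;> ring
  have iPw : IntervalIntegrable (fun s => P s * w s) volume c d := by
    simp only [ePw]
    exact (iPA.const_mul mB).sub (iPB.const_mul mA)
  rw [intervalIntegral.integral_add iQ iPw] at hv
  have e2 : ∫ s in c..d, P s * w s =
      mB * (∫ s in c..d, A.indicator P s) - mA * ∫ s in c..d, B.indicator P s := by
    simp only [ePw]
    rw [intervalIntegral.integral_sub (iPA.const_mul mB) (iPB.const_mul mA),
      intervalIntegral.integral_const_mul, intervalIntegral.integral_const_mul]
  have hlow : mA * α ≤ ∫ s in c..d, A.indicator P s := by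
    have := hval A hA α d ⟨hcd, le_rfl⟩
    rw [inter_eq_left.2 hAs] at this
    rw [← this]
    refine intervalIntegral.integral_mono_on hcd (hint A hA α c d) iPA fun s _ => ?_
    simp only [indicator]
    split_ifs with h
    · exact hα s h
    · exact le_rfl
  have hup : ∫ s in c..d, B.indicator P s ≤ mB * β := by
    have := hval B hB β d ⟨hcd, le_rfl⟩
    rw [inter_eq_left.2 hBs] at this
    rw [← this]
    refine intervalIntegral.integral_mono_on hcd iPB (hint B hB β c d) fun s _ => ?_
    simp only [indicator]
    split_ifs with h
    · exact hβ s h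
    · exact le_rfl
  have hQb : -(mA * mB * ∫ s in c..d, |Q s|) ≤ ∫ s in c..d, Q s * ∫ u in c..s, w u := by
    rw [← intervalIntegral.integral_const_mul, ← intervalIntegral.integral_neg]
    refine intervalIntegral.integral_mono_on hcd (hQ.abs.const_mul _).neg iQ fun s hs => ?_
    have h1 : |Q s * ∫ u in c..s, w u| ≤ |Q s| * (mA * mB) := by
      rw [abs_mul]
      exact mul_le_mul_of_nonneg_left (hφ s hs) (abs_nonneg _)
    linarith [neg_abs_le (Q s * ∫ u in c..s, w u)]
  rw [e2] at hv
  have h5 : mA * mB * (α - β) ≤ mA * mB * ∫ s in c..d, |Q s| := by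
    nlinarith [mul_le_mul_of_nonneg_left hlow hmB0.le, mul_le_mul_of_nonneg_left hup hmA0.le]
  exact le_of_mul_le_mul_left h5 (by positivity)

/-! ### Bounds on the speed along an edge -/

section Momentum

variable {p T r C C₀ c₀ : ℝ} {D : Set ℝ} {ℓ : ℝ → ℝ → ℝ → ℝ} {y a s K : ℝ}

theorem IsRegularRunningCost.partialSpeed_mono (hreg : IsRegularRunningCost T D ℓ) (hy : y ∈ D)
    (hs : s ∈ Icc 0 T) (hconv : StrictConvexOn ℝ univ fun a => ℓ y a s) {b : ℝ} (hab : a ≤ b) :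
    partialSpeed ℓ y a s ≤ partialSpeed ℓ y b s :=
  hconv.convexOn.monotoneOn_deriv
    (fun _ _ => (hreg.hasDerivAt_speed hy hs).differentiableAt) (mem_univ a) (mem_univ b) hab

theorem rpow_sub_const_le_div (hp : 1 < p) (hC₀ : 0 ≤ C₀) {M : ℝ} (hM : 0 ≤ M) (hK : 1 ≤ K)
    (ha : K ≤ a) : C₀ * K ^ (p - 1) - M ≤ (C₀ * a ^ p - M) / a := by
  have ha0 : 0 < a := by linarith
  rw [le_div_iff₀ ha0]
  have h1 : K ^ (p - 1) * a ≤ a ^ p := by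
    rw [← mul_rpow_sub_one hp ha0.le, mul_comm]
    exact mul_le_mul_of_nonneg_left (Real.rpow_le_rpow (by linarith) ha (by linarith)) ha0.le
  nlinarith [mul_le_mul_of_nonneg_left h1 hC₀]

/-- By convexity the momentum at `a` is at least the slope of the chord from speed `0`, and
coercivity makes this slope large. -/
theorem le_partialSpeed (hp : 1 < p) (hreg : IsRegularRunningCost T D ℓ)
    (hg : HasGrowth p T r C D ℓ) (hy : y ∈ D ∩ Icc 0 r) (hs : s ∈ Icc 0 T)
    (hconv : StrictConvexOn ℝ univ fun a => ℓ y a s) (hC₀ : 0 ≤ C₀)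
    (hco : C₀ * |a| ^ p + c₀ ≤ ℓ y a s) (hK : 1 ≤ K) (ha : K ≤ a) :
    C₀ * K ^ (p - 1) - (C + |c₀|) ≤ partialSpeed ℓ y a s := by
  have ha0 : 0 < a := by linarith
  have h0 := (hg y hy 0 s hs).1
  rw [abs_zero, Real.zero_rpow (by linarith), add_zero, mul_one] at h0
  have h1 := hconv.convexOn.slope_le_of_hasDerivAt (mem_univ 0) (mem_univ a) ha0
    (hreg.hasDerivAt_speed hy.1 hs)
  rw [slope_def_field, sub_zero] at h1
  refine le_trans ?_ h1
  refine (rpow_sub_const_le_div hp hC₀ (add_nonneg ((abs_nonneg _).trans h0) (abs_nonneg c₀))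
    hK ha).trans ?_
  rw [abs_of_pos ha0] at hco
  exact div_le_div_of_nonneg_right (by linarith [le_abs_self (ℓ y 0 s), neg_abs_le c₀]) ha0.le

/-- Mirror image of `le_partialSpeed` for large negative speeds. -/
theorem partialSpeed_le (hp : 1 < p) (hreg : IsRegularRunningCost T D ℓ)
    (hg : HasGrowth p T r C D ℓ) (hy : y ∈ D ∩ Icc 0 r) (hs : s ∈ Icc 0 T)
    (hconv : StrictConvexOn ℝ univ fun a => ℓ y a s) (hC₀ : 0 ≤ C₀)
    (hco : C₀ * |a| ^ p + c₀ ≤ ℓ y a s) (hK : 1 ≤ K) (ha : a ≤ -K) :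
    partialSpeed ℓ y a s ≤ -(C₀ * K ^ (p - 1) - (C + |c₀|)) := by
  have ha0 : a < 0 := by linarith
  have h0 := (hg y hy 0 s hs).1
  rw [abs_zero, Real.zero_rpow (by linarith), add_zero, mul_one] at h0
  have h1 := hconv.convexOn.le_slope_of_hasDerivAt (mem_univ a) (mem_univ 0) ha0
    (hreg.hasDerivAt_speed hy.1 hs)
  rw [slope_def_field, zero_sub] at h1
  refine h1.trans ?_
  have h2 := rpow_sub_const_le_div hp hC₀ (add_nonneg ((abs_nonneg _).trans h0) (abs_nonneg c₀))
    hK (show K ≤ -a by linarith)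
  rw [abs_of_neg ha0] at hco
  have h3 : (C₀ * (-a) ^ p - (C + |c₀|)) / -a ≤ (ℓ y a s - ℓ y 0 s) / -a :=
    div_le_div_of_nonneg_right (by linarith [le_abs_self (ℓ y 0 s), neg_abs_le c₀]) (by linarith)
  have h4 : (ℓ y 0 s - ℓ y a s) / -a = -((ℓ y a s - ℓ y 0 s) / -a) := by ring
  rw [h4]
  linarith

theorem exists_rpow_gt {q A : ℝ} (hq : 0 < q) (hA : 0 < A) (B m : ℝ) :
    ∃ K, 1 ≤ K ∧ m < K ∧ B < A * K ^ q := by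
  have h := (tendsto_rpow_atTop hq).const_mul_atTop hA
  obtain ⟨K, h1, h2, h3⟩ := ((h.eventually_gt_atTop B).and
    ((Filter.eventually_ge_atTop 1).and (Filter.eventually_gt_atTop m))).exists
  exact ⟨K, h2, h3, h1⟩

end Momentum

/-- The ends of an excursion may be vertices, where variations would leave the edge, so oscillation
is estimated on compact subintervals only. A set of positive measure still charges a large enough
subinterval. -/
theorem exists_Ioc_inter_ne_zero {c d : ℝ} {S : Set ℝ} (hS : S ⊆ Ioo c d)
    (hS0 : volume S ≠ 0) : ∃ c₀ d₀, c < c₀ ∧ d₀ < d ∧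
      ∀ c' ≤ c₀, ∀ d' ≥ d₀, volume (S ∩ Ioc c' d') ≠ 0 := by
  by_contra! hcon
  apply hS0
  obtain ⟨x, -, hx, hxl⟩ := exists_seq_strictAnti_tendsto c
  obtain ⟨x', -, hx', hxl'⟩ := exists_seq_strictMono_tendsto d
  have hnull : ∀ k, volume (S ∩ Ioc (x k) (x' k)) = 0 := by
    intro k
    obtain ⟨c', hc', d', hd', h⟩ := hcon (x k) (x' k) (hx k) (hx' k)
    exact measure_mono_null (inter_subset_inter_right _ (Ioc_subset_Ioc hc' hd')) h
  refine measure_mono_null (fun s hs => ?_) (measure_iUnion_null hnull)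
  obtain ⟨h1, h2⟩ := hS hs
  obtain ⟨k, hk1, hk2⟩ := ((hxl.eventually_lt_const h1).and (hxl'.eventually_const_lt h2)).exists
  exact mem_iUnion.2 ⟨k, hs, hk1, hk2.le⟩

theorem volume_le_average_ne_zero {a : ℝ → ℝ} {c d m : ℝ} (hcd : c < d)
    (ha : IntervalIntegrable a volume c d) (hm : ∫ s in c..d, a s ≤ m * (d - c)) :
    volume {s ∈ Ioo c d | a s ≤ m} ≠ 0 := by
  have h0 : volume (Ioo c d) ≠ 0 := by simp [hcd]
  have h := measure_le_setAverage_pos h0 (by simp) (ha.1.mono_set Ioo_subset_Ioc_self)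
  refine ne_of_gt (h.trans_le (measure_mono (t := {s ∈ Ioo c d | a s ≤ m})
    fun s hs => ⟨hs.1, le_trans hs.2 ?_⟩))
  rw [setAverage_eq, ← integral_Ioc_eq_integral_Ioo, ← intervalIntegral.integral_of_le hcd.le,
    Real.volume_real_Ioo_of_le hcd.le, smul_eq_mul, inv_mul_le_iff₀ (by linarith)]
  linarith

/-- A bound on the mean speed and on the oscillation of the momentum implies a bound on the
speed. -/
theorem speed_le_of_oscillation {p T r C C₀ c₀ Q m K c d : ℝ} {D : Set ℝ}
    {ℓ : ℝ → ℝ → ℝ → ℝ} {u a : ℝ → ℝ} (hp : 1 < p) (hreg : IsRegularRunningCost T D ℓ)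
    (hg : HasGrowth p T r C D ℓ)
    (hconv : ∀ y ∈ D, ∀ s ∈ Icc 0 T, StrictConvexOn ℝ univ fun a => ℓ y a s) (hC₀ : 0 ≤ C₀)
    (hco : ∀ y ∈ D, ∀ a : ℝ, ∀ s ∈ Icc 0 T, C₀ * |a| ^ p + c₀ ≤ ℓ y a s) (hm : 0 ≤ m)
    (hK : 1 ≤ K) (hKm : C * (1 + m ^ (p - 1)) + Q + (C + |c₀|) < C₀ * K ^ (p - 1))
    (hc : 0 ≤ c) (hcd : c < d) (hd : d ≤ T) (ham : Measurable a)
    (ha : IntervalIntegrable a volume c d) (hmean : |∫ s in c..d, a s| ≤ m * (d - c))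
    (hu : ∀ s ∈ Ioo c d, u s ∈ D ∩ Icc 0 r)
    (hosc : ∀ c' d', c < c' → c' ≤ d' → d' < d → ∀ A B : Set ℝ, MeasurableSet A →
      MeasurableSet B → A ⊆ Ioc c' d' → B ⊆ Ioc c' d' → volume A ≠ 0 → volume B ≠ 0 →
      ∀ α β, (∀ s ∈ A, α ≤ partialSpeed ℓ (u s) (a s) s) →
        (∀ s ∈ B, partialSpeed ℓ (u s) (a s) s ≤ β) → α - β ≤ Q) :
    ∀ᵐ s, s ∈ Ioo c d → |a s| ≤ K := by
  have hT : ∀ s ∈ Ioo c d, s ∈ Icc 0 T := fun s hs => ⟨hc.trans hs.1.le, hs.2.le.trans hd⟩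
  have main : ∀ A B : Set ℝ, MeasurableSet A → MeasurableSet B → A ⊆ Ioo c d → B ⊆ Ioo c d →
      volume A ≠ 0 → volume B ≠ 0 → ∀ α β, (∀ s ∈ A, α ≤ partialSpeed ℓ (u s) (a s) s) →
        (∀ s ∈ B, partialSpeed ℓ (u s) (a s) s ≤ β) → α - β ≤ Q := by
    intro A B hA hB hAs hBs hA0 hB0 α β hα hβ
    obtain ⟨c₁, d₁, hc₁, hd₁, h₁⟩ := exists_Ioc_inter_ne_zero hAs hA0
    obtain ⟨c₂, d₂, hc₂, hd₂, h₂⟩ := exists_Ioc_inter_ne_zero hBs hB0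
    have hA' := h₁ (min c₁ c₂) (min_le_left _ _) (max d₁ d₂) (le_max_left _ _)
    have hB' := h₂ (min c₁ c₂) (min_le_right _ _) (max d₁ d₂) (le_max_right _ _)
    have hle : min c₁ c₂ ≤ max d₁ d₂ := by
      by_contra hlt
      exact hA' (by rw [Ioc_eq_empty (fun h => hlt h.le)]; simp)
    exact hosc (min c₁ c₂) (max d₁ d₂) (lt_min hc₁ hc₂) hle (max_lt hd₁ hd₂)
      (A ∩ Ioc (min c₁ c₂) (max d₁ d₂)) (B ∩ Ioc (min c₁ c₂) (max d₁ d₂))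
      (hA.inter measurableSet_Ioc) (hB.inter measurableSet_Ioc) inter_subset_right
      inter_subset_right hA' hB' α β (fun s hs => hα s hs.1) (fun s hs => hβ s hs.1)
  have hmb : ∀ s ∈ Ioo c d, |partialSpeed ℓ (u s) m s| ≤ C * (1 + m ^ (p - 1)) ∧
      |partialSpeed ℓ (u s) (-m) s| ≤ C * (1 + m ^ (p - 1)) := by
    intro s hs
    have h1 := (hg _ (hu s hs) m s (hT s hs)).2.2
    have h2 := (hg _ (hu s hs) (-m) s (hT s hs)).2.2
    rw [abs_neg] at h2
    rw [abs_of_nonneg hm] at h1 h2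
    exact ⟨h1, h2⟩
  have hB1 : volume {s ∈ Ioo c d | a s ≤ m} ≠ 0 :=
    volume_le_average_ne_zero hcd ha ((le_abs_self _).trans hmean)
  have hB2 : volume {s ∈ Ioo c d | -a s ≤ m} ≠ 0 := by
    refine volume_le_average_ne_zero hcd ha.neg ?_
    rw [intervalIntegral.integral_neg]
    exact (neg_le_abs _).trans hmean
  have hm1 : MeasurableSet {s ∈ Ioo c d | a s ≤ m} :=
    measurableSet_Ioo.inter (measurableSet_le ham measurable_const)
  have hm2 : MeasurableSet {s ∈ Ioo c d | -a s ≤ m} :=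
    measurableSet_Ioo.inter (measurableSet_le ham.neg measurable_const)
  have hm3 : MeasurableSet {s ∈ Ioo c d | K < a s} :=
    measurableSet_Ioo.inter (measurableSet_lt measurable_const ham)
  have hm4 : MeasurableSet {s ∈ Ioo c d | a s < -K} :=
    measurableSet_Ioo.inter (measurableSet_lt ham measurable_const)
  -- Otherwise the momentum is at least `C₀ * K ^ (p - 1) - (C + |c₀|)` on one set of positive
  -- measure and at most `C * (1 + m ^ (p - 1))` on another, where `a` is below its mean bound. By
  -- `hKm` this gap exceeds `Q`. The other sign is symmetric.
  have z1 : volume {s ∈ Ioo c d | K < a s} = 0 := by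
    by_contra hne
    have := main _ _ hm3 hm1 (sep_subset _ _) (sep_subset _ _) hne hB1
      (C₀ * K ^ (p - 1) - (C + |c₀|)) (C * (1 + m ^ (p - 1)))
      (fun s hs => le_partialSpeed hp hreg hg (hu s hs.1) (hT s hs.1)
        (hconv _ (hu s hs.1).1 s (hT s hs.1)) hC₀ (hco _ (hu s hs.1).1 _ s (hT s hs.1)) hK hs.2.le)
      (fun s hs => (hreg.partialSpeed_mono (hu s hs.1).1 (hT s hs.1)
        (hconv _ (hu s hs.1).1 s (hT s hs.1)) hs.2).trans
          ((le_abs_self _).trans (hmb s hs.1).1))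
    linarith
  have z2 : volume {s ∈ Ioo c d | a s < -K} = 0 := by
    by_contra hne
    have := main _ _ hm2 hm4 (sep_subset _ _) (sep_subset _ _) hB2 hne
      (-(C * (1 + m ^ (p - 1)))) (-(C₀ * K ^ (p - 1) - (C + |c₀|)))
      (fun s hs => le_trans (by linarith [neg_abs_le (partialSpeed ℓ (u s) (-m) s),
          (hmb s hs.1).2]) (hreg.partialSpeed_mono (hu s hs.1).1 (hT s hs.1)
        (hconv _ (hu s hs.1).1 s (hT s hs.1)) (by linarith [hs.2] : -m ≤ a s)))
      (fun s hs => partialSpeed_le hp hreg hg (hu s hs.1) (hT s hs.1)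
        (hconv _ (hu s hs.1).1 s (hT s hs.1)) hC₀ (hco _ (hu s hs.1).1 _ s (hT s hs.1)) hK hs.2.le)
    linarith
  filter_upwards [measure_eq_zero_iff_ae_notMem.1 z1, measure_eq_zero_iff_ae_notMem.1 z2]
    with s h1 h2 hs
  simp only [not_and, not_lt] at h1 h2
  exact abs_le.2 ⟨h2 hs, h1 hs⟩

namespace Network

variable {d n N : ℕ} {𝒩 : Network d n N} {p T : ℝ} {ℓ : Fin N → ℝ → ℝ → ℝ → ℝ}
  {ℓstar : Fin n → ℝ → ℝ} {g : EuclideanSpace ℝ (Fin d) → ℝ} {t : ℝ}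
  {x : EuclideanSpace ℝ (Fin d)} {y v : ℝ → EuclideanSpace ℝ (Fin d)}

/-! ### Variations of a trajectory inside an edge -/

theorem coord_sub_eq_integral {a b : ℝ} {z w : ℝ → EuclideanSpace ℝ (Fin d)} (hp : 1 ≤ p)
    {G : Set (EuclideanSpace ℝ (Fin d))} (h : IsPath p G a b z w) (i : Fin N) {s s' : ℝ}
    (hs : s ∈ Icc a b) (hs' : s' ∈ Icc a b) :
    𝒩.coord i (z s') - 𝒩.coord i (z s) = ∫ u in s..s', inner ℝ (𝒩.dir i) (w u) := by
  have hab := hs.1.trans hs.2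
  rw [coord_sub_coord, h.sub_eq_integral hp hs hs']
  have hi : IntervalIntegrable w volume s s' := (h.intervalIntegrable hp hab).mono_set (by
    rw [uIcc_of_le hab]; exact uIcc_subset_Icc hs hs')
  exact ((innerSL ℝ (𝒩.dir i)).intervalIntegral_comp_comm hi).symm

theorem isPath_param {a b : ℝ} {i : Fin N} {q α : ℝ → ℝ}
    (hα : MemLp α (ENNReal.ofReal p) (volume.restrict (Ioc a b)))
    (hq : ∀ s ∈ Icc a b, q s - q a = ∫ u in a..s, α u) (hd : ∀ s ∈ Icc a b, q s ∈ 𝒩.dom i) :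
    IsPath p 𝒩.carrier a b (fun s => 𝒩.param i (q s)) (fun s => α s • 𝒩.dir i) where
  memLp := by
    refine (hα.norm.const_mul 1).of_le (hα.1.smul_const _) (Filter.Eventually.of_forall fun s => ?_)
    simp [norm_smul, 𝒩.norm_dir]
  eq_integral s hs := by
    rw [intervalIntegral.integral_smul_const, ← hq s hs, ← param_sub_param]
    abel
  mapsTo s hs := 𝒩.edge_subset_carrier i (𝒩.param_mem_edge (hd s hs))

/-- Variations of the coordinate that vanish at both ends stay in the open edge for small `ε`, so
optimality gives the weak Euler–Lagrange equation, and `essOsc_le_integral` applies with `∂_y ℓ` in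
the role of its `Q`. The integral of `|∂_y ℓ|` is controlled by the total energy, whatever the
length of `[c, c']`. -/
theorem oscillation_le (hp : 1 < p) (hA : RunningCostAssumptions p T 𝒩.dom ℓ ℓstar)
    (ht : 0 ≤ t) (hopt : IsOptimal p T 𝒩.carrier (𝒩.runningCost ℓ ℓstar) g x t y v)
    {r C Q c c' : ℝ} {i : Fin N} (hg : HasGrowth p T r C (𝒩.dom i) (ℓ i)) (hC : 0 ≤ C)
    (htc : t ≤ c) (hcc : c ≤ c') (hcT : c' ≤ T)
    (hedge : ∀ s ∈ Icc c c', y s ∈ 𝒩.edge i ∧ y s ∉ 𝒩.vertices)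
    (hr : ∀ s ∈ Icc c c', 𝒩.coord i (y s) + 1 ≤ r)
    (hQ : C * (∫ s in t..T, (1 + ‖v s‖ ^ p)) ≤ Q)
    {A B : Set ℝ} (hAm : MeasurableSet A) (hBm : MeasurableSet B) (hAs : A ⊆ Ioc c c')
    (hBs : B ⊆ Ioc c c') (hA0 : volume A ≠ 0) (hB0 : volume B ≠ 0) {α β : ℝ}
    (hα : ∀ s ∈ A, α ≤ partialSpeed (ℓ i) (𝒩.coord i (y s)) (inner ℝ (𝒩.dir i) (v s)) s)
    (hβ : ∀ s ∈ B, partialSpeed (ℓ i) (𝒩.coord i (y s)) (inner ℝ (𝒩.dir i) (v s)) s ≤ β) :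
    α - β ≤ Q := by
  have htT : t ≤ T := htc.trans (hcc.trans hcT)
  have hc : 0 ≤ c := ht.trans htc
  have hpath := hopt.isPath hp.le htT
  have hy := hpath.mono hp.le htc hcT
  have hyc := hy.continuousOn hp.le hcc
  set u : ℝ → ℝ := fun s => 𝒩.coord i (y s) with hu
  set a : ℝ → ℝ := fun s => inner ℝ (𝒩.dir i) (v s) with ha
  have huc : ContinuousOn u (Icc c c') := (𝒩.continuous_coord i).comp_continuousOn hyc
  have haL : MemLp a (ENNReal.ofReal p) (volume.restrict (Ioc c c')) := hy.memLp.const_inner _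
  have hdom : ∀ s ∈ Icc c c', u s ∈ 𝒩.dom i := fun s hs => 𝒩.coord_mem_dom (hedge s hs).1
  have hint : ∀ s ∈ Icc c c', u s ∈ interior (𝒩.dom i) := fun s hs => by
    rw [𝒩.mem_interior_dom_iff (hdom s hs), 𝒩.param_coord (hedge s hs).1]
    exact (hedge s hs).2
  have hD := 𝒩.isClosed_dom i
  have hur : ∀ s ∈ Icc c c', u s ∈ 𝒩.dom i ∩ Icc 0 r := fun s hs =>
    ⟨hdom s hs, 𝒩.nonneg_of_mem_dom (hdom s hs), by linarith [hr s hs]⟩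
  have iP : IntervalIntegrable (fun s => partialSpeed (ℓ i) (u s) (a s) s) volume c c' := by
    refine intervalIntegrable_of_growth (f := partialSpeed (ℓ i)) (r := r) (C := 2 * C) hp
      (hA.regular i).continuousOn_partialSpeed (fun y hy b s hs => ?_) hD hc hcc hcT huc haL hur
    refine (hg y hy b s hs).2.2.trans ?_
    rw [mul_comm 2 C, mul_assoc]
    exact mul_le_mul_of_nonneg_left (one_add_rpow_sub_one_le hp (abs_nonneg b)) hC
  have iQ : IntervalIntegrable (fun s => partialPos (𝒩.dom i) (ℓ i) (u s) (a s) s) volume c c' :=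
    intervalIntegrable_of_growth (f := partialPos (𝒩.dom i) (ℓ i)) (r := r) (C := C) hp
      (hA.regular i).continuousOn_partialPos (fun y hy b s hs => (hg y hy b s hs).2.1) hD hc hcc
      hcT huc haL hur
  have hL := integrableAlongPaths_runningCost hp hA
  refine (essOsc_le_integral hcc iP iQ ?_ hAm hBm hAs hBs hA0 hB0 hα hβ).trans ?_
  · rintro w hw ⟨W, hW⟩ hw0
    have hwint : ∀ a b : ℝ, IntervalIntegrable w volume a b := fun a b => by
      rw [intervalIntegrable_iff]
      exact Measure.integrableOn_of_bounded (by simp) hw.aestronglyMeasurable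
        (Filter.Eventually.of_forall hW)
    have hφc : Continuous (fun s => ∫ u in c..s, w u) :=
      intervalIntegral.continuous_primitive hwint c
    obtain ⟨Φ, hΦ⟩ := isCompact_Icc.exists_bound_of_continuousOn (s := Icc c c') hφc.continuousOn
    have hΦ0 : 0 ≤ Φ := (norm_nonneg _).trans (hΦ c ⟨le_rfl, hcc⟩)
    obtain ⟨δ, hδ, hδs⟩ := (isCompact_Icc.image_of_continuousOn huc).exists_thickening_subset_open
      isOpen_interior (by rintro _ ⟨s, hs, rfl⟩; exact hint s hs)
    -- The margin `δ` keeps the varied coordinate inside the open edge, the inner `1` keeps it below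
    -- `r`, and the outer `1` is required by `first_variation_eq_zero`.
    set ε₀ : ℝ := min 1 (min δ 1 / (Φ + 1)) with hε
    have hε₀ : 0 < ε₀ := by positivity
    have hsmall : ∀ ε, |ε| < ε₀ → ∀ s ∈ Icc c c', |ε * ∫ u in c..s, w u| < min δ 1 := by
      intro ε hε s hs
      have h1 : |ε| < min δ 1 / (Φ + 1) := hε.trans_le (min_le_right _ _)
      rw [lt_div_iff₀ (by linarith)] at h1
      have h2 : |∫ u in c..s, w u| ≤ Φ := hΦ s hs
      rw [abs_mul]
      nlinarith [abs_nonneg ε]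
    have hintε : ∀ ε, |ε| < ε₀ → ∀ s ∈ Icc c c',
        u s + ε * (∫ u in c..s, w u) ∈ interior (𝒩.dom i) ∩ Icc 0 r := by
      intro ε hε s hs
      have h1 := hsmall ε hε s hs
      have h2 : u s + ε * (∫ u in c..s, w u) ∈ interior (𝒩.dom i) := by
        apply hδs
        rw [Metric.mem_thickening_iff]
        refine ⟨u s, mem_image_of_mem u hs, ?_⟩
        rw [Real.dist_eq, add_sub_cancel_left]
        exact h1.trans_le (min_le_left _ _)
      refine ⟨h2, 𝒩.nonneg_of_mem_dom (interior_subset h2), ?_⟩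
      have h3 := (le_abs_self _).trans (h1.trans_le (min_le_right _ _)).le
      linarith [hr s hs]
    refine first_variation_eq_zero hp (hA.regular i) hD hg hc hcc hcT huc haL hφc.continuousOn
      (fun s hs => hΦ s hs) hw hW hε₀ (min_le_left _ _) hintε fun ε hε => ?_
    have hαL : MemLp (fun s => a s + ε * w s) (ENNReal.ofReal p) (volume.restrict (Ioc c c')) :=
      haL.add ((MemLp.of_bound hw.aestronglyMeasurable W
        (Filter.Eventually.of_forall hW)).const_mul ε)
    have hz : IsPath p 𝒩.carrier c c' (fun s => 𝒩.param i (u s + ε * ∫ u in c..s, w u))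
        (fun s => (a s + ε * w s) • 𝒩.dir i) := by
      refine isPath_param hαL (fun s hs => ?_)
        fun s hs => interior_subset (hintε ε hε s hs).1
      have h1 : IntervalIntegrable a volume c s := by
        rw [intervalIntegrable_iff_integrableOn_Ioc_of_le hs.1]
        exact IntegrableOn.mono_set (haL.integrable (by
          rw [← ENNReal.ofReal_one, ENNReal.ofReal_le_ofReal_iff (by linarith)]; exact hp.le))
          (Ioc_subset_Ioc_right hs.2)
      rw [intervalIntegral.integral_add h1 ((hwint c s).const_mul ε),
        intervalIntegral.integral_const_mul,
        ← coord_sub_eq_integral hp.le hy i ⟨le_rfl, hcc⟩ hs]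
      simp only [hu, intervalIntegral.integral_same]
      ring
    have hle := hopt.integral_le hp.le ht hL htc hcc hcT hz
      (by simp [hu, 𝒩.param_coord (hedge c ⟨le_rfl, hcc⟩).1])
      (by simp [hu, hw0, 𝒩.param_coord (hedge c' ⟨hcc, le_rfl⟩).1])
    have e1 : ∫ s in c..c', 𝒩.runningCost ℓ ℓstar (y s) (v s) s =
        ∫ s in c..c', ℓ i (u s) (a s) s := by
      apply intervalIntegral.integral_congr
      intro s hs
      rw [uIcc_of_le hcc] at hs
      exact 𝒩.runningCost_edge ℓ ℓstar (hedge s hs).1 (hedge s hs).2 _ _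
    have e2 : ∫ s in c..c', 𝒩.runningCost ℓ ℓstar (𝒩.param i (u s + ε * ∫ u in c..s, w u))
          ((a s + ε * w s) • 𝒩.dir i) s =
        ∫ s in c..c', ℓ i (u s + ε * ∫ u in c..s, w u) (a s + ε * w s) s := by
      apply intervalIntegral.integral_congr
      intro s hs
      rw [uIcc_of_le hcc] at hs
      have h1 := (hintε ε hε s hs).1
      have h2 := interior_subset h1
      simp only
      rw [𝒩.runningCost_edge ℓ ℓstar (𝒩.param_mem_edge h2) ((𝒩.mem_interior_dom_iff h2).1 h1),
        coord_param, inner_smul_right, real_inner_self_eq_norm_sq, 𝒩.norm_dir]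
      simp
    rw [e1, e2] at hle
    exact hle
  · refine le_trans ?_ hQ
    have hI : IntervalIntegrable (fun s => 1 + ‖v s‖ ^ p) volume t T := by
      rw [intervalIntegrable_iff_integrableOn_Ioc_of_le htT]
      exact integrable_one_add_norm_rpow hp.le hpath.memLp
    have hI' : IntervalIntegrable (fun s => 1 + ‖v s‖ ^ p) volume c c' := hI.mono_set (by
      rw [uIcc_of_le hcc, uIcc_of_le htT]; exact Icc_subset_Icc htc hcT)
    calc ∫ s in c..c', |partialPos (𝒩.dom i) (ℓ i) (u s) (a s) s|
        ≤ ∫ s in c..c', C * (1 + ‖v s‖ ^ p) := by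
          refine intervalIntegral.integral_mono_on hcc iQ.abs (hI'.const_mul C) fun s hs => ?_
          refine (hg _ (hur s hs) _ s ⟨hc.trans hs.1, hs.2.trans hcT⟩).2.1.trans ?_
          have := 𝒩.abs_inner_dir_le i (v s)
          have hp0 : 0 ≤ p := by linarith
          gcongr
      _ = C * ∫ s in c..c', (1 + ‖v s‖ ^ p) := intervalIntegral.integral_const_mul _ _
      _ ≤ C * ∫ s in t..T, (1 + ‖v s‖ ^ p) := by
          refine mul_le_mul_of_nonneg_left ?_ hC
          exact intervalIntegral.integral_mono_interval htc hcc hcT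
            (Filter.Eventually.of_forall fun s => by simp only [Pi.zero_apply]; positivity) hI

/-- On a time interval spent inside an edge, a bound on the mean velocity of an optimal
trajectory implies a bound on its velocity. -/
theorem velocity_le_of_mean_le (hp : 1 < p) (hA : RunningCostAssumptions p T 𝒩.dom ℓ ℓstar)
    {C₀ c₀ : ℝ} (hC₀ : 0 ≤ C₀)
    (hco : ∀ i, ∀ y ∈ 𝒩.dom i, ∀ a : ℝ, ∀ s ∈ Icc 0 T, C₀ * |a| ^ p + c₀ ≤ ℓ i y a s)
    (ht : 0 ≤ t) (hopt : IsOptimal p T 𝒩.carrier (𝒩.runningCost ℓ ℓstar) g x t y v)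
    (hv : Measurable v) {r C Q m K c c' : ℝ} {i : Fin N}
    (hg : HasGrowth p T r C (𝒩.dom i) (ℓ i)) (hC : 0 ≤ C) (hm : 0 ≤ m)
    (hK : 1 ≤ K) (hKm : C * (1 + m ^ (p - 1)) + Q + (C + |c₀|) < C₀ * K ^ (p - 1))
    (htc : t ≤ c) (hcc : c < c') (hcT : c' ≤ T)
    (hedge : ∀ s ∈ Ioo c c', y s ∈ 𝒩.edge i ∧ y s ∉ 𝒩.vertices)
    (hr : ∀ s ∈ Ioo c c', 𝒩.coord i (y s) + 1 ≤ r)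
    (hQ : C * (∫ s in t..T, (1 + ‖v s‖ ^ p)) ≤ Q)
    (hmean : |𝒩.coord i (y c') - 𝒩.coord i (y c)| ≤ m * (c' - c)) :
    ∀ᵐ s, s ∈ Ioo c c' → ‖v s‖ ≤ K := by
  have hy := (hopt.isPath hp.le (htc.trans (hcc.le.trans hcT))).mono hp.le htc hcT
  have hi := hy.intervalIntegrable hp.le hcc.le
  have key := speed_le_of_oscillation (u := fun s => 𝒩.coord i (y s))
    (a := fun s => inner ℝ (𝒩.dir i) (v s)) hp (hA.regular i) hg (hA.strictConvex i) hC₀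
    (hco i) hm hK hKm (ht.trans htc) hcc hcT (measurable_const.inner hv)
    ⟨hi.1.const_inner _, hi.2.const_inner _⟩ (by
      rwa [← coord_sub_eq_integral hp.le hy i ⟨le_rfl, hcc.le⟩ ⟨hcc.le, le_rfl⟩])
    (fun s hs => ⟨𝒩.coord_mem_dom (hedge s hs).1,
      𝒩.nonneg_of_mem_dom (𝒩.coord_mem_dom (hedge s hs).1), by linarith [hr s hs]⟩)
    (fun b b' hb hbb hb' A B hAm hBm hAs hBs hA0 hB0 α β hα hβ =>
      oscillation_le hp hA ht hopt hg hC (htc.trans hb.le) hbb (hb'.le.trans hcT)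
        (fun s hs => hedge s ⟨hb.trans_le hs.1, hs.2.trans_lt hb'⟩)
        (fun s hs => hr s ⟨hb.trans_le hs.1, hs.2.trans_lt hb'⟩) hQ hAm hBm hAs hBs hA0 hB0 hα hβ)
  filter_upwards [key, ae_abs_inner_dir hp.le hcc.le hy] with s h1 h2 hs
  rw [← h2 hs i (hedge s hs).1 (hedge s hs).2]
  exact h1 hs

end Network

/-! ### Comparison with affine paths -/

/-- A crude Young inequality, split by which of `r` and `K` is larger. It gives lower bounds of the
energy that are linear in the displacement, with slope as steep as desired. -/
theorem rpow_sub_one_mul_le {p K r : ℝ} (hp : 1 < p) (hK : 0 ≤ K) (hr : 0 ≤ r) :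
    K ^ (p - 1) * r ≤ K ^ p + r ^ p := by
  have h1 := Real.rpow_nonneg hK p
  have h2 := Real.rpow_nonneg hr p
  rcases le_total r K with h | h
  · have : K ^ (p - 1) * r ≤ K ^ p := by
      rw [← mul_rpow_sub_one hp hK, mul_comm]
      exact mul_le_mul_of_nonneg_right h (Real.rpow_nonneg hK _)
    linarith
  · have : K ^ (p - 1) * r ≤ r ^ p := by
      rw [← mul_rpow_sub_one hp hr, mul_comm]
      exact mul_le_mul_of_nonneg_left (Real.rpow_le_rpow hK h (by linarith)) hr
    linarith

namespace IsPath

variable {d : ℕ} {p a b : ℝ} {G : Set (EuclideanSpace ℝ (Fin d))}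
  {z w : ℝ → EuclideanSpace ℝ (Fin d)}

theorem intervalIntegrable_rpow (hp : 1 ≤ p) (hab : a ≤ b) (h : IsPath p G a b z w) :
    IntervalIntegrable (fun s => ‖w s‖ ^ p) volume a b := by
  rw [intervalIntegrable_iff_integrableOn_Ioc_of_le hab]
  have := h.memLp.integrable_norm_rpow (by simp; linarith) ENNReal.ofReal_ne_top
  rwa [ENNReal.toReal_ofReal (by linarith)] at this

theorem norm_sub_le_integral (hp : 1 ≤ p) (hab : a ≤ b) (h : IsPath p G a b z w) :
    ‖z b - z a‖ ≤ ∫ s in a..b, ‖w s‖ := by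
  rw [h.sub_eq_integral hp ⟨le_rfl, hab⟩ ⟨hab, le_rfl⟩]
  exact intervalIntegral.norm_integral_le_integral_norm hab

/-- A lower bound of the energy of a path that is linear in its displacement. -/
theorem le_integral_rpow (hp : 1 < p) (hab : a ≤ b) (h : IsPath p G a b z w) {K : ℝ}
    (hK : 0 ≤ K) : K ^ (p - 1) * ‖z b - z a‖ - K ^ p * (b - a) ≤ ∫ s in a..b, ‖w s‖ ^ p := by
  have h1 := mul_le_mul_of_nonneg_left (h.norm_sub_le_integral hp.le hab)
    (Real.rpow_nonneg hK (p - 1))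
  have hi := (h.intervalIntegrable hp.le hab).norm
  have hi' := h.intervalIntegrable_rpow hp.le hab
  have h2 : ∫ s in a..b, K ^ (p - 1) * ‖w s‖ ≤ ∫ s in a..b, (K ^ p + ‖w s‖ ^ p) :=
    intervalIntegral.integral_mono_on hab (hi.const_mul _) (intervalIntegrable_const.add hi')
      fun s _ => rpow_sub_one_mul_le hp hK (norm_nonneg _)
  rw [intervalIntegral.integral_const_mul,
    intervalIntegral.integral_add intervalIntegrable_const hi', intervalIntegral.integral_const,
    smul_eq_mul] at h2
  linarith

theorem norm_sub_le_of_velocity_le (hp : 1 ≤ p) (hab : a ≤ b) (h : IsPath p G a b z w) {K : ℝ}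
    (hK : ∀ᵐ s, s ∈ Ioo a b → ‖w s‖ ≤ K) : ‖z b - z a‖ ≤ K * (b - a) := by
  refine (h.norm_sub_le_integral hp hab).trans ?_
  have := integral_mono_of_ae_Ioo hab (h.intervalIntegrable hp hab).norm
    (intervalIntegrable_const (c := K)) hK
  rw [intervalIntegral.integral_const, smul_eq_mul] at this
  linarith

/-- If a path has bounded energy and large displacement, then it takes a long time. -/
theorem norm_sub_le_of_energy_le (hp : 1 < p) (hab : a ≤ b) (h : IsPath p G a b z w)
    {E κ K : ℝ} (hE : ∫ s in a..b, ‖w s‖ ^ p ≤ E) (hK : 1 ≤ K) (hKE : 2 * E < κ * K ^ (p - 1))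
    (hκ : κ ≤ ‖z b - z a‖) : ‖z b - z a‖ ≤ 2 * K * (b - a) := by
  have h1 := h.le_integral_rpow hp hab (K := K) (by linarith)
  have h2 : 0 < K ^ (p - 1) := Real.rpow_pos_of_pos (by linarith) _
  have h3 := mul_le_mul_of_nonneg_right hκ h2.le
  rw [← mul_rpow_sub_one hp (by linarith)] at h1
  -- The energy is below half of `K ^ (p - 1) * ‖z b - z a‖`, so the linear lower bound absorbs it
  -- and leaves the other half.
  have h4 : K ^ (p - 1) * ‖z b - z a‖ ≤ K ^ (p - 1) * (2 * K * (b - a)) := by nlinarith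
  exact le_of_mul_le_mul_left h4 h2

end IsPath

namespace Network

variable {d n N : ℕ} {𝒩 : Network d n N} {p T : ℝ} {ℓ : Fin N → ℝ → ℝ → ℝ → ℝ}
  {ℓstar : Fin n → ℝ → ℝ} {t : ℝ}
  {x : EuclideanSpace ℝ (Fin d)} {y v : ℝ → EuclideanSpace ℝ (Fin d)}

theorem integral_affine_le (hp : 1 < p) (hA : RunningCostAssumptions p T 𝒩.dom ℓ ℓstar)
    {R C : ℝ} (hC : 0 ≤ C) (hbd : ∀ z ∈ 𝒩.carrier, ‖z‖ ≤ R → ∀ a, ∀ s ∈ Icc 0 T,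
      |𝒩.runningCost ℓ ℓstar z a s| ≤ C * (1 + ‖a‖ ^ p))
    {a b q : ℝ} (ha : 0 ≤ a) (hab : a < b) (hb : b ≤ T) {z₀ z₁ : EuclideanSpace ℝ (Fin d)}
    (hseg : segment ℝ z₀ z₁ ⊆ 𝒩.carrier) (h₀ : ‖z₀‖ ≤ R) (h₁ : ‖z₁‖ ≤ R)
    (hq : ‖z₁ - z₀‖ ≤ q * (b - a)) :
    ∫ s in a..b, 𝒩.runningCost ℓ ℓstar (z₀ + ((s - a) / (b - a)) • (z₁ - z₀))
      ((b - a)⁻¹ • (z₁ - z₀)) s ≤ C * (1 + q ^ p) * (b - a) := by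
  have hball : segment ℝ z₀ z₁ ⊆ Metric.closedBall 0 R :=
    (convex_closedBall 0 R).segment_subset (by simpa using h₀) (by simpa using h₁)
  have haff := IsPath.affine (p := p) hab hseg
  have haff' := IsPath.affine (p := p) hab hball
  have hspeed : ‖(b - a)⁻¹ • (z₁ - z₀)‖ ≤ q := by
    rw [norm_smul, norm_inv, Real.norm_of_nonneg (by linarith), inv_mul_le_iff₀ (by linarith)]
    linarith
  calc _ ≤ ∫ s in a..b, C * (1 + q ^ p) := by
        refine intervalIntegral.integral_mono_on hab.le
          (integrableAlongPaths_runningCost hp hA _ _ _ _ ha hab.le hb haff)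
          intervalIntegrable_const fun s hs => ?_
        refine (le_abs_self _).trans ((hbd _ (haff.mapsTo hs)
          (by simpa using haff'.mapsTo hs) _ s ⟨ha.trans hs.1, hs.2.trans hb⟩).trans ?_)
        have hp0 : 0 ≤ p := by linarith
        gcongr
    _ = C * (1 + q ^ p) * (b - a) := by
        rw [intervalIntegral.integral_const, smul_eq_mul]; ring

theorem integral_const_path_le (hp : 1 < p) (hA : RunningCostAssumptions p T 𝒩.dom ℓ ℓstar)
    {R C : ℝ} (hbd : ∀ z ∈ 𝒩.carrier, ‖z‖ ≤ R → ∀ a, ∀ s ∈ Icc 0 T,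
      |𝒩.runningCost ℓ ℓstar z a s| ≤ C * (1 + ‖a‖ ^ p))
    {a b : ℝ} (ha : 0 ≤ a) (hab : a ≤ b) (hb : b ≤ T) {z₀ : EuclideanSpace ℝ (Fin d)}
    (hz₀ : z₀ ∈ 𝒩.carrier) (h₀ : ‖z₀‖ ≤ R) :
    ∫ s in a..b, 𝒩.runningCost ℓ ℓstar z₀ 0 s ≤ C * (b - a) := by
  calc _ ≤ ∫ s in a..b, C := by
        refine intervalIntegral.integral_mono_on hab
          (integrableAlongPaths_runningCost hp hA _ _ _ _ ha hab hb (IsPath.const hz₀))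
          intervalIntegrable_const fun s hs => ?_
        have := (le_abs_self _).trans (hbd z₀ hz₀ h₀ 0 s ⟨ha.trans hs.1, hs.2.trans hb⟩)
        rwa [norm_zero, Real.zero_rpow (by linarith), add_zero, mul_one] at this
    _ = C * (b - a) := by rw [intervalIntegral.integral_const, smul_eq_mul]; ring

/-! ### Energy bound and mean velocity bounds from competitors -/

section Comparison

variable {g : Fin N → ℝ → ℝ} {gstar : Fin n → ℝ} {C₀ c₀ : ℝ}

/-- Optimal trajectories have bounded energy. -/
theorem exists_energy_bound (hp : 1 < p) (hA : RunningCostAssumptions p T 𝒩.dom ℓ ℓstar)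
    (hT : 0 < T) (hg : TerminalCostAssumptions 𝒩.dom g) (hC₀ : 0 < C₀)
    (hco : ∀ i, ∀ y ∈ 𝒩.dom i, ∀ a : ℝ, ∀ s ∈ Icc 0 T, C₀ * |a| ^ p + c₀ ≤ ℓ i y a s)
    (hco' : ∀ k, ∀ s ∈ Icc 0 T, c₀ ≤ ℓstar k s) (R : ℝ) :
    ∃ E, 0 ≤ E ∧ ∀ x y v t, t ∈ Icc 0 T → ‖x‖ ≤ R →
      IsOptimal p T 𝒩.carrier (𝒩.runningCost ℓ ℓstar) (𝒩.terminalCost g gstar) x t y v →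
      ∫ s in t..T, (1 + ‖v s‖ ^ p) ≤ E := by
  obtain ⟨C, hC, hbd⟩ := exists_runningCost_bound hp hA R
  obtain ⟨M, hM⟩ := 𝒩.exists_bound_terminalCost gstar hg
  -- Resting at `x` costs at most `C * T + M`; coercivity and the lower bound `-M` of the terminal
  -- cost turn this into an energy bound. The first `T` bounds the integral of `1`.
  refine ⟨T + (C * T + |c₀| * T + 2 * |M|) / C₀, by positivity, fun x y v t ht hx hopt => ?_⟩
  have hpath := hopt.isPath hp.le ht.2
  have hx' : x ∈ 𝒩.carrier := hopt.1.start ▸ hpath.mapsTo ⟨le_rfl, ht.2⟩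
  have h1 := hopt.terminal_le hp.le ht.1 (integrableAlongPaths_runningCost hp hA) le_rfl ht.2
    (IsPath.const hx') hopt.1.start.symm
  have h2 := integral_const_path_le hp hA hbd ht.1 ht.2 le_rfl hx' hx
  have h3 := integral_runningCost_ge hp hA hco hco' hC₀ ht.1 le_rfl ht.2 hpath
  have h4 := abs_le.1 (hM _ (hpath.mapsTo ⟨ht.2, le_rfl⟩))
  have h5 := abs_le.1 (hM _ hx')
  rw [intervalIntegral.integral_add intervalIntegrable_const
    (hpath.intervalIntegrable_rpow hp.le ht.2), intervalIntegral.integral_const, smul_eq_mul,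
    mul_one]
  have h6 : C * (T - t) ≤ C * T := mul_le_mul_of_nonneg_left (by linarith [ht.1]) hC
  have h7 : -(|c₀| * T) ≤ c₀ * (T - t) := by
    have : |c₀ * (T - t)| ≤ |c₀| * T := by
      rw [abs_mul, abs_of_nonneg (by linarith [ht.2] : 0 ≤ T - t)]
      exact mul_le_mul_of_nonneg_left (by linarith [ht.1]) (abs_nonneg _)
    linarith [neg_abs_le (c₀ * (T - t))]
  refine add_le_add (by linarith [ht.1]) ?_
  rw [le_div_iff₀ hC₀]
  linarith [le_abs_self M]

/-- The assumptions on the running cost, with the constants of the coercivity condition and with a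
growth constant for positions in a ball. -/
structure CostBounds (𝒩 : Network d n N) (p T : ℝ) (ℓ : Fin N → ℝ → ℝ → ℝ → ℝ)
    (ℓstar : Fin n → ℝ → ℝ) (C₀ c₀ R C : ℝ) : Prop where
  assumptions : RunningCostAssumptions p T 𝒩.dom ℓ ℓstar
  pos : 0 < C₀
  coercive : ∀ i, ∀ y ∈ 𝒩.dom i, ∀ a : ℝ, ∀ s ∈ Icc 0 T, C₀ * |a| ^ p + c₀ ≤ ℓ i y a s
  coercive_star : ∀ k, ∀ s ∈ Icc 0 T, c₀ ≤ ℓstar k s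
  nonneg : 0 ≤ C
  bound : ∀ z ∈ 𝒩.carrier, ‖z‖ ≤ R → ∀ a, ∀ s ∈ Icc 0 T,
    |𝒩.runningCost ℓ ℓstar z a s| ≤ C * (1 + ‖a‖ ^ p)

theorem norm_sub_eq_abs_coord_sub {i : Fin N} {z z' : EuclideanSpace ℝ (Fin d)}
    (hz : z ∈ 𝒩.edge i) (hz' : z' ∈ 𝒩.edge i) : ‖z - z'‖ = |𝒩.coord i z - 𝒩.coord i z'| := by
  rw [← norm_param_sub_param, 𝒩.param_coord hz, 𝒩.param_coord hz']

variable {R C : ℝ}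

/-- The mean velocity on the last edge is bounded: compare with the path that stops. -/
theorem mean_le_of_terminal (hp : 1 < p) (hb : CostBounds 𝒩 p T ℓ ℓstar C₀ c₀ R C) (ht : 0 ≤ t)
    (hopt : IsOptimal p T 𝒩.carrier (𝒩.runningCost ℓ ℓstar) (𝒩.terminalCost g gstar) x t y v)
    (hyR : ∀ s ∈ Icc t T, ‖y s‖ ≤ R) {c : ℝ} (htc : t ≤ c) (hcT : c ≤ T) {i : Fin N}
    (hc : y c ∈ 𝒩.edge i) (hyT : y T ∈ 𝒩.edge i) (hyTv : y T ∉ 𝒩.vertices) {Λ K : ℝ}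
    (hΛ : |g i (𝒩.coord i (y T)) - g i (𝒩.coord i (y c))| ≤
      Λ * |𝒩.coord i (y T) - 𝒩.coord i (y c)|)
    (hK : 0 ≤ K) (hKΛ : Λ + 1 ≤ C₀ * K ^ (p - 1)) :
    |𝒩.coord i (y T) - 𝒩.coord i (y c)| ≤ (C + |c₀| + C₀ * K ^ p) * (T - c) := by
  have htT := htc.trans hcT
  have hpath := (hopt.isPath hp.le htT).mono hp.le htc le_rfl
  have hyc : y c ∈ 𝒩.carrier := 𝒩.edge_subset_carrier i hc
  have h1 := hopt.terminal_le hp.le ht (integrableAlongPaths_runningCost hp hb.assumptions)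
    htc hcT (IsPath.const hyc) rfl
  have h2 := integral_const_path_le hp hb.assumptions hb.bound (ht.trans htc) hcT le_rfl hyc
    (hyR c ⟨htc, hcT⟩)
  have h3 := integral_runningCost_ge hp hb.assumptions hb.coercive hb.coercive_star hb.pos
    (ht.trans htc) le_rfl hcT hpath
  have h4 := hpath.le_integral_rpow hp hcT hK
  rw [norm_sub_eq_abs_coord_sub hyT hc] at h4
  have h5 := 𝒩.terminalCost_le g gstar hc
  rw [𝒩.terminalCost_edge g gstar hyT hyTv] at h1
  set X := |𝒩.coord i (y T) - 𝒩.coord i (y c)|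
  have hX : 0 ≤ X := abs_nonneg _
  have h6 := mul_le_mul_of_nonneg_left h4 hb.pos.le
  have h7 := mul_le_mul_of_nonneg_right hKΛ hX
  have h8 := (neg_le_abs _).trans hΛ
  have h9 : -(|c₀| * (T - c)) ≤ c₀ * (T - c) := by
    rw [← neg_mul]
    exact mul_le_mul_of_nonneg_right (neg_abs_le c₀) (by linarith)
  -- Since `Λ + 1 ≤ C₀ * K ^ (p - 1)`, the energy of the displacement pays for the loss `Λ * X` in
  -- terminal cost and one copy of `X` remains.
  nlinarith

/-- The mean velocity before the first visit to a vertex is bounded if the trajectory starts near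
this vertex and the velocity is bounded afterwards: compare with the path that goes to the vertex
at unit speed and then catches up. -/
theorem mean_le_of_hitting (hp : 1 < p) (hb : CostBounds 𝒩 p T ℓ ℓstar C₀ c₀ R C) (ht : 0 ≤ t)
    (hopt : IsOptimal p T 𝒩.carrier (𝒩.runningCost ℓ ℓstar) (𝒩.terminalCost g gstar) x t y v)
    (hyR : ∀ s ∈ Icc t T, ‖y s‖ ≤ R) {c : ℝ} (htc : t ≤ c) (hcT : c ≤ T) {k : Fin n}
    (hc : y c = 𝒩.vertex k) (hseg : segment ℝ (y t) (y c) ⊆ 𝒩.carrier)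
    {K₀ K ρ κ : ℝ} (hK₀ : 0 ≤ K₀) (hv : ∀ᵐ s, s ∈ Ioo c T → ‖v s‖ ≤ K₀)
    (hρ : ∀ k, ∀ z ∈ 𝒩.carrier, dist z (𝒩.vertex k) < ρ →
      segment ℝ (𝒩.vertex k) z ⊆ 𝒩.carrier)
    (hκT : 2 * κ ≤ T - t) (hκρ : 2 * κ * K₀ < ρ) (hK : 0 ≤ K)
    (hKC : C * (3 + (2 * K₀) ^ p) + 2 * |c₀| + 1 ≤ C₀ * K ^ (p - 1))
    (hX : ‖y c - y t‖ ≤ κ) : ‖y c - y t‖ ≤ max 1 (C₀ * K ^ p) * (c - t) := by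
  set X := ‖y c - y t‖ with hXdef
  have hX0 : 0 ≤ X := norm_nonneg _
  -- If `X ≤ c - t`, the mean speed is at most one. Otherwise the unit-speed competitor reaches the
  -- vertex later than `y`, at time `s₁ > c`.
  rcases le_or_gt X (c - t) with hle | hlt
  · exact hle.trans (le_mul_of_one_le_left (by linarith) (le_max_left _ _))
  have hXpos : 0 < X := by linarith
  have htT := htc.trans hcT
  have hpath := hopt.isPath hp.le htT
  have hL := integrableAlongPaths_runningCost hp hb.assumptions
  set s₁ := t + X with hs₁
  set s₂ := t + 2 * X with hs₂
  have h12 : s₁ < s₂ := by linarith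
  have ht1 : t < s₁ := by linarith
  have hc2 : c ≤ s₂ := by linarith
  have h2T : s₂ ≤ T := by linarith
  have ht2 : t ≤ s₂ := by linarith
  have hd2 : ‖y s₂ - y c‖ ≤ K₀ * (s₂ - c) :=
    (hpath.mono hp.le htc h2T).norm_sub_le_of_velocity_le hp.le hc2 (by
      filter_upwards [hv] with s hs hs'
      exact hs ⟨hs'.1, hs'.2.trans_le h2T⟩)
  -- Between `c` and `s₂`, a time of at most `2 * X`, the trajectory moves by at most `2 * K₀ * X`,
  -- and the competitor has time `X` to cover it.
  have hd2' : ‖y s₂ - y c‖ ≤ 2 * K₀ * (s₂ - s₁) := by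
    refine hd2.trans ?_
    have : K₀ * (s₂ - c) ≤ K₀ * (2 * X) := mul_le_mul_of_nonneg_left (by linarith) hK₀
    have e : s₂ - s₁ = X := by rw [hs₁, hs₂]; ring
    rw [e]; linarith
  have hseg2 : segment ℝ (y c) (y s₂) ⊆ 𝒩.carrier := by
    rw [hc]
    refine hρ k _ (hpath.mapsTo ⟨ht2, h2T⟩) ?_
    rw [dist_eq_norm, ← hc]
    have : 2 * K₀ * (s₂ - s₁) ≤ 2 * κ * K₀ := by
      have e : s₂ - s₁ = X := by rw [hs₁, hs₂]; ring
      rw [e]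
      nlinarith
    linarith
  have hRt := hyR t ⟨le_rfl, htT⟩
  have hRc := hyR c ⟨htc, hcT⟩
  have hR2 := hyR s₂ ⟨ht2, h2T⟩
  have p1 := IsPath.affine (p := p) ht1 hseg
  have p2 := IsPath.affine (p := p) h12 hseg2
  have q1 := integral_affine_le (q := 1) hp hb.assumptions hb.nonneg hb.bound ht ht1
    (h12.le.trans h2T) hseg hRt hRc (by rw [one_mul, hs₁, add_sub_cancel_left])
  have q2 := integral_affine_le hp hb.assumptions hb.nonneg hb.bound (ht.trans ht1.le) h12 h2T
    hseg2 hRc hR2 hd2'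
  have i1 := hL _ _ _ _ ht ht1.le (h12.le.trans h2T) p1
  have i2 := hL _ _ _ _ (ht.trans ht1.le) h12.le h2T p2
  have hcat := p1.concat hp.le ht1.le h12.le p2 (by
    have h1 : s₁ - t ≠ 0 := by linarith
    simp [div_self h1])
  have hle := hopt.integral_le hp.le ht hL le_rfl ht2 h2T hcat (by simp [ht1.le])
    (by
      have h1 : s₂ - s₁ ≠ 0 := by linarith
      simp [not_le.2 h12, div_self h1])
  rw [integral_concat ht1.le h12.le i1 i2] at hle
  have hlow := integral_runningCost_ge hp hb.assumptions hb.coercive hb.coercive_star hb.pos ht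
    h2T ht2 (hpath.mono hp.le le_rfl h2T)
  have hlin := (hpath.mono hp.le (le_refl t) hcT).le_integral_rpow hp htc hK
  have hmono : ∫ s in t..c, ‖v s‖ ^ p ≤ ∫ s in t..s₂, ‖v s‖ ^ p :=
    intervalIntegral.integral_mono_interval le_rfl htc hc2
      (Filter.Eventually.of_forall fun s => by simp only [Pi.zero_apply]; positivity)
      ((hpath.mono hp.le (le_refl t) h2T).intervalIntegrable_rpow hp.le ht2)
  have e1 : s₁ - t = X := by rw [hs₁]; ring
  have e2 : s₂ - s₁ = X := by rw [hs₁, hs₂]; ring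
  have e3 : s₂ - t = 2 * X := by rw [hs₂]; ring
  -- The two legs cost at most `2 * C * X` and `C * (1 + (2 * K₀) ^ p) * X`, and coercivity on `[t,
  -- s₂]` loses `2 * |c₀| * X`. The condition `hKC` absorbs all of this and leaves one `X`.
  have hup := hle.trans (add_le_add q1 q2)
  rw [e1, e2, Real.one_rpow] at hup
  rw [e3] at hlow
  have h6 := mul_le_mul_of_nonneg_left (hlin.trans hmono) hb.pos.le
  have h7 := mul_le_mul_of_nonneg_right hKC hX0
  have h9 : -(|c₀| * (2 * X)) ≤ c₀ * (2 * X) := by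
    rw [← neg_mul]
    exact mul_le_mul_of_nonneg_right (neg_abs_le c₀) (by linarith)
  have h10 : X ≤ C₀ * K ^ p * (c - t) := by
    rw [← hXdef] at h6
    nlinarith
  exact h10.trans (mul_le_mul_of_nonneg_right (le_max_right _ _) (by linarith))

end Comparison

end Network

/-! ### Uniform bound on optimal velocities -/

/-- The nearest points of `Z` on both sides of `s`; `t` and `T` are inserted as fallbacks when there
is none. -/
theorem exists_maximal_Ioo {Z : Set ℝ} (hZ : IsClosed Z) {t T s : ℝ} (hts : t < s) (hsT : s < T)
    (hs : s ∉ Z) : ∃ c d, t ≤ c ∧ c < s ∧ s < d ∧ d ≤ T ∧ Disjoint (Ioo c d) Z ∧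
      (c = t ∨ c ∈ Z) ∧ (d = T ∨ d ∈ Z) := by
  have h1 : IsCompact (insert t (Z ∩ Icc t s)) := (isCompact_Icc.inter_left hZ).insert t
  have h2 : IsCompact (insert T (Z ∩ Icc s T)) := (isCompact_Icc.inter_left hZ).insert T
  obtain ⟨c, hc, hc'⟩ := h1.exists_isGreatest ⟨t, mem_insert _ _⟩
  obtain ⟨d, hd, hd'⟩ := h2.exists_isLeast ⟨T, mem_insert _ _⟩
  have hcs : c < s := by
    rcases hc with rfl | hc
    · exact hts
    · exact lt_of_le_of_ne hc.2.2 fun h => hs (h ▸ hc.1)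
  have hsd : s < d := by
    rcases hd with rfl | hd
    · exact hsT
    · exact lt_of_le_of_ne hd.2.1 fun h => hs (h ▸ hd.1)
  have htc : t ≤ c := hc' (mem_insert _ _)
  have hdT : d ≤ T := hd' (mem_insert _ _)
  refine ⟨c, d, htc, hcs, hsd, hdT, ?_, hc.imp id fun h => h.1, hd.imp id fun h => h.1⟩
  rw [disjoint_left]
  intro u hu huZ
  rcases le_total u s with h | h
  · exact (hc' (mem_insert_of_mem _ ⟨huZ, htc.trans hu.1.le, h⟩)).not_gt hu.1
  · exact (hd' (mem_insert_of_mem _ ⟨huZ, h, hu.2.le.trans hdT⟩)).not_gt hu.2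

/-- A locally null set is null, so the excursions need not be enumerated. -/
theorem ae_le_of_locally {f : ℝ → ℝ} {K : ℝ} {S : Set ℝ}
    (h : ∀ s ∈ S, ∃ c d, c < s ∧ s < d ∧ ∀ᵐ u, u ∈ Ioo c d → f u ≤ K) :
    ∀ᵐ s, s ∈ S → f s ≤ K := by
  have h0 : volume {s | s ∈ S ∧ K < f s} = 0 := by
    refine measure_null_of_locally_null _ fun s hs => ?_
    obtain ⟨c, d, hc, hd, hae⟩ := h s hs.1
    refine ⟨{u | u ∈ Ioo c d ∧ K < f u}, ?_, ?_⟩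
    · filter_upwards [self_mem_nhdsWithin, mem_nhdsWithin_of_mem_nhds (Ioo_mem_nhds hc hd)]
        with u hu hu' using ⟨hu', hu.2⟩
    · rw [measure_eq_zero_iff_ae_notMem]
      filter_upwards [hae] with u hu hu'
      exact (hu hu'.1).not_gt hu'.2
  filter_upwards [measure_eq_zero_iff_ae_notMem.1 h0] with s hs hsS
  by_contra hlt
  exact hs ⟨hsS, not_le.1 hlt⟩

/-- A bound on optimal velocities for each ball of initial positions and each lower bound of the
time to maturity gives a bound that is monotone in both. -/
theorem optimalVelocitiesBounded_of_exists {d : ℕ} {p T : ℝ}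
    {G : Set (EuclideanSpace ℝ (Fin d))}
    {L : EuclideanSpace ℝ (Fin d) → EuclideanSpace ℝ (Fin d) → ℝ → ℝ}
    {g : EuclideanSpace ℝ (Fin d) → ℝ}
    (h : ∀ R τ : ℝ, 0 < τ → ∃ K, ∀ x y v t, t ∈ Icc 0 T → ‖x‖ ≤ R → τ ≤ T - t →
      IsOptimal p T G L g x t y v → ∀ᵐ s, s ∈ Ioo t T → ‖v s‖ ≤ K) :
    OptimalVelocitiesBounded p T G L g := by
  set S : ℝ → ℝ → Set ℝ := fun R τ => {K | 0 ≤ K ∧ ∀ x y v t, t ∈ Icc 0 T → ‖x‖ ≤ R →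
    τ ≤ T - t → IsOptimal p T G L g x t y v → ∀ᵐ s, s ∈ Ioo t T → ‖v s‖ ≤ K} with hS
  have hbdd : ∀ R τ, BddBelow (S R τ) := fun R τ => ⟨0, fun K hK => hK.1⟩
  have hne : ∀ R τ, 0 < τ → (S R τ).Nonempty := by
    intro R τ hτ
    obtain ⟨K, hK⟩ := h R τ hτ
    refine ⟨max K 0, le_max_right _ _, fun x y v t ht hx hτt hopt => ?_⟩
    filter_upwards [hK x y v t ht hx hτt hopt] with s hs hs'
    exact (hs hs').trans (le_max_left _ _)
  -- The set of valid bounds shrinks as `R` grows or `τ` decreases, so its infimum is monotone as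
  -- required. Adding `1` gives positivity and a valid bound below the value even if the infimum is
  -- not attained. For `τ ≤ 0` the value is a convention.
  refine ⟨fun R τ => if 0 < τ then 1 + sInf (S R τ) else 1, ?_, ?_, ?_, ?_⟩
  · intro R τ
    have : 0 ≤ sInf (S R τ) := Real.sInf_nonneg fun K hK => hK.1
    simp only
    split_ifs <;> linarith
  · intro τ R R' hRR
    simp only
    split_ifs with hτ
    · refine add_le_add le_rfl (csInf_le_csInf (hbdd _ _) (hne _ _ hτ) fun K hK => ⟨hK.1, ?_⟩)
      exact fun x y v t ht hx hτt hopt => hK.2 x y v t ht (hx.trans hRR) hτt hopt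
    · exact le_rfl
  · intro R τ hτ τ' hτ' hττ
    simp only [if_pos (mem_Ioi.1 hτ), if_pos (mem_Ioi.1 hτ')]
    refine add_le_add le_rfl (csInf_le_csInf (hbdd _ _) (hne _ _ hτ) fun K hK => ⟨hK.1, ?_⟩)
    exact fun x y v t ht hx hτt hopt => hK.2 x y v t ht hx (hττ.trans hτt) hopt
  · intro x _ t ht y v hopt
    have hvm : AEStronglyMeasurable v (volume.restrict (Ioo t T)) :=
      hopt.1.memW1p.memLp_deriv.1
    rcases ht.2.eq_or_lt with heq | hlt
    · subst heq
      simp only [Ioo_self, Measure.restrict_empty, eLpNorm_measure_zero, zero_le, and_true]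
      exact MemLp.of_bound (aestronglyMeasurable_zero_measure _) 0 (by simp)
    · have hτ : 0 < T - t := by linarith
      obtain ⟨K, hK, hKlt⟩ := exists_lt_of_csInf_lt (hne ‖x‖ _ hτ)
        (show sInf (S ‖x‖ (T - t)) < 1 + sInf (S ‖x‖ (T - t)) by linarith)
      have hb : ∀ᵐ s ∂(volume.restrict (Ioo t T)), ‖v s‖ ≤ 1 + sInf (S ‖x‖ (T - t)) := by
        rw [ae_restrict_iff' measurableSet_Ioo]
        filter_upwards [hK.2 x y v t ht le_rfl le_rfl hopt] with s hs hs'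
        exact (hs hs').trans hKlt.le
      refine ⟨MemLp.of_bound hvm _ hb, ?_⟩
      simp only [if_pos hτ]
      refine (eLpNorm_le_of_ae_bound hb).trans ?_
      simp

namespace Network

variable {d n N : ℕ} {𝒩 : Network d n N} {p T : ℝ} {ℓ : Fin N → ℝ → ℝ → ℝ → ℝ}
  {ℓstar : Fin n → ℝ → ℝ} {g : Fin N → ℝ → ℝ} {gstar : Fin n → ℝ}

theorem exists_lipschitz_terminalCost (hg : TerminalCostAssumptions 𝒩.dom g) (r : ℝ) :
    ∃ Λ, 0 ≤ Λ ∧ ∀ i, ∀ q ∈ 𝒩.dom i ∩ Icc 0 r, ∀ q' ∈ 𝒩.dom i ∩ Icc 0 r,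
      |g i q - g i q'| ≤ Λ * |q - q'| := by
  have h : ∀ i, ∃ Λ : NNReal, LipschitzOnWith Λ (g i) (𝒩.dom i ∩ Icc 0 r) := fun i =>
    ((hg.contDiffOn i).mono inter_subset_left).exists_lipschitzOnWith one_ne_zero
      ((𝒩.convex_dom i).inter (convex_Icc _ _)) (isCompact_Icc.inter_left (𝒩.isClosed_dom i))
  choose Λ hΛ using h
  refine ⟨∑ i, (Λ i : ℝ), Finset.sum_nonneg fun i _ => (Λ i).2, fun i q hq q' hq' => ?_⟩
  have h1 := (hΛ i).dist_le_mul q hq q' hq'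
  rw [Real.dist_eq, Real.dist_eq] at h1
  refine h1.trans (mul_le_mul_of_nonneg_right ?_ (abs_nonneg _))
  exact Finset.single_le_sum (f := fun i => (Λ i : ℝ)) (fun j _ => (Λ j).2) (Finset.mem_univ i)

/-- Around every time at which a path is not at a vertex, it stays inside one edge, until it
reaches a vertex or an endpoint of the time interval. -/
theorem exists_excursion {t s : ℝ} {y v : ℝ → EuclideanSpace ℝ (Fin d)} (hp : 1 ≤ p)
    (hpath : IsPath p 𝒩.carrier t T y v) (hs : s ∈ Ioo t T) (hv : y s ∉ 𝒩.vertices) :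
    ∃ c c' i, t ≤ c ∧ c < s ∧ s < c' ∧ c' ≤ T ∧
      (∀ u ∈ Icc c c', y u ∈ 𝒩.edge i) ∧ (∀ u ∈ Ioo c c', y u ∉ 𝒩.vertices) ∧
      (c = t ∨ y c ∈ 𝒩.vertices) ∧ (c' = T ∨ y c' ∈ 𝒩.vertices) := by
  have htT := (hs.1.trans hs.2).le
  have hyc := hpath.continuousOn hp htT
  have hZ : IsClosed (Icc t T ∩ y ⁻¹' 𝒩.vertices) :=
    hyc.preimage_isClosed_of_isClosed isClosed_Icc 𝒩.isClosed_vertices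
  obtain ⟨c, c', htc, hcs, hsc, hcT, hdisj, h1, h2⟩ :=
    exists_maximal_Ioo hZ hs.1 hs.2 fun h => hv h.2
  have hsub : Icc c c' ⊆ Icc t T := Icc_subset_Icc htc hcT
  have hnv : ∀ u ∈ Ioo c c', y u ∉ 𝒩.vertices := fun u hu hu' =>
    disjoint_left.1 hdisj hu ⟨hsub (Ioo_subset_Icc_self hu), hu'⟩
  have hcI : ContinuousOn y (Icc c c') := hyc.mono hsub
  obtain ⟨i, hi⟩ := 𝒩.exists_subset_edge (S := y '' Ioo c c')
    (isPreconnected_Ioo.image y (hcI.mono Ioo_subset_Icc_self)) ⟨y s, s, ⟨hcs, hsc⟩, rfl⟩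
    (by rintro _ ⟨u, hu, rfl⟩; exact hpath.mapsTo (hsub (Ioo_subset_Icc_self hu)))
    (by
      rw [disjoint_left]
      rintro _ ⟨u, hu, rfl⟩
      exact hnv u hu)
  refine ⟨c, c', i, htc, hcs, hsc, hcT, fun u hu => ?_, hnv, h1.imp id fun h => h.2,
    h2.imp id fun h => h.2⟩
  -- The edge is closed, so the endpoints of the excursion belong to it as well.
  have hcl : u ∈ closure (Ioo c c') := by rwa [closure_Ioo (hcs.trans hsc).ne]
  have := (hcI u hu).mono Ioo_subset_Icc_self |>.mem_closure_image hcl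
  exact (𝒩.isClosed_edge i).closure_subset_iff.2 hi this

/-- All constants precede the trajectory. The order matters: `m` and `K₀` serve the excursions that
start at a vertex or end off the vertices and do not involve `τ`; `κ` depends on `K₀` and `τ`; then
`m'` and `K` serve the remaining excursion. -/
theorem exists_velocity_bound (hp : 1 < p) (hT : 0 < T)
    (hA : RunningCostAssumptions p T 𝒩.dom ℓ ℓstar) (hg : TerminalCostAssumptions 𝒩.dom g)
    (R τ : ℝ) (hτ : 0 < τ) : ∃ K, ∀ x y v t, t ∈ Icc 0 T → ‖x‖ ≤ R → τ ≤ T - t →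
      IsOptimal p T 𝒩.carrier (𝒩.runningCost ℓ ℓstar) (𝒩.terminalCost g gstar) x t y v →
      ∀ᵐ s, s ∈ Ioo t T → ‖v s‖ ≤ K := by
  obtain ⟨C₀, c₀, hC₀, hco, hco'⟩ := hA.coercive
  obtain ⟨E, hE0, hE⟩ := exists_energy_bound (gstar := gstar) hp hA hT hg hC₀ hco hco' R
  have hp1 : 0 < p - 1 := by linarith
  -- The displacement is at most `∫ ‖v‖ ≤ ∫ (1 + ‖v‖ ^ p) ≤ E`.
  set R' := R + E with hR'
  obtain ⟨C₁, hC₁, hbd⟩ := exists_runningCost_bound hp hA R'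
  have hb : CostBounds 𝒩 p T ℓ ℓstar C₀ c₀ R' C₁ := ⟨hA, hC₀, hco, hco', hC₁, hbd⟩
  obtain ⟨r, hr, hcoord⟩ := exists_coord_bound (𝒩 := 𝒩) R'
  -- The extra `1` leaves room for variations around coordinates in `[0, r]`.
  obtain ⟨C, hC, -, hgrowth⟩ := hA.exists_growth_bound hp 𝒩.isClosed_dom (r + 1)
  have hgr : ∀ i, HasGrowth p T (r + 1) C (𝒩.dom i) (ℓ i) := fun i => hgrowth i
  obtain ⟨Λ, hΛ0, hΛ⟩ := exists_lipschitz_terminalCost hg r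
  obtain ⟨κ₁, hκ₁, hgap⟩ := 𝒩.exists_vertex_gap
  obtain ⟨ρ, hρ, hstar⟩ := 𝒩.exists_star_radius
  -- `k₁` serves the comparison with stopping, `k₂` the crossing of a whole edge.
  obtain ⟨k₁, hk₁, -, hk₁'⟩ := exists_rpow_gt hp1 hC₀ (Λ + 1) 0
  obtain ⟨k₂, hk₂, -, hk₂'⟩ := exists_rpow_gt hp1 hκ₁ (2 * E) 0
  set m := max (C₁ + |c₀| + C₀ * k₁ ^ p) (2 * k₂) with hm
  have hm0 : 0 ≤ m := le_max_of_le_right (by linarith)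
  obtain ⟨K₀, hK₀, -, hK₀'⟩ := exists_rpow_gt hp1 hC₀
    (C * (1 + m ^ (p - 1)) + C * E + (C + |c₀|)) 0
  obtain ⟨κ, hκ, hκτ, hκρ⟩ : ∃ κ > 0, 2 * κ ≤ τ ∧ 2 * κ * K₀ < ρ := by
    refine ⟨min (τ / 2) (ρ / (4 * K₀)), by positivity, ?_, ?_⟩
    · linarith [min_le_left (τ / 2) (ρ / (4 * K₀))]
    · have h1 := min_le_right (τ / 2) (ρ / (4 * K₀))
      have h2 : ρ / (4 * K₀) * K₀ = ρ / 4 := by field_simp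
      have h3 := mul_le_mul_of_nonneg_right h1 (show 0 ≤ K₀ by linarith)
      linarith
  -- `k₃` serves the detour through the vertex when the displacement is at most `κ`, `k₄` the energy
  -- argument when it is at least `κ`.
  obtain ⟨k₃, hk₃, -, hk₃'⟩ := exists_rpow_gt hp1 hC₀
    (C₁ * (3 + (2 * K₀) ^ p) + 2 * |c₀| + 1) 0
  obtain ⟨k₄, hk₄, -, hk₄'⟩ := exists_rpow_gt hp1 hκ (2 * E) 0
  set m' := max (max 1 (C₀ * k₃ ^ p)) (2 * k₄) with hm'
  have hm'0 : 0 ≤ m' := le_max_of_le_right (by linarith)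
  obtain ⟨K, hK, hKK₀, hK'⟩ := exists_rpow_gt hp1 hC₀
    (C * (1 + m' ^ (p - 1)) + C * E + (C + |c₀|)) K₀
  refine ⟨K, fun x y v₀ t ht hx htτ hopt₀ => ?_⟩
  have hpath₀ := hopt₀.isPath hp.le ht.2
  -- Level sets of the speed serve as test sets, so they have to be measurable.
  obtain ⟨v, hv, hvv⟩ : ∃ v : ℝ → EuclideanSpace ℝ (Fin d), Measurable v ∧
      ∀ᵐ s, s ∈ Ioc t T → v s = v₀ s := by
    refine ⟨hpath₀.memLp.1.mk v₀, hpath₀.memLp.1.stronglyMeasurable_mk.measurable, ?_⟩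
    have := hpath₀.memLp.1.ae_eq_mk
    rw [Filter.EventuallyEq, ae_restrict_iff' measurableSet_Ioc] at this
    filter_upwards [this] with s hs hs' using (hs hs').symm
  have hopt := hopt₀.congr_velocity hp.le ht.2 hvv
  suffices hmain : ∀ᵐ s, s ∈ Ioo t T → ‖v s‖ ≤ K by
    filter_upwards [hmain, hvv] with s h1 h2 hs
    rw [← h2 (Ioo_subset_Ioc_self hs)]
    exact h1 hs
  clear hvv hopt₀ hpath₀
  have hpath := hopt.isPath hp.le ht.2
  have hEy := hE x y v t ht hx hopt
  have hQ : C * (∫ s in t..T, (1 + ‖v s‖ ^ p)) ≤ C * E := mul_le_mul_of_nonneg_left hEy hC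
  have hI : IntervalIntegrable (fun s => 1 + ‖v s‖ ^ p) volume t T :=
    intervalIntegrable_const.add (hpath.intervalIntegrable_rpow hp.le ht.2)
  have henergy : ∀ a b, t ≤ a → a ≤ b → b ≤ T → ∫ s in a..b, (1 + ‖v s‖ ^ p) ≤ E := by
    intro a b hta hab hbT
    refine le_trans ?_ hEy
    exact intervalIntegral.integral_mono_interval hta hab hbT
      (Filter.Eventually.of_forall fun s => by simp only [Pi.zero_apply]; positivity) hI
  have hsubI : ∀ a b, t ≤ a → a ≤ b → b ≤ T →
      IntervalIntegrable (fun s => 1 + ‖v s‖ ^ p) volume a b := fun a b hta hab hbT =>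
    hI.mono_set (by rw [uIcc_of_le hab, uIcc_of_le ht.2]; exact Icc_subset_Icc hta hbT)
  have henergy' : ∀ a b, t ≤ a → a ≤ b → b ≤ T → ∫ s in a..b, ‖v s‖ ^ p ≤ E := by
    intro a b hta hab hbT
    refine le_trans ?_ (henergy a b hta hab hbT)
    exact intervalIntegral.integral_mono_on hab
      ((hpath.mono hp.le hta hbT).intervalIntegrable_rpow hp.le hab) (hsubI a b hta hab hbT)
      fun s _ => by linarith
  have hyR : ∀ s ∈ Icc t T, ‖y s‖ ≤ R' := by
    intro s hs
    have h1 := (hpath.mono hp.le (le_refl t) hs.2).norm_sub_le_integral hp.le hs.1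
    have h2 : ∫ u in t..s, ‖v u‖ ≤ ∫ u in t..s, (1 + ‖v u‖ ^ p) :=
      intervalIntegral.integral_mono_on hs.1
        ((hpath.mono hp.le (le_refl t) hs.2).intervalIntegrable hp.le hs.1).norm
        (hsubI t s le_rfl hs.1 hs.2) fun u _ => abs_le_one_add_rpow hp.le (norm_nonneg _)
    have h3 := henergy t s le_rfl hs.1 hs.2
    have h4 := norm_le_norm_add_norm_sub' (y s) (y t)
    rw [hopt.1.start] at h1 h4
    linarith
  have hcr : ∀ i, ∀ s ∈ Icc t T, y s ∈ 𝒩.edge i → 𝒩.coord i (y s) ∈ 𝒩.dom i ∩ Icc 0 r :=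
    fun i s hs hi => hcoord i _ hi (hyR s hs)
  have hvert := ae_velocity_vertex hp.le ht.2 hpath
  -- excursions with a bound on the mean velocity
  have hbound : ∀ c c' i μ κ', 0 ≤ μ → 1 ≤ κ' →
      C * (1 + μ ^ (p - 1)) + C * E + (C + |c₀|) < C₀ * κ' ^ (p - 1) → t ≤ c → c < c' → c' ≤ T →
      (∀ u ∈ Icc c c', y u ∈ 𝒩.edge i) → (∀ u ∈ Ioo c c', y u ∉ 𝒩.vertices) →
      |𝒩.coord i (y c') - 𝒩.coord i (y c)| ≤ μ * (c' - c) →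
      ∀ᵐ s, s ∈ Ioo c c' → ‖v s‖ ≤ κ' := by
    intro c c' i μ κ' hμ hκ' hμκ htc hcc hcT hedge hnv hmean
    have hsub : ∀ u ∈ Ioo c c', u ∈ Icc t T := fun u hu =>
      ⟨htc.trans hu.1.le, hu.2.le.trans hcT⟩
    exact velocity_le_of_mean_le hp hA hC₀.le hco ht.1 hopt hv (hgr i) hC hμ hκ' hμκ htc hcc hcT
      (fun u hu => ⟨hedge u (Ioo_subset_Icc_self hu), hnv u hu⟩)
      (fun u hu => by
        have := (hcr i u (hsub u hu) (hedge u (Ioo_subset_Icc_self hu))).2.2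
        linarith) hQ hmean
  -- excursions that start at a vertex or do not end at a vertex
  have hgood : ∀ c c' i, t ≤ c → c < c' → c' ≤ T → (∀ u ∈ Icc c c', y u ∈ 𝒩.edge i) →
      (∀ u ∈ Ioo c c', y u ∉ 𝒩.vertices) → (c' = T ∨ y c' ∈ 𝒩.vertices) →
      (y c ∈ 𝒩.vertices ∨ y c' ∉ 𝒩.vertices) → ∀ᵐ s, s ∈ Ioo c c' → ‖v s‖ ≤ K₀ := by
    intro c c' i htc hcc hcT hedge hnv hend hcase
    refine hbound c c' i m K₀ hm0 hK₀ hK₀' htc hcc hcT hedge hnv ?_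
    have hec := hedge c ⟨le_rfl, hcc.le⟩
    have hec' := hedge c' ⟨hcc.le, le_rfl⟩
    have hlen : 0 ≤ c' - c := by linarith
    by_cases hv' : y c' ∈ 𝒩.vertices
    · have hvc : y c ∈ 𝒩.vertices := hcase.resolve_right fun h => h hv'
      rcases hgap i _ (𝒩.coord_mem_dom hec') _ (𝒩.coord_mem_dom hec)
        (by rwa [𝒩.param_coord hec']) (by rwa [𝒩.param_coord hec]) with h | h
      · rw [h, sub_self, abs_zero]
        positivity
      · rw [← norm_sub_eq_abs_coord_sub hec' hec] at h ⊢
        refine ((hpath.mono hp.le htc hcT).norm_sub_le_of_energy_le hp hcc.le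
          (henergy' c c' htc hcc.le hcT) hk₂ hk₂' h).trans ?_
        exact mul_le_mul_of_nonneg_right (le_max_right _ _) hlen
    · have hcT' : c' = T := hend.resolve_right hv'
      subst hcT'
      refine (mean_le_of_terminal hp hb ht.1 hopt hyR htc hcc.le hec hec' hv'
        (hΛ i _ (hcr i _ ⟨ht.2, le_rfl⟩ hec') _ (hcr i _ ⟨htc, hcc.le⟩ hec))
        (by linarith) hk₁'.le).trans ?_
      exact mul_le_mul_of_nonneg_right (le_max_left _ _) hlen
  -- after the first visit to a vertex
  have hafter : ∀ c, t ≤ c → y c ∈ 𝒩.vertices → ∀ᵐ s, s ∈ Ioo c T → ‖v s‖ ≤ K₀ := by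
    intro c htc hvc
    have hloc : ∀ᵐ s, s ∈ {s | s ∈ Ioo c T ∧ y s ∉ 𝒩.vertices} → ‖v s‖ ≤ K₀ := by
      refine ae_le_of_locally fun s hs => ?_
      obtain ⟨a, b, i, hta, has, hsb, hbT, hedge, hnv, h1, h2⟩ :=
        exists_excursion hp.le hpath ⟨htc.trans_lt hs.1.1, hs.1.2⟩ hs.2
      -- An excursion contains no vertex time, so it cannot extend to the left of `c` and must
      -- itself start at a vertex.
      have hca : c ≤ a := by
        by_contra hlt
        exact hnv c ⟨not_le.1 hlt, hs.1.1.trans hsb⟩ hvc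
      have hva : y a ∈ 𝒩.vertices := by
        rcases h1 with h1 | h1
        · rwa [h1, ← le_antisymm (hca.trans h1.le) htc]
        · exact h1
      exact ⟨a, b, has, hsb, hgood a b i hta (has.trans hsb) hbT hedge hnv h2 (Or.inl hva)⟩
    filter_upwards [hloc, hvert] with s h1 h2 hs
    by_cases hvs : y s ∈ 𝒩.vertices
    · rw [h2 ⟨htc.trans_lt hs.1, hs.2⟩ hvs, norm_zero]
      linarith
    · exact h1 ⟨hs, hvs⟩
  have hloc : ∀ᵐ s, s ∈ {s | s ∈ Ioo t T ∧ y s ∉ 𝒩.vertices} → ‖v s‖ ≤ K := by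
    refine ae_le_of_locally fun s hs => ?_
    obtain ⟨c, c', i, htc, hcs, hsc, hcT, hedge, hnv, h1, h2⟩ :=
      exists_excursion hp.le hpath hs.1 hs.2
    refine ⟨c, c', hcs, hsc, ?_⟩
    have hcc := hcs.trans hsc
    by_cases hcase : y c ∈ 𝒩.vertices ∨ y c' ∉ 𝒩.vertices
    · filter_upwards [hgood c c' i htc hcc hcT hedge hnv h2 hcase] with u hu hu'
      exact (hu hu').trans hKK₀.le
    -- Only the excursion from the initial point to the first vertex is left; `hafter` bounds the
    -- speed beyond it.
    · push Not at hcase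
      have hct : c = t := h1.resolve_right hcase.1
      subst hct
      refine hbound c c' i m' K hm'0 hK hK' le_rfl hcc hcT hedge hnv ?_
      have hec := hedge c ⟨le_rfl, hcc.le⟩
      have hec' := hedge c' ⟨hcc.le, le_rfl⟩
      rw [← norm_sub_eq_abs_coord_sub hec' hec]
      have hlen : 0 ≤ c' - c := by linarith
      rcases le_total κ ‖y c' - y c‖ with hX | hX
      · refine ((hpath.mono hp.le le_rfl hcT).norm_sub_le_of_energy_le hp hcc.le
          (henergy' c c' le_rfl hcc.le hcT) hk₄ hk₄' hX).trans ?_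
        exact mul_le_mul_of_nonneg_right (le_max_right _ _) hlen
      · obtain ⟨k, hk⟩ := hcase.2
        refine (mean_le_of_hitting hp hb ht.1 hopt hyR hcc.le hcT hk.symm
          (((𝒩.convex_edge i).segment_subset hec hec').trans (𝒩.edge_subset_carrier i))
          (by linarith) (hafter c' hcc.le hcase.2) hstar (hκτ.trans htτ) hκρ (by linarith)
          hk₃'.le hX).trans ?_
        exact mul_le_mul_of_nonneg_right (le_max_left _ _) hlen
  filter_upwards [hloc, hvert] with s h1 h2 hs
  by_cases hvs : y s ∈ 𝒩.vertices
  · rw [h2 hs hvs, norm_zero]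
    linarith
  · exact h1 ⟨hs, hvs⟩

theorem optimalVelocitiesBounded (hp : 1 < p) (hT : 0 < T)
    (hA : RunningCostAssumptions p T 𝒩.dom ℓ ℓstar) (hg : TerminalCostAssumptions 𝒩.dom g)
    (gstar : Fin n → ℝ) : OptimalVelocitiesBounded p T 𝒩.carrier (𝒩.runningCost ℓ ℓstar)
      (𝒩.terminalCost g gstar) :=
  optimalVelocitiesBounded_of_exists (exists_velocity_bound hp hT hA hg)

end Network

/-! ### Junctions as networks -/

theorem junctionEdge_inter {N : ℕ} {i j : Fin N} (hij : i ≠ j) :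
    rayPoint 0 (EuclideanSpace.single i (1 : ℝ)) '' edgeDomain ⊤ ∩
      rayPoint 0 (EuclideanSpace.single j (1 : ℝ)) '' edgeDomain ⊤ = {0} := by
  ext z
  constructor
  · rintro ⟨⟨r, -, rfl⟩, r', -, h⟩
    have := congrArg (fun z : EuclideanSpace ℝ (Fin N) => z i) h
    have hr : r = 0 := by simpa [rayPoint, hij, eq_comm] using this
    simp [rayPoint, hr]
  · rintro rfl
    exact ⟨⟨0, ⟨le_rfl, by simp⟩, by simp [rayPoint]⟩, 0, ⟨le_rfl, by simp⟩, by simp [rayPoint]⟩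

/-- The junction with `N` half-lines, as a network with one vertex. -/
noncomputable def junctionNetwork {N : ℕ} : Network N 1 N where
  vertex _ := 0
  src _ := 0
  dir i := EuclideanSpace.single i 1
  len _ := ⊤
  vertex_injective := Function.injective_of_subsingleton _
  norm_dir i := by simp
  len_pos i := by simp
  endpoint i h := absurd rfl h
  vertex_on_edge i r _ _ h := by
    left
    have := congrArg (fun z : EuclideanSpace ℝ (Fin N) => z i) h
    simpa [rayPoint] using this
  inter_subset i j hij := by
    rw [junctionEdge_inter hij]
    exact singleton_subset_iff.2 ⟨0, rfl⟩
  inter_subsingleton i j hij := by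
    rw [junctionEdge_inter hij]
    exact subsingleton_singleton
  connected := by
    have hstar : StarConvex ℝ 0 (range (fun _ : Fin 1 => (0 : EuclideanSpace ℝ (Fin N))) ∪
        ⋃ i : Fin N, rayPoint 0 (EuclideanSpace.single i 1) '' edgeDomain ⊤) := by
      refine StarConvex.union ?_ (starConvex_iUnion fun i => ?_)
      · rw [range_const]
        exact starConvex_singleton _
      · rw [edgeDomain_top, starConvex_zero_iff]
        rintro _ ⟨r, hr, rfl⟩ a ha _
        exact ⟨a * r, mul_nonneg ha hr, by simp [rayPoint, mul_smul]⟩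
    exact (hstar.isPathConnected (Or.inl ⟨0, rfl⟩)).isConnected

section Junction

variable {N : ℕ}

theorem junctionNetwork_edge (i : Fin N) : (junctionNetwork (N := N)).edge i = junctionEdge i := by
  ext z
  simp only [Network.edge, Network.dom, junctionNetwork, edgeDomain_top, Network.param, rayPoint,
    junctionEdge, mem_image, mem_Ici, zero_add]
  exact ⟨fun ⟨r, hr, h⟩ => ⟨r, hr, h.symm⟩, fun ⟨r, hr, h⟩ => ⟨r, hr, h.symm⟩⟩

theorem junctionNetwork_vertex (k : Fin 1) : (junctionNetwork (N := N)).vertex k = 0 := rfl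

theorem junctionNetwork_vertices : (junctionNetwork (N := N)).vertices = {0} := range_const

theorem junctionNetwork_dom (i : Fin N) : (junctionNetwork (N := N)).dom i = Ici 0 :=
  edgeDomain_top

theorem junctionNetwork_carrier (hN : 1 < N) :
    (junctionNetwork (N := N)).carrier = junction N := by
  unfold Network.carrier junction
  rw [junctionNetwork_vertices]
  simp only [junctionNetwork_edge]
  refine union_eq_right.2 (singleton_subset_iff.2 (mem_iUnion.2 ⟨⟨0, by omega⟩, 0, le_rfl, ?_⟩))
  simp

theorem junctionNetwork_coord (i : Fin N) (z : EuclideanSpace ℝ (Fin N)) :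
    (junctionNetwork (N := N)).coord i z = z i := by
  simp [Network.coord, junctionNetwork, EuclideanSpace.inner_single_left]

/-- The junction costs measure position by the norm, the network costs by the coordinate along the
edge. -/
theorem norm_eq_apply_of_mem_junctionEdge {i : Fin N} {z : EuclideanSpace ℝ (Fin N)}
    (hz : z ∈ junctionEdge i) : ‖z‖ = z i := by
  obtain ⟨r, hr, rfl⟩ := hz
  simp [norm_smul, abs_of_nonneg hr]

theorem junctionNetwork_adjacent (k : Fin 1) :
    (junctionNetwork (N := N)).adjacent k = Finset.univ := by
  ext i
  simp only [Network.adjacent, Finset.mem_filter, Finset.mem_univ, true_and, iff_true]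
  rw [junctionNetwork_edge]
  exact ⟨0, le_rfl, by simp [junctionNetwork]⟩

theorem junctionNetwork_runningCost (ℓ : Fin N → ℝ → ℝ → ℝ → ℝ) (ℓstar : ℝ → ℝ) :
    (junctionNetwork (N := N)).runningCost ℓ (fun _ => ℓstar) = junctionRunningCost ℓ ℓstar := by
  funext z a s
  unfold Network.runningCost junctionRunningCost
  rw [Fin.sum_univ_one]
  congr 1
  · refine Finset.sum_congr rfl fun i _ => ?_
    rw [junctionNetwork_edge, junctionNetwork_vertices]
    by_cases h : z ∈ junctionEdge i \ {0}
    · rw [indicator_of_mem h, indicator_of_mem h, junctionNetwork_coord,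
        norm_eq_apply_of_mem_junctionEdge h.1]
      simp [junctionNetwork, EuclideanSpace.inner_single_left]
    · rw [indicator_of_notMem h, indicator_of_notMem h]
  · rw [junctionNetwork_adjacent]
    by_cases h : z = 0
    · subst h
      simp [junctionNetwork_coord, junctionNetwork_vertex]
    · simp [h, junctionNetwork_vertex]

theorem junctionNetwork_terminalCost (g : Fin N → ℝ → ℝ) (gstar : ℝ) :
    (junctionNetwork (N := N)).terminalCost g (fun _ => gstar) = junctionTerminalCost g gstar := by
  funext z
  unfold Network.terminalCost junctionTerminalCost
  rw [Fin.sum_univ_one]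
  congr 1
  · refine Finset.sum_congr rfl fun i _ => ?_
    rw [junctionNetwork_edge, junctionNetwork_vertices]
    by_cases h : z ∈ junctionEdge i \ {0}
    · rw [indicator_of_mem h, indicator_of_mem h, junctionNetwork_coord,
        norm_eq_apply_of_mem_junctionEdge h.1]
    · rw [indicator_of_notMem h, indicator_of_notMem h]
  · rw [junctionNetwork_adjacent]
    by_cases h : z = 0
    · subst h
      simp [junctionNetwork_coord, junctionNetwork_vertex]
    · simp [h, junctionNetwork_vertex]

end Junction

end NetworkControl

theorem mainTheorem4 (p T : ℝ) (hp : 1 < p) (hT : 0 < T) :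
    -- junctions
    (∀ (N : ℕ), 1 < N →
      ∀ (ℓ : Fin N → ℝ → ℝ → ℝ → ℝ) (ℓstar : ℝ → ℝ) (g : Fin N → ℝ → ℝ) (gstar : ℝ),
        NetworkControl.RunningCostAssumptions p T (fun _ : Fin N => Set.Ici 0) ℓ
          (fun _ : Fin 1 => ℓstar) →
        NetworkControl.TerminalCostAssumptions (fun _ : Fin N => Set.Ici 0) g →
        NetworkControl.OptimalVelocitiesBounded p T (NetworkControl.junction N)
          (NetworkControl.junctionRunningCost ℓ ℓstar)
          (NetworkControl.junctionTerminalCost g gstar)) ∧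
    -- general networks
    (∀ (d n N : ℕ) (𝒩 : NetworkControl.Network d n N)
      (ℓ : Fin N → ℝ → ℝ → ℝ → ℝ) (ℓstar : Fin n → ℝ → ℝ)
      (g : Fin N → ℝ → ℝ) (gstar : Fin n → ℝ),
        NetworkControl.RunningCostAssumptions p T 𝒩.dom ℓ ℓstar →
        NetworkControl.TerminalCostAssumptions 𝒩.dom g →
        NetworkControl.OptimalVelocitiesBounded p T 𝒩.carrier
          (𝒩.runningCost ℓ ℓstar) (𝒩.terminalCost g gstar)) := by
  refine ⟨fun N hN ℓ ℓstar g gstar hA hg => ?_,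
    fun d n N 𝒩 ℓ ℓstar g gstar hA hg => 𝒩.optimalVelocitiesBounded hp hT hA hg gstar⟩
  have hdom : (NetworkControl.junctionNetwork (N := N)).dom = fun _ => Set.Ici 0 :=
    funext NetworkControl.junctionNetwork_dom
  have h := NetworkControl.Network.optimalVelocitiesBounded
    (𝒩 := NetworkControl.junctionNetwork (N := N)) (ℓstar := fun _ => ℓstar) hp hT
    (by rw [hdom]; exact hA) (by rw [hdom]; exact hg) (fun _ => gstar)
  rwa [NetworkControl.junctionNetwork_carrier hN, NetworkControl.junctionNetwork_runningCost,
    NetworkControl.junctionNetwork_terminalCost] at h
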